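/- Notation. For $n\ge 1$ odd, let $U_n$ be the uniform distribution on $\{\pm1\}^n$, let $u\odot x$ be the entrywise product, $\langle u,x\rangle=\sum_i u_ix_i$, and $S(x)=\sum_i x_i$. For $f:\{\pm1\}^n\to\mathbb R$ let $T_\rho f(x)=\mathbb E[f(Y)]$, where the coordinates $Y_i\in\{\pm1\}$ are independent with $\mathbb E[Y_i]=\rho x_i$. Let $L_\ell^{(\alpha)}(y)=\frac1{\ell!}y^{-\alpha}e^{y}\frac{d^\ell}{dy^\ell}\bigl(y^{\ell+\alpha}e^{-y}\bigr)$ be the generalized Laguerre polynomials. With $\theta_n(y)=\arctan\sqrt{y/n}$ and $W_n(y)=\sqrt y\,(1+y/n)^{-n/2}$, set \[ \Omega_{\ell,n}(x)=(-1)^\ell\int_0^\infty L_\ell^{(1/2)}(y)\,\frac{y^{1/2}e^{-y}}{W_n(y)}\,\sin\bigl(\theta_n(y)S(x)\bigr)\,dy ,\qquad \widetilde\Omega_{j,n}=\tfrac12(\Omega_{j,n}+\Omega_{j+1,n}), \] and let $\psi_{j,n}=\widetilde\Omega_{j,n}/\|\widetilde\Omega_{j,n}\|_\infty$ be the normalized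 sine--Laguerre witness (defined whenever $\widetilde\Omega_{j,n}\not\equiv0$). For probability distributions on a finite set, with $\mathcal D$ of full support, write $\chi_{\mathcal D}(\mathcal D_1,\mathcal D_2)=\bigl|\mathbb E_{\mathcal D}\bigl[(\tfrac{\mathcal D_1}{\mathcal D}-1)(\tfrac{\mathcal D_2}{\mathcal D}-1)\bigr]\bigr|$. Lemma (hidden-direction family). There exist absolute constants $A>0$ and $c>0$ and constants $C_p$ with $0<C_p\le A^p$ ($p\ge1$) such that the following holds. For every $c_0>0$ and $0<\eta<1/2$ there exist $n_0=n_0(c_0,\eta)\ge1$ and $K=K_{c_0,\eta}>0$ such that for every $0<\rho<1$, every odd $n\ge n_0$ and every integer $m\ge1$ with $m\le c_0n^{1/2-\eta}$, setting $k:=\lfloor (m+1)/2\rfloor$, we have $\widetilde\Omega_{k,n}\not\equiv0$, and for $u\in\{\pm1\}^n$ the functions \[ \mathcal D_u(x,y)=2^{-(n+1)}\bigl(1+y\,\psi_{k,n}(u\odot x)\bigr),\qquad \mathcal D_0(x,y)=2^{-(n+1)}\qquad(x\in\{\pm1\}^n,\ y\in\{\pm1\}) \] are probability distributions. Moreover,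 with $f_u:=T_\rho\bigl(\operatorname{sign}(\langle u,\cdot\rangle)\bigr)$: (i) For every $u\in\{\pm1\}^n$, \[\mathbb E_{(X,Y)\sim\mathcal D_u}[Y f_u(X)]\ \ge\ \frac{K\,\rho^{2m+1}}{\sqrt m}.\] (ii) For every $0<\delta\le1$ and all $u\ne v$ in $\{\pm1\}^n$ with $|\langle u,v\rangle|\le\delta n$, \[ \chi_{\mathcal D_0}(\mathcal D_u,\mathcal D_v)\ \le\ \delta^{2k+1}+\sum_{p=1}^{k+1}C_p\,\frac{k^{2p}}{n^p}\,\delta^{\max\{0,\,2k+1-2p\}} . \] (iii) For every $0<\delta<1$ there is $\mathcal U\subseteq\{\pm1\}^n$ with $|\mathcal U|\ge\lfloor\exp(c\delta^2n)\rfloor$ such that $|\langle u,v\rangle|\le\delta n$ for all distinct $u,v\in\mathcal U$. -/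

import Mathlib

namespace HiddenDirection

noncomputable section

/-- The Boolean cube `{±1}^n`. The entrywise product `u ⊙ x` is the multiplication `u * x` of
functions. -/
abbrev Cube (n : ℕ) : Type := Fin n → ℤˣ

/-- A sign `y ∈ {±1}` as a real number. -/
def sgn (y : ℤˣ) : ℝ := ((y : ℤ) : ℝ)

/-- The inner product `⟨u, x⟩ = ∑ i, u_i x_i`. -/
def dot {n : ℕ} (u x : Cube n) : ℝ := ∑ i, sgn (u i) * sgn (x i)

/-- `S(x) = ∑ i, x_i`. -/
def coordSum {n : ℕ} (x : Cube n) : ℝ := ∑ i, sgn (x i)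

/-- The noise operator `T_ρ f (x) = E f(Y)`, where the coordinates `Y_i ∈ {±1}` are independent
with mean `ρ x_i`, that is, `Y_i = y_i` with probability `(1 + ρ x_i y_i) / 2`. -/
def noise {n : ℕ} (ρ : ℝ) (f : Cube n → ℝ) (x : Cube n) : ℝ :=
  ∑ y : Cube n, (∏ i, (1 + ρ * sgn (x i) * sgn (y i)) / 2) * f y

/-- The generalized Laguerre polynomial `L_m^{(α)}` on `(0, ∞)`, by the Rodrigues formula. -/
def laguerre (α : ℝ) (m : ℕ) (x : ℝ) : ℝ :=
  1 / (m.factorial : ℝ) * x ^ (-α) * Real.exp x *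
    iteratedDeriv m (fun t : ℝ => t ^ ((m : ℝ) + α) * Real.exp (-t)) x

/-- `θ_n(y) = arctan √(y/n)`. -/
def theta (n : ℕ) (y : ℝ) : ℝ := Real.arctan (Real.sqrt (y / n))

/-- `W_n(y) = √y (1 + y/n)^{-n/2}`. -/
def weight (n : ℕ) (y : ℝ) : ℝ := Real.sqrt y * (1 + y / n) ^ (-(n : ℝ) / 2)

/-- The bounded oscillating kernel `sin(θ_n(y) S(x))`. -/
def sineKernel {n : ℕ} (y : ℝ) (x : Cube n) : ℝ := Real.sin (theta n y * coordSum x)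

/-- The `ℓ`-th unnormalized Laguerre witness `Ω_{ℓ,n}`. -/
def laguerreWitness (ℓ n : ℕ) (x : Cube n) : ℝ :=
  (-1) ^ ℓ * ∫ y in Set.Ioi (0 : ℝ),
    laguerre (1 / 2) ℓ y * (y ^ (1 / 2 : ℝ) * Real.exp (-y) / weight n y) * sineKernel y x

/-- The two-term averaged sine-Laguerre witness. -/
def avgWitness (j n : ℕ) (x : Cube n) : ℝ :=
  1 / 2 * (laguerreWitness j n x + laguerreWitness (j + 1) n x)

/-- The normalized sine-Laguerre witness `ψ_{j,n}`: the averaged witness divided by its maximum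
norm over the (finite) cube. It is meaningful when the averaged witness is not identically `0`. -/
def witness (j n : ℕ) (x : Cube n) : ℝ :=
  avgWitness j n x / ⨆ z : Cube n, |avgWitness j n z|

/-- The probability mass function of the reference distribution `D_0` on `{±1}^n × {±1}`. -/
def refDist (n : ℕ) (_ : Cube n × ℤˣ) : ℝ := ((2 : ℝ) ^ (n + 1))⁻¹

/-- The probability mass function of the planted distribution `D_u` on `{±1}^n × {±1}`. -/
def plantedDist (k n : ℕ) (u : Cube n) (z : Cube n × ℤˣ) : ℝ :=
  ((2 : ℝ) ^ (n + 1))⁻¹ * (1 + sgn z.2 * witness k n (u * z.1))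

/-- `p` is the mass function of a probability distribution on a finite set. -/
def IsProbMass {Z : Type*} [Fintype Z] (p : Z → ℝ) : Prop :=
  (∀ z, 0 ≤ p z) ∧ ∑ z, p z = 1

/-- The expectation of `g` under the distribution with mass function `p`. -/
def expect {Z : Type*} [Fintype Z] (p g : Z → ℝ) : ℝ := ∑ z, p z * g z

/-- The pairwise correlation `χ_D(D₁, D₂) = |⟨D₁/D - 1, D₂/D - 1⟩_D|` of mass functions. -/
def pairCorr {Z : Type*} [Fintype Z] (p p₁ p₂ : Z → ℝ) : ℝ :=
  |expect p fun z => (p₁ z / p z - 1) * (p₂ z / p z - 1)|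

/-- The smoothed halfspace `f_u = T_ρ sign(⟨u, ·⟩)`. -/
def smoothedHalfspace {n : ℕ} (ρ : ℝ) (u : Cube n) : Cube n → ℝ :=
  noise ρ fun x => Real.sign (dot u x)

end

end HiddenDirection

open HiddenDirection

namespace HiddenDirection

noncomputable section

open Finset Polynomial

/-! ### Fourier analysis on the cube -/

/-! The product `∏ j, (1 + iτ x_j)` has modulus `(1+τ²)^{n/2}` and argument `S(x) arctan τ`, so the
sine kernel at `τ = √(y/n)` is its imaginary part once the weight `W_n` has removed the modulus.
Hence the witness is an explicit combination of odd elementary symmetric polynomials `e_d`, with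
Laguerre moments as coefficients. Averaging two consecutive indices is Pascal's rule: `e_{2r+1}`
receives `½ (-1)^r C(r+1,k+1) Γ(r+3/2) n^{-(2r+1)/2}` (`avgWitness_eq`), which vanishes for `r < k`.
Write `N` for the maximum norm of the averaged witness.

(i) The Fourier coefficients of majority at degree `2r+1` also carry the sign `(-1)^r`
(`sum_sign_mul_esum`), so the levels never cancel. The levels `k ≤ r < 2k` have degree at most
`2m+1` and alone contribute a constant multiple of `ρ^{2m+1}/√k`, before division by `N`
(`le_expect_plantedDist`). What remains is an upper bound for `N`.

(ii) By orthogonality the pairwise correlation is `N⁻² |∑ c_r² e_{2r+1}(u*v)|`, and Parseval gives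
`N² ≥ ∑ c_r² C(n,2r+1)`. The three-term recurrence of `e_d` bounds `|e_d| / C(n,d)` by `δ^{2k+1}`
plus corrections in powers of `d²/n` (`abs_esum_le_sum`). The level weights decay geometrically
beyond `r` of order `k`, so their moments replace `d` by a multiple of `k`
(`sum_levelWeight_mul_pow_two_mul_le`). No upper bound for `N` is needed here.

(iii) A maximal nearly orthogonal family covers the cube by sets of vectors with large inner
product, and these are exponentially small by a Chernoff bound.

The analytic core is the bound on `N`. The moments of the witness are also those of even Hermite
polynomials, which yields `2i · avgWitness = ∫ t h(t) P(t) exp(-t²) dt` with `P(t) = ∏ (1 + i x_j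
t/√n)` and `h` a multiple of `H_{2k+2}` (`gaussInt_mul_rotPoly`). With `s = S/√n` there are two
regimes. If `|s|` is at least `4√(4k+5)`, shifting the contour by `i√(4k+5)` in the direction of the
sign of `s` makes the integrand small. Otherwise `P(t) = exp(ist + t²/2) · R(t)`, where `R` is
expanded in powers of `1/n` through its differential equation. The terms are Fourier transforms of
polynomials times a Hermite function, which satisfy the harmonic oscillator equation and are
controlled by Sonin's energy argument (`sonin_bound`). Each order costs `Z⁴/n` with `Z` of order
`√k`, so for `k ≤ c₀ n^{1/2-η}` about `1/(2η)` orders suffice. -/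

lemma sgn_mul (a b : ℤˣ) : sgn (a * b) = sgn a * sgn b := by simp [sgn]

lemma sgn_mul_self (a : ℤˣ) : sgn a * sgn a = 1 := by
  rcases Int.units_eq_one_or a with rfl | rfl <;> simp [sgn]

lemma sgn_one : sgn 1 = 1 := by simp [sgn]

lemma sgn_neg_one : sgn (-1) = -1 := by simp [sgn]

lemma sum_units {M : Type*} [AddCommMonoid M] (f : ℤˣ → M) : ∑ y, f y = f 1 + f (-1) := by
  rw [show (univ : Finset ℤˣ) = {1, -1} from rfl, sum_pair (by decide)]

lemma sum_cube_prod {n : ℕ} {R : Type*} [CommSemiring R] (f : Fin n → ℤˣ → R) :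
    ∑ x : Cube n, ∏ i, f i (x i) = ∏ i, (f i 1 + f i (-1)) := by
  simp_rw [← sum_units]
  rw [prod_univ_sum, Fintype.piFinset_univ]

/-- The Walsh character `x ↦ ∏ i ∈ T, x_i`. -/
def chi {n : ℕ} (T : Finset (Fin n)) (x : Cube n) : ℝ := ∏ i ∈ T, sgn (x i)

/-- The elementary symmetric polynomial of degree `d` on the cube. -/
def esum {n : ℕ} (d : ℕ) (x : Cube n) : ℝ := ∑ T ∈ (univ : Finset (Fin n)).powersetCard d, chi T x

lemma chi_eq_prod_ite {n : ℕ} (T : Finset (Fin n)) (x : Cube n) :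
    chi T x = ∏ i, if i ∈ T then sgn (x i) else 1 := by
  simp [chi, prod_ite_mem]

lemma chi_mul {n : ℕ} (T : Finset (Fin n)) (u x : Cube n) : chi T (u * x) = chi T u * chi T x := by
  simp [chi, sgn_mul, prod_mul_distrib]

lemma sum_chi_mul_chi {n : ℕ} (T T' : Finset (Fin n)) :
    ∑ x : Cube n, chi T x * chi T' x = if T = T' then (2 : ℝ) ^ n else 0 := by
  simp_rw [chi_eq_prod_ite, ← prod_mul_distrib]
  rw [sum_cube_prod (fun i y => (if i ∈ T then sgn y else 1) * (if i ∈ T' then sgn y else 1))]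
  split_ifs with h
  · subst h
    rw [prod_congr rfl (g := fun _ => (2 : ℝ))]
    · simp
    · intro i _
      split_ifs <;> simp [sgn_mul_self] <;> norm_num
  · obtain ⟨i, hi⟩ : ∃ i, ¬ (i ∈ T ↔ i ∈ T') := by
      by_contra hc
      push Not at hc
      exact h (Finset.ext hc)
    refine prod_eq_zero (mem_univ i) ?_
    by_cases h1 : i ∈ T <;> by_cases h2 : i ∈ T' <;> simp_all [sgn_one, sgn_neg_one]

lemma noise_chi {n : ℕ} (ρ : ℝ) (T : Finset (Fin n)) (x : Cube n) :
    noise ρ (chi T) x = ρ ^ #T * chi T x := by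
  have h : ∀ y : Cube n, (∏ i, (1 + ρ * sgn (x i) * sgn (y i)) / 2) * chi T y =
      ∏ i, ((1 + ρ * sgn (x i) * sgn (y i)) / 2 * if i ∈ T then sgn (y i) else 1) := by
    intro y
    rw [prod_mul_distrib, ← chi_eq_prod_ite]
  unfold noise
  simp_rw [h]
  rw [sum_cube_prod (fun i y => (1 + ρ * sgn (x i) * sgn y) / 2 * if i ∈ T then sgn y else 1)]
  have h2 : ρ ^ #T * chi T x = ∏ i, if i ∈ T then ρ * sgn (x i) else 1 := by
    simp [chi, prod_ite_mem, prod_mul_distrib]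
  rw [h2]
  refine prod_congr rfl fun i _ => ?_
  split_ifs <;> simp [sgn_one, sgn_neg_one] <;> ring

lemma noise_symm {n : ℕ} (ρ : ℝ) (f g : Cube n → ℝ) :
    ∑ x, g x * noise ρ f x = ∑ x, noise ρ g x * f x := by
  simp only [noise, mul_sum, sum_mul]
  rw [sum_comm]
  refine sum_congr rfl fun y _ => sum_congr rfl fun x _ => ?_
  rw [prod_congr rfl fun i _ => show (1 + ρ * sgn (x i) * sgn (y i)) / 2 =
    (1 + ρ * sgn (y i) * sgn (x i)) / 2 by ring]
  ring

lemma sum_mul_left_cube {n : ℕ} (u : Cube n) (f : Cube n → ℝ) : ∑ x, f (u * x) = ∑ x, f x :=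
  Fintype.sum_equiv (Equiv.mulLeft u) _ _ fun _ => rfl

lemma noise_comp_mul {n : ℕ} (ρ : ℝ) (f : Cube n → ℝ) (u x : Cube n) :
    noise ρ (fun y => f (u * y)) x = noise ρ f (u * x) := by
  unfold noise
  rw [← sum_mul_left_cube u fun y => (∏ i, (1 + ρ * sgn ((u * x) i) * sgn (y i)) / 2) * f y]
  refine sum_congr rfl fun y _ => ?_
  congr 1
  refine prod_congr rfl fun i _ => ?_
  simp only [Pi.mul_apply, sgn_mul]
  linear_combination (-(ρ * sgn (x i) * sgn (y i)) / 2) * sgn_mul_self (u i)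

lemma dot_eq_coordSum {n : ℕ} (u x : Cube n) : dot u x = coordSum (u * x) := by
  simp [dot, coordSum, sgn_mul]

/-- Characters are multiplicative and orthogonal, so a correlation of two translates depends only on
`u * v`; this drives the pairwise correlations. -/
lemma sum_esum_mul_esum {n : ℕ} (d d' : ℕ) (u v : Cube n) :
    ∑ x, esum d (u * x) * esum d' (v * x) = if d = d' then 2 ^ n * esum d (u * v) else 0 := by
  have h : ∑ x, esum d (u * x) * esum d' (v * x) =
      ∑ T ∈ (univ : Finset (Fin n)).powersetCard d, ∑ T' ∈ (univ : Finset (Fin n)).powersetCard d',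
        chi T u * chi T' v * if T = T' then (2 : ℝ) ^ n else 0 := by
    simp_rw [esum, sum_mul_sum]
    rw [sum_comm]
    refine sum_congr rfl fun T _ => ?_
    rw [sum_comm]
    refine sum_congr rfl fun T' _ => ?_
    rw [← sum_chi_mul_chi, mul_sum]
    refine sum_congr rfl fun x _ => ?_
    rw [chi_mul, chi_mul]; ring
  rw [h]
  split_ifs with hd
  · subst hd
    rw [esum, mul_sum]
    refine sum_congr rfl fun T hT => ?_
    simp only [mul_ite, mul_zero]
    rw [sum_ite_eq, if_pos hT, chi_mul]; ring
  · refine sum_eq_zero fun T hT => sum_eq_zero fun T' hT' => ?_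
    rw [if_neg, mul_zero]
    rintro rfl
    exact hd ((mem_powersetCard.1 hT).2.symm.trans (mem_powersetCard.1 hT').2)

lemma noise_esum {n : ℕ} (ρ : ℝ) (d : ℕ) (x : Cube n) :
    noise ρ (esum d) x = ρ ^ d * esum d x := by
  have h : noise ρ (esum d) x =
      ∑ T ∈ (univ : Finset (Fin n)).powersetCard d, noise ρ (chi T) x := by
    simp only [noise, esum, mul_sum]
    rw [sum_comm]
  rw [h, esum, mul_sum]
  refine sum_congr rfl fun T hT => ?_
  rw [noise_chi, (mem_powersetCard.1 hT).2]

lemma esum_one_eq {n : ℕ} (d : ℕ) : esum d (1 : Cube n) = n.choose d := by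
  simp [esum, chi, sgn_one, card_powersetCard]

lemma abs_chi {n : ℕ} (T : Finset (Fin n)) (x : Cube n) : |chi T x| = 1 := by
  rw [chi, abs_prod]
  refine prod_eq_one fun i _ => ?_
  rcases Int.units_eq_one_or (x i) with h | h <;> simp [h, sgn]

lemma abs_esum_le {n : ℕ} (d : ℕ) (x : Cube n) : |esum d x| ≤ n.choose d := by
  refine (abs_sum_le_sum_abs _ _).trans ?_
  simp [abs_chi, card_powersetCard]

lemma prod_one_add_algebraMap {n : ℕ} {A : Type*} [CommRing A] [Algebra ℝ A] (x : Cube n) (z : A) :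
    ∏ i, (1 + algebraMap ℝ A (sgn (x i)) * z) =
      ∑ d ∈ range (n + 1), algebraMap ℝ A (esum d x) * z ^ d := by
  rw [prod_one_add, sum_powerset]
  simp only [card_univ, Fintype.card_fin, esum, map_sum, sum_mul]
  refine sum_congr rfl fun d _ => sum_congr rfl fun T hT => ?_
  rw [prod_mul_distrib, prod_const, (mem_powersetCard.1 hT).2, chi, map_prod]

/-- The generating polynomial of the elementary symmetric polynomials. -/
def genPoly {n : ℕ} (x : Cube n) : ℝ[X] := ∏ i, (1 + C (sgn (x i)) * X)

lemma coeff_genPoly {n : ℕ} (x : Cube n) (d : ℕ) : (genPoly x).coeff d = esum d x := by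
  have h := prod_one_add_algebraMap x (X : ℝ[X])
  simp only [algebraMap_eq] at h
  rw [genPoly, h, finsetSum_coeff]
  simp only [coeff_C_mul_X_pow]
  rw [sum_ite_eq]
  split_ifs with hd
  · rfl
  · rw [esum, powersetCard_eq_empty.2, sum_empty]
    simp at hd ⊢
    omega

/-- Logarithmic derivative: since `x_i² = 1`, the factor `1 - X²` equals `(1 - x_i X)(1 + x_i X)`,
and each factor of the product contributes `x_i - X`. The coefficients of this equation give the
three-term recurrence for the `e_d`. -/
lemma one_sub_X_sq_mul_derivative_genPoly {n : ℕ} (x : Cube n) :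
    (1 - X ^ 2) * derivative (genPoly x) = (C (coordSum x) - (n : ℝ[X]) * X) * genPoly x := by
  have h : ∀ i, (1 - X ^ 2) * ((∏ j ∈ univ.erase i, (1 + C (sgn (x j)) * X)) *
      derivative (1 + C (sgn (x i)) * X)) = (C (sgn (x i)) - X) * genPoly x := by
    intro i
    rw [genPoly, ← mul_prod_erase univ _ (mem_univ i)]
    have h1 : (C (sgn (x i)) * C (sgn (x i)) : ℝ[X]) = 1 := by
      rw [← C_mul, sgn_mul_self, C_1]
    simp only [derivative_add, derivative_one, derivative_C_mul, derivative_X]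
    linear_combination (-(∏ j ∈ univ.erase i, (1 + C (sgn (x j)) * X)) * X) * h1
  rw [genPoly, derivative_prod_finset, mul_sum, sum_congr rfl fun i _ => h i, ← sum_mul,
    sum_sub_distrib, genPoly]
  simp [coordSum, map_sum]

lemma esum_succ_succ {n : ℕ} (x : Cube n) (d : ℕ) :
    ((d : ℝ) + 2) * esum (d + 2) x = coordSum x * esum (d + 1) x - (n - d : ℝ) * esum d x := by
  have h := congrArg (fun p : ℝ[X] => coeff p (d + 1)) (one_sub_X_sq_mul_derivative_genPoly x)
  have e1 : (n : ℝ[X]) * X * genPoly x = C (n : ℝ) * (X * genPoly x) := by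
    rw [mul_assoc]; simp
  have e2 : (X ^ 2 * derivative (genPoly x)) = X * (X * derivative (genPoly x)) := by ring
  simp only [sub_mul, one_mul, coeff_sub, e1, e2, coeff_C_mul, coeff_X_mul, coeff_derivative,
    coeff_genPoly] at h
  cases d with
  | zero => simp [coeff_derivative, coeff_genPoly] at h ⊢; linarith
  | succ d =>
    simp only [coeff_X_mul, coeff_derivative, coeff_genPoly] at h
    push_cast at h ⊢; linarith

lemma esum_zero {n : ℕ} (x : Cube n) : esum 0 x = 1 := by simp [esum, chi]

lemma esum_one {n : ℕ} (x : Cube n) : esum 1 x = coordSum x := by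
  have h := congrArg (fun p : ℝ[X] => coeff p 0) (one_sub_X_sq_mul_derivative_genPoly x)
  simpa [mul_coeff_zero, sub_mul, coeff_derivative, coeff_genPoly, esum_zero] using h

lemma sum_cube_eq_sum_choose {n : ℕ} {M : Type*} [AddCommMonoid M] (f : ℕ → M) :
    ∑ x : Cube n, f (#{i | x i = -1}) = ∑ b ∈ range (n + 1), n.choose b • f b := by
  have h : ∑ x : Cube n, f (#{i | x i = -1}) = ∑ B ∈ (univ : Finset (Fin n)).powerset, f #B := by
    refine sum_bij' (fun x _ => ({i | x i = -1} : Finset (Fin n)))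
      (fun B _ i => if i ∈ B then -1 else 1) (by simp) (by simp) ?_ ?_ (by simp)
    · intro x _
      funext i
      rcases Int.units_eq_one_or (x i) with h | h <;> simp [h]
    · intro B _
      ext i
      by_cases hi : i ∈ B <;> simp [hi]
  rw [h, sum_powerset_apply_card]
  simp

lemma genPoly_eq {n : ℕ} (x : Cube n) :
    genPoly x = (1 - X) ^ #{i | x i = -1} * (1 + X) ^ (n - #{i | x i = -1}) := by
  have h : ∀ i, (1 + C (sgn (x i)) * X : ℝ[X]) = if x i = -1 then 1 - X else 1 + X := by
    intro i
    rcases Int.units_eq_one_or (x i) with h | h <;> simp [h, sgn]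
    ring
  rw [genPoly, prod_congr rfl fun i _ => h i, prod_ite, prod_const, prod_const]
  congr 2
  rw [filter_not, card_sdiff_of_subset (filter_subset _ _)]
  simp

lemma coordSum_eq {n : ℕ} (x : Cube n) : coordSum x = n - 2 * #{i | x i = -1} := by
  have h0 : ∀ i, sgn (x i) = 1 - 2 * if x i = -1 then 1 else 0 := by
    intro i
    rcases Int.units_eq_one_or (x i) with h | h <;> simp [h, sgn]
    norm_num
  rw [coordSum, sum_congr rfl fun i _ => h0 i, sum_sub_distrib, ← mul_sum]
  simp

end

end HiddenDirection

namespace HiddenDirection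

noncomputable section

open Finset Polynomial

/-! ### The Fourier expansion of the majority function -/

lemma coeff_one_sub_X_sq_pow (h r : ℕ) :
    ((1 - X ^ 2 : ℝ[X]) ^ h).coeff (2 * r) = (-1) ^ r * h.choose r := by
  have e : (1 - X ^ 2 : ℝ[X]) ^ h =
      ∑ m ∈ range (h + 1), C ((-1) ^ m * (h.choose m : ℝ)) * X ^ (2 * m) := by
    rw [sub_eq_neg_add, add_pow]
    refine sum_congr rfl fun m _ => ?_
    rw [neg_pow, ← pow_mul]
    simp
    ring
  rw [e, finsetSum_coeff]
  simp only [coeff_C_mul_X_pow]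
  have : ∀ m, (2 * r = 2 * m) = (r = m) := by intro m; simp
  simp only [this]
  rw [sum_ite_eq]
  split_ifs with hr
  · rfl
  · rw [Nat.choose_eq_zero_of_lt (by simpa using hr)]; simp

/-- Differentiating the generating polynomial turns the sum over the number `b` of negative
coordinates into a telescoping sum of the `T b`. The sign changes once, between `b = h` and `b = h +
1`, and the outer ends vanish, so `2 T (h + 1)`, a multiple of `(1 - X²)^h`, is all that survives.
-/
lemma sum_sign_mul_esum (h r : ℕ) :
    (∑ x : Cube (2 * h + 1), Real.sign (coordSum x) * esum (2 * r + 1) x) * (2 * r + 1) =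
      2 * (2 * h + 1) * h.centralBinom * ((-1) ^ r * h.choose r) := by
  set n := 2 * h + 1 with hn
  let F : ℕ → ℝ[X] := fun b =>
    C (Real.sign (n - 2 * b : ℝ)) * ((1 - X) ^ b * (1 + X) ^ (n - b))
  let T : ℕ → ℝ[X] := fun b => ((b * n.choose b : ℕ) : ℝ[X]) * ((1 + X) ^ (n - b) * (1 - X) ^ (b - 1))
  have hT : ∀ b, n.choose b • derivative ((1 - X) ^ b * (1 + X) ^ (n - b) : ℝ[X]) =
      T (b + 1) - T b := by
    intro b
    have e1 : (b + 1) * n.choose (b + 1) = n.choose b * (n - b) := by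
      rw [mul_comm, Nat.choose_succ_right_eq]
    simp only [T, e1, derivative_mul, derivative_pow, derivative_sub, derivative_add,
      derivative_one, derivative_X, nsmul_eq_mul, Nat.add_sub_cancel, Nat.sub_sub]
    push_cast
    simp only [map_natCast]
    ring
  have hsum : ∑ x : Cube n, C (Real.sign (coordSum x)) * genPoly x =
      ∑ b ∈ range (n + 1), n.choose b • F b := by
    rw [← sum_cube_eq_sum_choose F]
    refine sum_congr rfl fun x _ => ?_
    rw [genPoly_eq, coordSum_eq]
  have hder : derivative (∑ x : Cube n, C (Real.sign (coordSum x)) * genPoly x) =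
      C (2 * (2 * h + 1) * h.centralBinom : ℝ) * (1 - X ^ 2) ^ h := by
    have hF : ∀ b, derivative (n.choose b • F b) =
        C (Real.sign (n - 2 * b : ℝ)) * (T (b + 1) - T b) := by
      intro b
      rw [← hT]
      rw [derivative_smul]
      simp only [F, derivative_C_mul, nsmul_eq_mul]
      ring
    rw [hsum, derivative_sum, sum_congr rfl fun b _ => hF b,
      show n + 1 = (h + 1) + (h + 1) by omega, sum_range_add]
    have a1 : ∀ b ∈ range (h + 1), C (Real.sign (n - 2 * b : ℝ)) * (T (b + 1) - T b) =
        T (b + 1) - T b := by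
      intro b hb
      have hb' : b ≤ h := by simpa [Nat.lt_succ_iff] using hb
      have : (b : ℝ) ≤ h := by exact_mod_cast hb'
      rw [Real.sign_of_pos (by rw [hn]; push_cast; linarith)]
      simp
    have a2 : ∀ b ∈ range (h + 1), C (Real.sign (n - 2 * (h + 1 + b : ℕ) : ℝ)) *
        (T (h + 1 + b + 1) - T (h + 1 + b)) = -(T (h + 1 + (b + 1)) - T (h + 1 + b)) := by
      intro b _
      have : (0 : ℝ) ≤ b := by positivity
      rw [Real.sign_of_neg (by rw [hn]; push_cast; linarith)]
      simp [add_assoc]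
    rw [sum_congr rfl a1, sum_congr rfl a2, sum_neg_distrib, sum_range_sub,
      sum_range_sub fun b => T (h + 1 + b)]
    have t0 : T 0 = 0 := by simp [T]
    have t1 : T (h + 1 + (h + 1)) = 0 := by
      simp only [T]
      rw [Nat.choose_eq_zero_of_lt (by omega)]
      simp
    have t2 : T (h + 1) = C ((2 * h + 1) * h.centralBinom : ℝ) * (1 - X ^ 2) ^ h := by
      simp only [T]
      have e1 : (h + 1) * n.choose (h + 1) = (2 * h + 1) * h.centralBinom := by
        rw [Nat.centralBinom, hn, mul_comm, ← Nat.add_one_mul_choose_eq]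
      rw [e1, show n - (h + 1) = h by omega, Nat.add_sub_cancel, ← mul_pow]
      simp only [map_mul, map_add, map_one, map_natCast, map_ofNat]
      push_cast
      ring
    rw [t0, t1, add_zero, t2]
    simp only [map_mul, map_add, map_one, map_natCast, map_ofNat]
    ring
  have hc := congrArg (fun p : ℝ[X] => coeff p (2 * r)) hder
  simp only [coeff_derivative, finsetSum_coeff, coeff_C_mul, coeff_genPoly,
    coeff_one_sub_X_sq_pow] at hc
  push_cast at hc
  exact hc

end

end HiddenDirection

namespace HiddenDirection

noncomputable section

open Finset Polynomial MeasureTheory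

/-! ### The Fourier expansion of the witness -/

lemma sum_range_two_mul {M : Type*} [AddCommMonoid M] (f : ℕ → M) (h : ℕ) :
    ∑ d ∈ range (2 * h), f d = ∑ r ∈ range h, (f (2 * r) + f (2 * r + 1)) := by
  induction h with
  | zero => simp
  | succ h ih => rw [show 2 * (h + 1) = 2 * h + 1 + 1 by ring, sum_range_succ, sum_range_succ, ih,
      sum_range_succ, add_assoc]

lemma one_add_mul_I_eq (y : ℤˣ) (τ : ℝ) :
    (1 + (sgn y : ℂ) * (Complex.I * τ)) =
      (√(1 + τ ^ 2) : ℝ) * Complex.exp ((Real.arctan τ * sgn y : ℝ) * Complex.I) := by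
  have hpos : 0 < √(1 + τ ^ 2) := Real.sqrt_pos.2 (by positivity)
  rw [Complex.exp_mul_I, ← Complex.ofReal_cos, ← Complex.ofReal_sin]
  rcases Int.units_eq_one_or y with rfl | rfl
  all_goals
    simp only [sgn_one, sgn_neg_one, mul_one, mul_neg, Real.cos_neg, Real.sin_neg, Real.cos_arctan,
      Real.sin_arctan]
    apply Complex.ext <;> simp <;> field_simp

/-- Imaginary part of `∏ (1 + iτ x_j)`, written in polar form on the left and expanded in powers of
`iτ` on the right. -/
lemma sqrt_pow_mul_sin {n h : ℕ} (hn : n = 2 * h + 1) (x : Cube n) (τ : ℝ) :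
    √(1 + τ ^ 2) ^ n * Real.sin (Real.arctan τ * coordSum x) =
      ∑ r ∈ range (h + 1), (-1) ^ r * τ ^ (2 * r + 1) * esum (2 * r + 1) x := by
  have h1 := prod_one_add_algebraMap x (Complex.I * τ)
  simp only [Complex.coe_algebraMap, one_add_mul_I_eq, prod_mul_distrib, prod_const,
    ← Complex.exp_sum, ← sum_mul, card_univ, Fintype.card_fin] at h1
  rw [show n + 1 = 2 * (h + 1) by omega, sum_range_two_mul] at h1
  have h2 := congrArg Complex.im h1
  rw [← Complex.ofReal_sum, ← mul_sum, ← Complex.ofReal_pow, Complex.im_ofReal_mul,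
    Complex.exp_ofReal_mul_I_im, Complex.im_sum] at h2
  rw [coordSum, h2]
  refine sum_congr rfl fun r _ => ?_
  have e : ∀ a b : ℝ, (a : ℂ) * (Complex.I * τ) ^ (2 * r) + b * (Complex.I * τ) ^ (2 * r + 1) =
      ((a * ((-1) ^ r * τ ^ (2 * r)) : ℝ) : ℂ) +
        ((-1) ^ r * τ ^ (2 * r + 1) * b : ℝ) * Complex.I := by
    intro a b
    rw [mul_pow, mul_pow, pow_succ Complex.I, pow_mul, Complex.I_sq]
    push_cast
    ring
  rw [e]
  simp only [Complex.add_im, Complex.ofReal_im, Complex.im_ofReal_mul, Complex.I_im, mul_one,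
    zero_add]

/-- The polynomial factor in the `i`-th derivative of `t ^ β * exp (-t)`. -/
def rodriguesPoly (β : ℝ) : ℕ → ℝ[X]
  | 0 => 1
  | i + 1 => (C (β - i) - X) * rodriguesPoly β i + X * derivative (rodriguesPoly β i)

lemma iteratedDeriv_rpow_mul_exp_neg (β : ℝ) (i : ℕ) : ∀ y : ℝ, 0 < y →
    iteratedDeriv i (fun t : ℝ => t ^ β * Real.exp (-t)) y =
      y ^ (β - i) * Real.exp (-y) * (rodriguesPoly β i).eval y := by
  induction i with
  | zero => intro y _; simp [rodriguesPoly]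
  | succ i ih =>
    intro y hy
    rw [iteratedDeriv_succ]
    have he : iteratedDeriv i (fun t : ℝ => t ^ β * Real.exp (-t)) =ᶠ[nhds y]
        fun y => y ^ (β - i) * Real.exp (-y) * (rodriguesPoly β i).eval y := by
      filter_upwards [lt_mem_nhds hy] with z hz using ih z hz
    rw [he.deriv_eq]
    have hd : HasDerivAt (fun y : ℝ => y ^ (β - i) * Real.exp (-y) * (rodriguesPoly β i).eval y)
        (((β - i) * y ^ (β - i - 1) * Real.exp (-y) + y ^ (β - i) * (Real.exp (-y) * -1)) *
          (rodriguesPoly β i).eval y +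
          y ^ (β - i) * Real.exp (-y) * (derivative (rodriguesPoly β i)).eval y) y :=
      ((Real.hasDerivAt_rpow_const (Or.inl hy.ne')).mul
        ((hasDerivAt_neg y).exp)).mul ((rodriguesPoly β i).hasDerivAt y)
    rw [hd.deriv, rodriguesPoly]
    have e1 : y ^ (β - i) = y ^ (β - (i + 1 : ℕ)) * y := by
      rw [← Real.rpow_add_one hy.ne']; congr 1; push_cast; ring
    have e2 : y ^ (β - i - 1) = y ^ (β - (i + 1 : ℕ)) := by
      congr 1; push_cast; ring
    rw [e1, e2]
    simp only [eval_add, eval_mul, eval_sub, eval_C, eval_X]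
    ring

/-- The moment functional `p ↦ ∫₀^∞ p(y) y^γ e^{-y} dy`. -/
def gammaMoment (γ : ℝ) : ℝ[X] →ₗ[ℝ] ℝ :=
  Polynomial.lsum fun i => Real.Gamma (γ + i + 1) • LinearMap.id

lemma gammaMoment_monomial (γ : ℝ) (i : ℕ) (a : ℝ) :
    gammaMoment γ (monomial i a) = Real.Gamma (γ + i + 1) * a := by
  simp [gammaMoment, Polynomial.lsum_apply, sum_monomial_index]

lemma integrable_and_integral_gammaMoment {γ : ℝ} (hγ : -1 < γ) (p : ℝ[X]) :
    IntegrableOn (fun y => p.eval y * (y ^ γ * Real.exp (-y))) (Set.Ioi 0) ∧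
      ∫ y in Set.Ioi (0 : ℝ), p.eval y * (y ^ γ * Real.exp (-y)) = gammaMoment γ p := by
  induction p using Polynomial.induction_on' with
  | add p q hp hq =>
    simp only [eval_add, add_mul, map_add]
    exact ⟨hp.1.add hq.1, by rw [integral_add hp.1 hq.1, hp.2, hq.2]⟩
  | monomial i a =>
    have hs : 0 < γ + i + 1 := by have : (0 : ℝ) ≤ i := by positivity
                                  linarith
    have e : Set.EqOn (fun y : ℝ => (Real.exp (-y) * y ^ (γ + i + 1 - 1)) * a)
        (fun y : ℝ => (monomial i a).eval y * (y ^ γ * Real.exp (-y))) (Set.Ioi 0) := by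
      intro y hy
      have hy : 0 < y := hy
      simp only [eval_monomial]
      rw [show γ + i + 1 - 1 = γ + i by ring, Real.rpow_add_natCast hy.ne']
      ring
    refine ⟨IntegrableOn.congr_fun ((Real.GammaIntegral_convergent hs).mul_const a) e
      measurableSet_Ioi, ?_⟩
    rw [← setIntegral_congr_fun measurableSet_Ioi e, integral_mul_const, gammaMoment_monomial,
      Real.Gamma_eq_integral hs]

lemma gammaMoment_X_mul (γ : ℝ) (p : ℝ[X]) :
    gammaMoment (γ - 1) (X * p) = gammaMoment γ p := by
  induction p using Polynomial.induction_on' with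
  | add p q hp hq => rw [mul_add, map_add, map_add, hp, hq]
  | monomial i a =>
    rw [X_mul_monomial, gammaMoment_monomial, gammaMoment_monomial]
    congr 2
    push_cast
    ring

/-- The integrand is the total derivative of `y^γ e^{-y} p(y)`; on monomials this is `Γ(s+1) = s
Γ(s)`. -/
lemma gammaMoment_deriv {γ : ℝ} (hγ : 0 < γ) (p : ℝ[X]) :
    gammaMoment (γ - 1) ((C γ - X) * p + X * derivative p) = 0 := by
  induction p using Polynomial.induction_on' with
  | add p q hp hq =>
    rw [derivative_add, mul_add, mul_add, add_add_add_comm, map_add, hp, hq, add_zero]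
  | monomial i a =>
    have hs : γ + i ≠ 0 := by positivity
    rw [sub_mul, C_mul_monomial, X_mul_monomial, map_add, map_sub, gammaMoment_X_mul,
      derivative_monomial]
    simp only [gammaMoment_monomial]
    have hG := Real.Gamma_add_one hs
    have e1 : γ - 1 + i + 1 = γ + i := by ring
    have e2 : γ - 1 + (i + 1 : ℕ) + 1 = γ + i + 1 := by push_cast; ring
    rw [e1, e2, hG]
    rcases i with _ | i
    · simp; ring
    · have e3 : γ + ((i + 1 - 1 : ℕ) : ℝ) + 1 = γ + (i + 1 : ℕ) := by
        push_cast [Nat.add_sub_cancel]; ring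
      rw [e3]; ring

/-- Integration by parts `i` times moves the derivatives of the Rodrigues formula onto `y^r`. -/
lemma gammaMoment_X_pow_mul_rodriguesPoly (β : ℝ) (i : ℕ) : (i : ℝ) < β + 1 → ∀ r : ℕ,
    gammaMoment (β - i) (X ^ r * rodriguesPoly β i) =
      (-1) ^ i * r.descFactorial i * Real.Gamma (β - i + r + 1) := by
  induction i with
  | zero =>
    intro _ r
    simp [rodriguesPoly, ← monomial_one_right_eq_X_pow, gammaMoment_monomial]
  | succ i ih =>
    intro hi r
    push_cast at hi
    have h0 := gammaMoment_deriv (γ := β - i) (by linarith) (X ^ r * rodriguesPoly β i)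
    have e : (C (β - i) - X) * (X ^ r * rodriguesPoly β i) +
        X * derivative (X ^ r * rodriguesPoly β i) =
        X ^ r * rodriguesPoly β (i + 1) + X * (C (r : ℝ) * (X ^ (r - 1) * rodriguesPoly β i)) := by
      rw [rodriguesPoly, derivative_mul, derivative_X_pow]
      ring
    rw [e, map_add, gammaMoment_X_mul, ← smul_eq_C_mul, map_smul, ih (by linarith)] at h0
    rw [show β - (i + 1 : ℕ) = β - i - 1 by push_cast; ring, eq_neg_of_add_eq_zero_left h0]
    rcases r with _ | r
    · simp
    · rw [Nat.succ_descFactorial_succ, Nat.add_sub_cancel,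
        show β - i - 1 + (r + 1 : ℕ) + 1 = β - i + r + 1 by push_cast; ring]
      push_cast
      simp only [smul_eq_mul]
      ring

/-- The coefficient of `e_{2r+1}` in the averaged witness. -/
def witnessCoeff (k n r : ℕ) : ℝ :=
  1 / 2 * ((-1) ^ r * (r + 1).choose (k + 1) * Real.Gamma (r + 3 / 2) / √n ^ (2 * r + 1))

/-- The denominator `(1 + y/n)^{-n/2}` of the kernel is the modulus in `sqrt_pow_mul_sin`, so the
integrand is a polynomial times `y^{1/2} e^{-y}`, and each power of `y` is integrated by the
Rodrigues moment with `β = ℓ + 1/2`. -/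
lemma laguerreWitness_eq {n h : ℕ} (hn : n = 2 * h + 1) (ℓ : ℕ) (x : Cube n) :
    laguerreWitness ℓ n x = ∑ r ∈ range (h + 1),
      (-1) ^ r * r.choose ℓ * Real.Gamma (r + 3 / 2) / √n ^ (2 * r + 1) * esum (2 * r + 1) x := by
  have hn0 : (0 : ℝ) < n := by rw [hn]; positivity
  set q := rodriguesPoly ((ℓ : ℝ) + 1 / 2) ℓ with hq
  have hint : ∀ y ∈ Set.Ioi (0 : ℝ),
      laguerre (1 / 2) ℓ y * (y ^ (1 / 2 : ℝ) * Real.exp (-y) / weight n y) * sineKernel y x =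
      ∑ r ∈ range (h + 1), ((-1) ^ r / ℓ.factorial / √n ^ (2 * r + 1) * esum (2 * r + 1) x) *
        ((X ^ r * q).eval y * (y ^ (1 / 2 : ℝ) * Real.exp (-y))) := by
    intro y hy
    have hy : 0 < y := hy
    have h1 := sqrt_pow_mul_sin hn x (√(y / n))
    have hy1 : 0 < 1 + y / n := by positivity
    rw [Real.sq_sqrt (by positivity), ← Real.rpow_natCast, Real.sqrt_eq_rpow, ← Real.rpow_mul hy1.le,
      show (1 / 2 : ℝ) * n = -(-(n : ℝ) / 2) by ring, Real.rpow_neg hy1.le] at h1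
    have h2 : laguerre (1 / 2) ℓ y = (ℓ.factorial : ℝ)⁻¹ * q.eval y := by
      rw [laguerre, iteratedDeriv_rpow_mul_exp_neg _ _ y hy, ← hq,
        show (ℓ : ℝ) + 1 / 2 - ℓ = 1 / 2 by ring, Real.rpow_neg hy.le, Real.exp_neg]
      have := Real.rpow_pos_of_pos hy (1 / 2)
      field_simp
    have hsq : 0 < √y := Real.sqrt_pos.2 hy
    have hw : 0 < (1 + y / n) ^ (-(n : ℝ) / 2) := Real.rpow_pos_of_pos hy1 _
    calc _ = (ℓ.factorial : ℝ)⁻¹ * q.eval y * Real.exp (-y) *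
          (((1 + y / n) ^ (-(n : ℝ) / 2))⁻¹ * Real.sin (Real.arctan (√(y / n)) * coordSum x)) := by
          rw [h2, weight, sineKernel, theta, ← Real.sqrt_eq_rpow]
          field_simp
      _ = _ := by
          rw [h1, mul_sum]
          refine sum_congr rfl fun r _ => ?_
          rw [Real.sqrt_div hy.le, div_pow, pow_succ √y, pow_mul, Real.sq_sqrt hy.le,
            ← Real.sqrt_eq_rpow]
          simp only [eval_mul, eval_pow, eval_X]
          field_simp
  have hM := fun r : ℕ => integrable_and_integral_gammaMoment (γ := 1 / 2) (by norm_num) (X ^ r * q)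
  rw [laguerreWitness, setIntegral_congr_fun measurableSet_Ioi hint,
    integral_finsetSum _ fun r _ => (hM r).1.const_mul _, mul_sum]
  refine sum_congr rfl fun r _ => ?_
  rw [integral_const_mul, (hM r).2]
  have h3 := gammaMoment_X_pow_mul_rodriguesPoly ((ℓ : ℝ) + 1 / 2) ℓ (by linarith) r
  rw [show (ℓ : ℝ) + 1 / 2 - ℓ = 1 / 2 by ring, ← hq] at h3
  rw [h3, Nat.descFactorial_eq_factorial_mul_choose,
    show (1 / 2 : ℝ) + r + 1 = r + 3 / 2 by ring]
  have hs : ((-1 : ℝ) ^ ℓ) * (-1) ^ ℓ = 1 := by rw [← mul_pow]; simp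
  push_cast
  have hf : (ℓ.factorial : ℝ) ≠ 0 := by positivity
  field_simp
  rw [sq, hs, one_mul]

lemma avgWitness_eq {n h : ℕ} (hn : n = 2 * h + 1) (k : ℕ) (x : Cube n) :
    avgWitness k n x = ∑ r ∈ range (h + 1), witnessCoeff k n r * esum (2 * r + 1) x := by
  rw [avgWitness, laguerreWitness_eq hn, laguerreWitness_eq hn, ← sum_add_distrib, mul_sum]
  refine sum_congr rfl fun r _ => ?_
  rw [witnessCoeff, Nat.choose_succ_succ]
  push_cast
  ring

end

end HiddenDirection

namespace HiddenDirection

noncomputable section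

open Finset

/-! ### Bounds for the elementary symmetric polynomials -/

/-- A sequence dominating the normalized elementary symmetric polynomials. -/
def domSeq (δ c : ℝ) : ℕ → ℝ
  | 0 => 1
  | 1 => δ
  | d + 2 => δ * domSeq δ c (d + 1) + c * domSeq δ c d

section

variable {δ c : ℝ}

lemma domSeq_nonneg (hδ : 0 ≤ δ) (hc : 0 ≤ c) : ∀ d, 0 ≤ domSeq δ c d
  | 0 => zero_le_one
  | 1 => hδ
  | d + 2 => add_nonneg (mul_nonneg hδ (domSeq_nonneg hδ hc (d + 1)))
      (mul_nonneg hc (domSeq_nonneg hδ hc d))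

lemma mul_domSeq_le_succ (hδ : 0 ≤ δ) (hc : 0 ≤ c) (d : ℕ) :
    δ * domSeq δ c d ≤ domSeq δ c (d + 1) := by
  cases d with
  | zero => simp [domSeq]
  | succ d => exact le_add_of_nonneg_right (mul_nonneg hc (domSeq_nonneg hδ hc d))

lemma mul_domSeq_succ_le (hδ : 0 ≤ δ) (hδ1 : δ ≤ 1) (hc : 0 ≤ c) (hc1 : c ≤ 1) (d : ℕ) :
    δ * domSeq δ c (d + 1) ≤ 2 * domSeq δ c d := by
  cases d with
  | zero => simp [domSeq]; nlinarith
  | succ d =>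
    have h1 := mul_domSeq_le_succ hδ hc d
    have h2 := domSeq_nonneg hδ hc (d + 1)
    have h3 : δ * δ * domSeq δ c (d + 1) ≤ 1 * domSeq δ c (d + 1) :=
      mul_le_mul_of_nonneg_right (by nlinarith) h2
    have h4 : c * (δ * domSeq δ c d) ≤ 1 * domSeq δ c (d + 1) :=
      mul_le_mul hc1 h1 (mul_nonneg hδ (domSeq_nonneg hδ hc d)) zero_le_one
    rw [domSeq]
    linarith

/-- Unrolling the recurrence, each use of the second branch costs a factor `c` and lowers the degree
by two. The free parameter `M ≤ d` lets the powers of `δ` be capped independently of `d`, which is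
harmless because `δ ≤ 1`. -/
lemma domSeq_le_sum (hδ : 0 ≤ δ) (hδ1 : δ ≤ 1) (hc : 0 ≤ c) : ∀ d M : ℕ, M ≤ d →
    domSeq δ c d ≤ ∑ p ∈ range (d + 1), (d.choose p : ℝ) * c ^ p * δ ^ (M - 2 * p)
  | 0, M, hM => by obtain rfl : M = 0 := by omega
                   simp [domSeq]
  | 1, M, hM => by
    have : domSeq δ c 1 ≤ δ ^ M := by
      interval_cases M <;> simp [domSeq, hδ1]
    rw [sum_range_succ', sum_range_one]
    simp only [Nat.choose_zero_right, Nat.cast_one, pow_zero, mul_zero, Nat.sub_zero, one_mul]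
    have : 0 ≤ ((1 : ℕ).choose (0 + 1) : ℝ) * c ^ (0 + 1) * δ ^ (M - 2 * (0 + 1)) := by positivity
    linarith
  | d + 2, M, hM => by
    have h1 := mul_le_mul_of_nonneg_left (domSeq_le_sum hδ hδ1 hc (d + 1) (M - 1) (by omega)) hδ
    have h2 := mul_le_mul_of_nonneg_left (domSeq_le_sum hδ hδ1 hc d (M - 2) (by omega)) hc
    have g1 : δ * ∑ p ∈ range (d + 1 + 1), ((d + 1).choose p : ℝ) * c ^ p * δ ^ (M - 1 - 2 * p) ≤
        δ ^ M + ∑ p ∈ range (d + 2),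
          ((d + 1).choose (p + 1) : ℝ) * c ^ (p + 1) * δ ^ (M - 2 * (p + 1)) := by
      rw [mul_sum]
      calc _ ≤ ∑ p ∈ range (d + 1 + 1), ((d + 1).choose p : ℝ) * c ^ p * δ ^ (M - 2 * p) := by
            refine sum_le_sum fun p _ => ?_
            have : δ * δ ^ (M - 1 - 2 * p) ≤ δ ^ (M - 2 * p) := by
              rw [← pow_succ']
              exact pow_le_pow_of_le_one hδ hδ1 (by omega)
            calc _ = ((d + 1).choose p : ℝ) * c ^ p * (δ * δ ^ (M - 1 - 2 * p)) := by ring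
              _ ≤ _ := by gcongr
        _ ≤ ∑ p ∈ range (d + 1 + 1 + 1), ((d + 1).choose p : ℝ) * c ^ p * δ ^ (M - 2 * p) := by
            rw [sum_range_succ _ (d + 1 + 1)]
            exact le_add_of_nonneg_right (by positivity)
        _ = _ := by
            rw [sum_range_succ']
            simp [add_comm]
    have g2 : c * ∑ p ∈ range (d + 1), (d.choose p : ℝ) * c ^ p * δ ^ (M - 2 - 2 * p) ≤
        ∑ p ∈ range (d + 2), ((d + 1).choose p : ℝ) * c ^ (p + 1) * δ ^ (M - 2 * (p + 1)) := by
      rw [mul_sum, sum_range_succ _ (d + 1)]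
      refine le_add_of_le_of_nonneg (sum_le_sum fun p _ => ?_) (by positivity)
      rw [show M - 2 * (p + 1) = M - 2 - 2 * p by omega]
      have : (d.choose p : ℝ) ≤ (d + 1).choose p := by
        exact_mod_cast Nat.choose_le_choose p (by omega)
      calc _ = (d.choose p : ℝ) * c ^ (p + 1) * δ ^ (M - 2 - 2 * p) := by ring
        _ ≤ _ := by gcongr
    rw [sum_range_succ']
    simp only [Nat.choose_zero_right, Nat.cast_one, pow_zero, mul_zero, Nat.sub_zero, one_mul,
      Nat.choose_succ_succ (d + 1), Nat.cast_add, add_mul, sum_add_distrib]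
    rw [domSeq]
    linarith

end

/-- Divided by binomial coefficients, the recurrence for `e_d` has coefficients `S/(n-d-1)` and
`(d+1)/(n-d-1)`. The first slightly exceeds `δ`; the excess is moved to the second term through
`mul_domSeq_succ_le`, which is why the second coefficient becomes `6D/n`. -/
lemma abs_esum_le_domSeq {n : ℕ} (x : Cube n) {δ : ℝ} (hδ : 0 ≤ δ) (hδ1 : δ ≤ 1)
    (hS : |coordSum x| ≤ δ * n) {D : ℕ} (hD : 12 * D ^ 2 ≤ n) : ∀ d : ℕ, d ≤ D →
    |esum d x| ≤ n.choose d * domSeq δ (6 * D / n) d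
  | 0, _ => by simp [esum_zero, domSeq]
  | 1, _ => by simpa [esum_one, domSeq, mul_comm] using hS
  | d + 2, hd => by
    have hDn : 12 * D ≤ n := by nlinarith
    have hn0 : (0 : ℝ) < n := by
      have : 0 < n := by omega
      exact_mod_cast this
    have hDn' : (12 : ℝ) * D ≤ n := by exact_mod_cast hDn
    have hc : (0 : ℝ) ≤ 6 * D / n := by positivity
    have hc1 : (6 : ℝ) * D / n ≤ 1 := by rw [div_le_one hn0]; linarith
    have ih1 := abs_esum_le_domSeq x hδ hδ1 hS hD (d + 1) (by omega)
    have ih2 := abs_esum_le_domSeq x hδ hδ1 hS hD d (by omega)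
    have hd' : (d : ℝ) + 2 ≤ D := by exact_mod_cast hd
    have hdn : (0 : ℝ) ≤ n - d := by linarith
    set a := domSeq δ (6 * D / n) (d + 1)
    set b := domSeq δ (6 * D / n) d
    have hb : 0 ≤ b := domSeq_nonneg hδ hc d
    have hab : δ * a ≤ 2 * b := mul_domSeq_succ_le hδ hδ1 hc hc1 d
    have c1 : (n.choose (d + 1) : ℝ) * (d + 1) = n.choose d * (n - d) := by
      have := Nat.choose_succ_right_eq n d
      rw [← Nat.cast_sub (show d ≤ n by omega)]
      exact_mod_cast this
    have c2 : (n.choose (d + 2) : ℝ) * (d + 2) = n.choose (d + 1) * (n - (d + 1)) := by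
      have := Nat.choose_succ_right_eq n (d + 1)
      have e : ((n - (d + 1) : ℕ) : ℝ) = n - (d + 1) := by
        rw [Nat.cast_sub (show d + 1 ≤ n by omega)]; push_cast; ring
      rw [← e]
      exact_mod_cast this
    -- The excess `(d+1)δa` is at most `2(d+1)b`, so `3Db` must be paid for. Since `n - d - 1 ≥
    -- n/2`, the coefficient `6D/n` suffices.
    have key : δ * n * a + (d + 1) * b ≤ (n - (d + 1)) * (δ * a + 6 * D / n * b) := by
      have e1 : (3 : ℝ) * D ≤ (n - (d + 1)) * (6 * D / n) := by
        rw [← mul_div_assoc, le_div_iff₀ hn0]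
        nlinarith
      have e2 : 3 * D * b ≤ (n - (d + 1)) * (6 * D / n) * b := mul_le_mul_of_nonneg_right e1 hb
      have e3 : (d + 1) * (δ * a) ≤ (d + 1) * (2 * b) := by gcongr
      nlinarith
    have hrec := esum_succ_succ x d
    have hm : ((d : ℝ) + 2) * |esum (d + 2) x| ≤
        ((d : ℝ) + 2) * (n.choose (d + 2) * (δ * a + 6 * D / n * b)) := by
      calc ((d : ℝ) + 2) * |esum (d + 2) x| = |((d : ℝ) + 2) * esum (d + 2) x| := by
            rw [abs_mul, abs_of_nonneg (show (0 : ℝ) ≤ d + 2 by positivity)]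
        _ ≤ |coordSum x| * |esum (d + 1) x| + (n - d) * |esum d x| := by
            rw [hrec]
            refine (abs_sub _ _).trans_eq ?_
            rw [abs_mul, abs_mul, abs_of_nonneg hdn]
        _ ≤ δ * n * (n.choose (d + 1) * a) + (n - d) * (n.choose d * b) := by gcongr
        _ = n.choose (d + 1) * (δ * n * a + (d + 1) * b) := by linear_combination (-b) * c1
        _ ≤ n.choose (d + 1) * ((n - (d + 1)) * (δ * a + 6 * D / n * b)) := by gcongr
        _ = _ := by linear_combination (-(δ * a + 6 * D / n * b)) * c2
    exact le_of_mul_le_mul_left hm (by positivity)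

/-- For `12d² ≤ n` the correction series is dominated by a geometric series of ratio at most `1/2`,
whose tail is absorbed by the term `p = k + 1`. The exponent of `δ` in that term is truncated to
`0`. -/
lemma abs_esum_le_sum {n : ℕ} (x : Cube n) {δ : ℝ} (hδ : 0 ≤ δ) (hδ1 : δ ≤ 1)
    (hS : |coordSum x| ≤ δ * n) {k d : ℕ} (hd : 2 * k + 1 ≤ d) (hdn : d ≤ n) :
    |esum d x| ≤ n.choose d * (δ ^ (2 * k + 1) +
      ∑ p ∈ Icc 1 (k + 1), 2 * (12 * (d : ℝ) ^ 2 / n) ^ p * δ ^ (2 * k + 1 - 2 * p)) := by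
  have hn0 : (0 : ℝ) < n := by
    have : 0 < n := by omega
    exact_mod_cast this
  have hterm : ∀ p, 0 ≤ 2 * (12 * (d : ℝ) ^ 2 / n) ^ p * δ ^ (2 * k + 1 - 2 * p) := fun p => by
    positivity
  rcases le_or_gt (12 * d ^ 2) n with hle | hgt
  · refine (abs_esum_le_domSeq x hδ hδ1 hS hle d le_rfl).trans ?_
    gcongr
    set z : ℝ := 6 * (d : ℝ) ^ 2 / n with hz
    have hz0 : 0 ≤ z := by positivity
    have hz2 : z ≤ 1 / 2 := by
      have : (12 : ℝ) * d ^ 2 ≤ n := by exact_mod_cast hle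
      rw [hz, div_le_iff₀ hn0]; linarith
    have hzz : (12 : ℝ) * d ^ 2 / n = 2 * z := by rw [hz]; ring
    calc domSeq δ (6 * d / n) d
        ≤ ∑ p ∈ range (d + 1), (d.choose p : ℝ) * (6 * d / n) ^ p * δ ^ (2 * k + 1 - 2 * p) :=
          domSeq_le_sum hδ hδ1 (by positivity) d (2 * k + 1) hd
      _ ≤ ∑ p ∈ range (d + 1), z ^ p * δ ^ (2 * k + 1 - 2 * p) := by
          refine sum_le_sum fun p _ => ?_
          gcongr
          have : (d.choose p : ℝ) ≤ (d : ℝ) ^ p := by exact_mod_cast Nat.choose_le_pow d p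
          calc _ ≤ (d : ℝ) ^ p * (6 * d / n) ^ p := by gcongr
            _ = z ^ p := by rw [← mul_pow, hz]; congr 1; ring
      _ = δ ^ (2 * k + 1) + ∑ p ∈ Ico 1 (k + 1), z ^ p * δ ^ (2 * k + 1 - 2 * p) +
            ∑ p ∈ Ico (k + 1) (d + 1), z ^ p * δ ^ (2 * k + 1 - 2 * p) := by
          rw [range_eq_Ico, ← sum_Ico_consecutive _ (Nat.zero_le 1) (show 1 ≤ d + 1 by omega),
            ← sum_Ico_consecutive _ (show 1 ≤ k + 1 by omega) (show k + 1 ≤ d + 1 by omega),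
            ← add_assoc]
          simp
      _ ≤ δ ^ (2 * k + 1) +
          ∑ p ∈ Ico 1 (k + 1), 2 * (12 * (d : ℝ) ^ 2 / n) ^ p * δ ^ (2 * k + 1 - 2 * p) +
            2 * (12 * (d : ℝ) ^ 2 / n) ^ (k + 1) * δ ^ (2 * k + 1 - 2 * (k + 1)) := by
          gcongr with p hp
          · rw [hzz]
            calc z ^ p ≤ (2 * z) ^ p := by gcongr; linarith
              _ ≤ 2 * (2 * z) ^ p := by linarith [pow_nonneg (by positivity : 0 ≤ 2 * z) p]
          · calc _ ≤ ∑ p ∈ Ico (k + 1) (d + 1), z ^ p :=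
                  sum_le_sum fun p _ => mul_le_of_le_one_right (by positivity)
                    (pow_le_one₀ hδ hδ1)
              _ ≤ z ^ (k + 1) / (1 - z) := geom_sum_Ico_le_of_lt_one hz0 (by linarith)
              _ ≤ 2 * z ^ (k + 1) := by
                  rw [div_le_iff₀ (by linarith)]
                  nlinarith [pow_nonneg hz0 (k + 1)]
              _ ≤ _ := by
                  rw [show 2 * k + 1 - 2 * (k + 1) = 0 by omega, pow_zero, mul_one, hzz]
                  gcongr
                  linarith
      _ = _ := by
          rw [← Ico_add_one_right_eq_Icc, sum_Ico_succ_top (show 1 ≤ k + 1 by omega), add_assoc]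
  -- For `12d² > n` the term `p = k + 1` alone exceeds `1`, and the trivial bound by the number of
  -- monomials is enough.
  · refine (abs_esum_le d x).trans (le_mul_of_one_le_right (by positivity) ?_)
    have h1 : 2 * (12 * (d : ℝ) ^ 2 / n) ^ (k + 1) * δ ^ (2 * k + 1 - 2 * (k + 1)) ≤ _ :=
      single_le_sum (f := fun p => 2 * (12 * (d : ℝ) ^ 2 / n) ^ p * δ ^ (2 * k + 1 - 2 * p))
        (fun p _ => hterm p) (mem_Icc.2 ⟨by omega, le_rfl⟩ : k + 1 ∈ Icc 1 (k + 1))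
    rw [show 2 * k + 1 - 2 * (k + 1) = 0 by omega, pow_zero, mul_one] at h1
    have h2 : 1 ≤ 12 * (d : ℝ) ^ 2 / n := by
      rw [one_le_div hn0]; exact_mod_cast hgt.le
    have h3 := one_le_pow₀ h2 (n := k + 1)
    have : 0 ≤ δ ^ (2 * k + 1) := by positivity
    linarith

end

end HiddenDirection

namespace HiddenDirection

noncomputable section

open Finset

/-! ### The level weights of the witness and the pairwise correlations -/

/-- The squared `L²`-norm of the degree `2r + 1` part of the averaged witness. -/
def levelWeight (k n r : ℕ) : ℝ := witnessCoeff k n r ^ 2 * n.choose (2 * r + 1)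

lemma levelWeight_nonneg (k n r : ℕ) : 0 ≤ levelWeight k n r := by unfold levelWeight; positivity

lemma levelWeight_eq (k n r : ℕ) : levelWeight k n r = 1 / 4 * ((r + 1).choose (k + 1) : ℝ) ^ 2 *
    (Real.Gamma (r + 3 / 2) ^ 2 / (n : ℝ) ^ (2 * r + 1) * n.choose (2 * r + 1)) := by
  have h1 : (√(n : ℝ) ^ (2 * r + 1)) ^ 2 = (n : ℝ) ^ (2 * r + 1) := by
    rw [← pow_mul, mul_comm, pow_mul, Real.sq_sqrt (by positivity)]
  have h2 : ((-1 : ℝ) ^ r) ^ 2 = 1 := by rw [← pow_mul, mul_comm, pow_mul]; simp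
  rw [levelWeight, witnessCoeff, mul_pow, div_pow, div_pow, h1, mul_pow, mul_pow, h2]
  ring

lemma levelWeight_of_lt {k n r : ℕ} (h : r < k) : levelWeight k n r = 0 := by
  rw [levelWeight_eq, Nat.choose_eq_zero_of_lt (by omega)]
  simp

lemma levelWeight_self_pos {k n : ℕ} (h : 2 * k + 1 ≤ n) : 0 < levelWeight k n k := by
  have h1 : 0 < n.choose (2 * k + 1) := Nat.choose_pos h
  have h2 : 0 < Real.Gamma ((k : ℝ) + 3 / 2) := Real.Gamma_pos_of_pos (by positivity)
  have h3 : (0 : ℝ) < n := by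
    have : 0 < n := by omega
    exact_mod_cast this
  rw [levelWeight_eq, Nat.choose_self]
  positivity

/-- Consecutive values have ratio at most `(2r+3) / (4(2r+1))`; the product telescopes into decay
`4^{-(r-k)}` with a linear correction. -/
lemma gamma_sq_mul_choose_le {n k r : ℕ} (hkr : k ≤ r) :
    (Real.Gamma (r + 3 / 2) ^ 2 / (n : ℝ) ^ (2 * r + 1) * n.choose (2 * r + 1)) * 4 ^ r *
      (2 * k + 1) ≤ (Real.Gamma (k + 3 / 2) ^ 2 / (n : ℝ) ^ (2 * k + 1) * n.choose (2 * k + 1)) *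
        4 ^ k * (2 * r + 1) := by
  induction r, hkr using Nat.le_induction with
  | base => exact le_rfl
  | succ r _ ih =>
    rcases Nat.eq_zero_or_pos n with rfl | hn
    · simp
    have hn0 : (0 : ℝ) < n := by exact_mod_cast hn
    set v := Real.Gamma (r + 3 / 2) ^ 2 / (n : ℝ) ^ (2 * r + 1) * n.choose (2 * r + 1) with hv
    have hv0 : 0 ≤ v := by positivity
    have hG : Real.Gamma ((r + 1 : ℕ) + 3 / 2) = (r + 3 / 2) * Real.Gamma (r + 3 / 2) := by
      rw [← Real.Gamma_add_one (by positivity)]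
      congr 1
      push_cast
      ring
    have hC : (n.choose (2 * (r + 1) + 1) : ℝ) * ((2 * r + 3) * (2 * r + 2)) ≤
        n.choose (2 * r + 1) * (n : ℝ) ^ 2 := by
      have e1 := Nat.choose_succ_right_eq n (2 * r + 1)
      have e2 := Nat.choose_succ_right_eq n (2 * r + 2)
      have : n.choose (2 * (r + 1) + 1) * ((2 * r + 3) * (2 * r + 2)) ≤
          n.choose (2 * r + 1) * n ^ 2 := by
        calc n.choose (2 * (r + 1) + 1) * ((2 * r + 3) * (2 * r + 2))
            = n.choose (2 * r + 2 + 1) * (2 * r + 2 + 1) * (2 * r + 2) := by ring_nf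
          _ = n.choose (2 * r + 1 + 1) * (2 * r + 1 + 1) * (n - (2 * r + 2)) := by rw [e2]; ring
          _ = n.choose (2 * r + 1) * (n - (2 * r + 1)) * (n - (2 * r + 2)) := by rw [e1]
          _ ≤ n.choose (2 * r + 1) * n * n := by gcongr <;> omega
          _ = _ := by ring
      exact_mod_cast this
    have step : (Real.Gamma ((r + 1 : ℕ) + 3 / 2) ^ 2 / (n : ℝ) ^ (2 * (r + 1) + 1) *
        n.choose (2 * (r + 1) + 1)) * (4 * (2 * r + 1)) ≤ v * (2 * r + 3) := by
      rw [hG]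
      have hC' : (n.choose (2 * (r + 1) + 1) : ℝ) ≤
          n.choose (2 * r + 1) * (n : ℝ) ^ 2 / ((2 * r + 3) * (2 * r + 2)) := by
        rw [le_div_iff₀ (by positivity)]; exact hC
      calc _ ≤ ((r + 3 / 2) * Real.Gamma (r + 3 / 2)) ^ 2 / (n : ℝ) ^ (2 * (r + 1) + 1) *
            (n.choose (2 * r + 1) * (n : ℝ) ^ 2 / ((2 * r + 3) * (2 * r + 2))) *
              (4 * (2 * r + 1)) := by gcongr
        _ = v * ((2 * r + 3) * ((2 * r + 1) / (2 * r + 2))) := by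
            rw [hv, show 2 * (r + 1) + 1 = (2 * r + 1) + 2 by ring, pow_add (n : ℝ)]
            field_simp
            ring
        _ ≤ v * ((2 * r + 3) * 1) := by
            gcongr
            rw [div_le_one (by positivity)]
            linarith
        _ = _ := by ring
    have h1 : (0 : ℝ) < 2 * r + 1 := by positivity
    refine le_of_mul_le_mul_right ?_ h1
    push_cast at step ⊢
    calc _ = (Real.Gamma (r + 1 + 3 / 2) ^ 2 / (n : ℝ) ^ (2 * (r + 1) + 1) *
        n.choose (2 * (r + 1) + 1)) * (4 * (2 * r + 1)) * (4 ^ r * (2 * k + 1)) := by ring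
      _ ≤ v * (2 * r + 3) * (4 ^ r * (2 * k + 1)) := by gcongr
      _ = (v * 4 ^ r * (2 * k + 1)) * (2 * r + 3) := by ring
      _ ≤ _ := mul_le_mul_of_nonneg_right ih (by positivity)
      _ = _ := by ring

lemma levelWeight_le (k n r : ℕ) : levelWeight k n r ≤
    levelWeight k n k * ((2 * r + 1) * ((r + 1).choose (k + 1) : ℝ) ^ 2 * (4 ^ k / 4 ^ r)) := by
  rcases lt_or_ge r k with h | h
  · rw [levelWeight_of_lt h]
    exact mul_nonneg (levelWeight_nonneg _ _ _) (by positivity)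
  have h1 := gamma_sq_mul_choose_le (n := n) h
  rw [levelWeight_eq k n k, levelWeight_eq k n r, Nat.choose_self]
  set v := Real.Gamma (r + 3 / 2) ^ 2 / (n : ℝ) ^ (2 * r + 1) * n.choose (2 * r + 1)
  set w := Real.Gamma (k + 3 / 2) ^ 2 / (n : ℝ) ^ (2 * k + 1) * n.choose (2 * k + 1)
  have hv : 0 ≤ v := by positivity
  have h2 : v ≤ w * (4 ^ k / 4 ^ r) * (2 * r + 1) := by
    have h3 : v * 4 ^ r ≤ v * 4 ^ r * (2 * k + 1) := by
      refine le_mul_of_one_le_right (by positivity) ?_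
      have : (0 : ℝ) ≤ k := by positivity
      linarith
    have h4 : (0 : ℝ) < 4 ^ r := by positivity
    refine le_of_mul_le_mul_right ?_ h4
    calc _ ≤ _ := h3.trans h1
      _ = _ := by field_simp
  calc _ ≤ 1 / 4 * ((r + 1).choose (k + 1) : ℝ) ^ 2 * (w * (4 ^ k / 4 ^ r) * (2 * r + 1)) := by
        gcongr
    _ = _ := by push_cast; ring

/-- One term of the binomial expansion of `(1/4 + 1)^{r+1}`. The base `5/4` is chosen because its
square is well below the `4` of the geometric decay. -/
lemma choose_le_four_pow_mul (r k : ℕ) :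
    ((r + 1).choose (k + 1) : ℝ) ≤ 4 ^ (k + 1) * (5 / 4) ^ (r + 1) := by
  rcases lt_or_ge r k with h | h
  · rw [Nat.choose_eq_zero_of_lt (by omega)]
    simp only [Nat.cast_zero]; positivity
  have h1 := add_pow (1 / 4 : ℝ) 1 (r + 1)
  have h2 := single_le_sum (f := fun m => (1 / 4 : ℝ) ^ m * 1 ^ (r + 1 - m) * ((r + 1).choose m : ℝ))
    (fun m _ => by positivity) (mem_range.2 (by omega) : k + 1 ∈ range (r + 1 + 1))
  rw [← h1] at h2
  norm_num at h2
  rw [div_pow, one_pow] at h2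
  have h4 : (0 : ℝ) < 4 ^ (k + 1) := by positivity
  calc ((r + 1).choose (k + 1) : ℝ) =
        4 ^ (k + 1) * (1 / 4 ^ (k + 1) * ((r + 1).choose (k + 1) : ℝ)) := by field_simp
    _ ≤ _ := by gcongr

/-- The level weights are concentrated at degrees of order `k`: the squared binomial grows like
`(25/16)^r`, the polynomial factor costs `(4/3)^r`, and the decay `4^{-r}` leaves the ratio `25/48 ≤
3/4`. -/
lemma sum_levelWeight_mul_pow_le {k : ℕ} (hk : 1 ≤ k) (n h : ℕ) :
    ∑ r ∈ range h, levelWeight k n r * ((2 * r + 1 : ℕ) : ℝ) ^ (2 * k + 2) ≤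
      (12000 * (k : ℝ)) ^ (2 * k + 2) * levelWeight k n k := by
  set K : ℝ := 2 * 4 ^ k * 16 ^ (k + 1) * (25 / 16) * ((2 * k + 3).factorial * 8 ^ (2 * k + 3))
  have hexp4 : Real.exp (1 / 4) ≤ 4 / 3 := by
    have h1 := Real.add_one_le_exp (-(1 / 4) : ℝ)
    rw [Real.exp_neg] at h1
    rw [show (4 / 3 : ℝ) = (3 / 4)⁻¹ by norm_num]
    exact le_inv_of_le_inv₀ (by norm_num) (by linarith)
  have hexp8 : Real.exp (1 / 8) ≤ 2 := by
    have : Real.exp (1 / 8) ≤ Real.exp (1 / 4) := Real.exp_le_exp.2 (by norm_num)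
    linarith
  have hterm : ∀ r : ℕ, ((2 * r + 1) * ((r + 1).choose (k + 1) : ℝ) ^ 2 * (4 ^ k / 4 ^ r)) *
      ((2 * r + 1 : ℕ) : ℝ) ^ (2 * k + 2) ≤ K * (3 / 4) ^ r := by
    intro r
    have h1 := choose_le_four_pow_mul r k
    -- The exponent is `2k + 3` because `levelWeight_le` brings one further factor `2r + 1`. The
    -- power is bounded by a factorial times `exp((2r+1)/8)`.
    have h2 : (2 * r + 1 : ℝ) ^ (2 * k + 3) ≤
        (2 * k + 3).factorial * 8 ^ (2 * k + 3) * (2 * (4 / 3) ^ r) := by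
      have h3 := Real.pow_div_factorial_le_exp (x := (2 * r + 1) / 8) (by positivity) (2 * k + 3)
      have h4 : Real.exp ((2 * r + 1) / 8) ≤ 2 * (4 / 3) ^ r := by
        rw [show ((2 : ℝ) * r + 1) / 8 = 1 / 8 + r * (1 / 4) by ring, Real.exp_add,
          Real.exp_nat_mul]
        gcongr
      have h5 := h3.trans h4
      rw [div_pow, div_div, div_le_iff₀ (by positivity)] at h5
      linarith
    calc _ = (2 * r + 1 : ℝ) ^ (2 * k + 3) * ((r + 1).choose (k + 1) : ℝ) ^ 2 * (4 ^ k / 4 ^ r) := by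
          push_cast; ring
      _ ≤ ((2 * k + 3).factorial * 8 ^ (2 * k + 3) * (2 * (4 / 3) ^ r)) *
            (4 ^ (k + 1) * (5 / 4) ^ (r + 1)) ^ 2 * (4 ^ k / 4 ^ r) := by gcongr
      _ = K * (25 / 48) ^ r := by
          have e1 : ((4 : ℝ) ^ (k + 1)) ^ 2 = 16 ^ (k + 1) := by rw [← pow_mul, mul_comm, pow_mul]; norm_num
          have e2 : ((5 / 4 : ℝ) ^ (r + 1)) ^ 2 = 25 / 16 * (25 / 16) ^ r := by
            rw [← pow_mul, mul_comm, pow_mul, pow_succ]; norm_num; ring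
          have e3 : (25 / 48 : ℝ) ^ r = (4 / 3) ^ r * (25 / 16) ^ r / 4 ^ r := by
            rw [← mul_pow, ← div_pow]; norm_num
          rw [mul_pow, e1, e2, e3]
          ring
      _ ≤ _ := by
          refine mul_le_mul_of_nonneg_left (pow_le_pow_left₀ (by norm_num) (by norm_num) r) ?_
          positivity
  have hgeom : ∑ r ∈ range h, (3 / 4 : ℝ) ^ r ≤ 4 := by
    rw [geom_sum_eq (by norm_num), div_le_iff_of_neg (by norm_num)]
    have : (0 : ℝ) ≤ (3 / 4) ^ h := by positivity
    linarith
  -- The numerical factors combine to `500 · 4 · 16 · 25 · 2 · 64 = 102400000` per unit of `k + 1`,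
  -- which is below `12000²`.
  have hK : K * 4 ≤ (12000 * (k : ℝ)) ^ (2 * k + 2) := by
    have hk1 : (1 : ℝ) ≤ k := by exact_mod_cast hk
    have f1 : ((2 * k + 3).factorial : ℝ) ≤ 5 * 25 ^ (k + 1) * 2 ^ (k + 1) * k ^ (2 * k + 2) := by
      have g1 : ((2 * k + 3).factorial : ℝ) ≤ ((2 * k + 3 : ℕ) : ℝ) ^ (2 * k + 3) := by
        exact_mod_cast Nat.factorial_le_pow _
      have g2 : ((2 * k + 3 : ℕ) : ℝ) ≤ 5 * k := by push_cast; linarith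
      have g3 : (k : ℝ) ≤ 2 ^ (k + 1) := by
        exact_mod_cast (Nat.lt_two_pow_self (n := k)).le.trans (Nat.pow_le_pow_right (by norm_num) (by omega))
      calc _ ≤ (5 * (k : ℝ)) ^ (2 * k + 3) := g1.trans (by gcongr)
        _ = 5 * 25 ^ (k + 1) * k * k ^ (2 * k + 2) := by
            rw [mul_pow, show 2 * k + 3 = 2 * (k + 1) + 1 by ring, pow_succ (5 : ℝ), pow_mul,
              show 2 * k + 2 = 2 * (k + 1) by ring]
            norm_num
            ring
        _ ≤ _ := by gcongr
    have f2 : (8 : ℝ) ^ (2 * k + 3) = 8 * 64 ^ (k + 1) := by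
      rw [show 2 * k + 3 = 2 * (k + 1) + 1 by ring, pow_succ, pow_mul]; norm_num; ring
    have f3 : (4 : ℝ) ^ k ≤ 4 ^ (k + 1) := pow_le_pow_right₀ (by norm_num) (by omega)
    have f4 : (500 : ℝ) ≤ 500 ^ (k + 1) := le_self_pow₀ (by norm_num) (by omega)
    calc K * 4 ≤ 2 * 4 ^ (k + 1) * 16 ^ (k + 1) * (25 / 16) *
          ((5 * 25 ^ (k + 1) * 2 ^ (k + 1) * k ^ (2 * k + 2)) * (8 * 64 ^ (k + 1))) * 4 := by
          simp only [K]
          rw [f2]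
          gcongr
      _ = 500 * (4 ^ (k + 1) * 16 ^ (k + 1) * 25 ^ (k + 1) * 2 ^ (k + 1) * 64 ^ (k + 1)) *
          k ^ (2 * k + 2) := by ring
      _ ≤ 500 ^ (k + 1) * (4 ^ (k + 1) * 16 ^ (k + 1) * 25 ^ (k + 1) * 2 ^ (k + 1) * 64 ^ (k + 1)) *
          k ^ (2 * k + 2) := by gcongr
      _ = 102400000 ^ (k + 1) * k ^ (2 * k + 2) := by
          rw [← mul_pow, ← mul_pow, ← mul_pow, ← mul_pow, ← mul_pow]; norm_num
      _ ≤ 144000000 ^ (k + 1) * k ^ (2 * k + 2) := by gcongr; norm_num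
      _ = _ := by
          rw [mul_pow, show 2 * k + 2 = 2 * (k + 1) by ring, pow_mul 12000]; norm_num
  calc _ ≤ ∑ r ∈ range h, levelWeight k n k * (K * (3 / 4) ^ r) := by
        refine sum_le_sum fun r _ => ?_
        calc _ ≤ _ := mul_le_mul_of_nonneg_right (levelWeight_le k n r) (by positivity)
          _ ≤ _ := by
              rw [mul_assoc]
              exact mul_le_mul_of_nonneg_left (hterm r) (levelWeight_nonneg _ _ _)
    _ = levelWeight k n k * (K * ∑ r ∈ range h, (3 / 4 : ℝ) ^ r) := by
        rw [mul_sum, mul_sum]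
    _ ≤ levelWeight k n k * (K * 4) := by
        have := levelWeight_nonneg k n k
        have : 0 ≤ K := by positivity
        gcongr
    _ ≤ _ := by
        rw [mul_comm]
        exact mul_le_mul_of_nonneg_right hK (levelWeight_nonneg _ _ _)

end

end HiddenDirection

/-! ### Parseval's identity, the planted distributions and their pairwise correlations -/

namespace HiddenDirection

noncomputable section

open Finset

lemma abs_avgWitness_le_iSup (k n : ℕ) (x : Cube n) :
    |avgWitness k n x| ≤ ⨆ z : Cube n, |avgWitness k n z| :=
  le_ciSup (f := fun z : Cube n => |avgWitness k n z|) (Set.finite_range _).bddAbove x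

lemma sum_avgWitness_mul {n h : ℕ} (hn : n = 2 * h + 1) (k : ℕ) (u v : Cube n) :
    ∑ x, avgWitness k n (u * x) * avgWitness k n (v * x) =
      2 ^ n * ∑ r ∈ range (h + 1), witnessCoeff k n r ^ 2 * esum (2 * r + 1) (u * v) := by
  simp_rw [avgWitness_eq hn, sum_mul_sum]
  rw [sum_comm, mul_sum]
  refine sum_congr rfl fun r hr => ?_
  rw [sum_comm]
  have h1 : ∀ r' ∈ range (h + 1), ∑ x : Cube n,
      witnessCoeff k n r * esum (2 * r + 1) (u * x) *
        (witnessCoeff k n r' * esum (2 * r' + 1) (v * x)) =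
      if r = r' then 2 ^ n * (witnessCoeff k n r ^ 2 * esum (2 * r + 1) (u * v)) else 0 := by
    intro r' _
    have h2 := sum_esum_mul_esum (2 * r + 1) (2 * r' + 1) u v
    rw [sum_congr rfl fun x _ => show _ = witnessCoeff k n r * witnessCoeff k n r' *
      (esum (2 * r + 1) (u * x) * esum (2 * r' + 1) (v * x)) by ring, ← mul_sum, h2]
    by_cases h : r = r'
    · subst h; simp; ring
    · rw [if_neg h, if_neg (by omega), mul_zero]
  rw [sum_congr rfl h1, sum_ite_eq, if_pos hr]

/-- Parseval's identity, with the mean square bounded by the square of the maximum. -/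
lemma sum_levelWeight_le {n h : ℕ} (hn : n = 2 * h + 1) (k : ℕ) :
    ∑ r ∈ range (h + 1), levelWeight k n r ≤ (⨆ z : Cube n, |avgWitness k n z|) ^ 2 := by
  have h1 := sum_avgWitness_mul hn k 1 1
  simp only [one_mul, esum_one_eq] at h1
  have h2 : ∑ x : Cube n, avgWitness k n x * avgWitness k n x ≤
      ∑ x : Cube n, (⨆ z : Cube n, |avgWitness k n z|) ^ 2 := by
    refine sum_le_sum fun x _ => ?_
    rw [← sq, ← sq_abs]
    exact pow_le_pow_left₀ (abs_nonneg _) (abs_avgWitness_le_iSup k n x) 2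
  rw [h1] at h2
  simp only [sum_const, card_univ, Fintype.card_pi, Fintype.card_units_int, prod_const,
    Fintype.card_fin, nsmul_eq_mul] at h2
  push_cast at h2
  exact le_of_mul_le_mul_left h2 (by positivity)

lemma iSup_abs_avgWitness_pos {n h k : ℕ} (hn : n = 2 * h + 1) (hk : k ≤ h) :
    0 < ⨆ z : Cube n, |avgWitness k n z| := by
  have h1 := sum_levelWeight_le hn k
  have h2 := levelWeight_self_pos (k := k) (n := n) (by omega)
  have h3 := single_le_sum (f := levelWeight k n) (fun r _ => levelWeight_nonneg k n r)
    (mem_range.2 (by omega) : k ∈ range (h + 1))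
  have h4 : 0 ≤ ⨆ z : Cube n, |avgWitness k n z| := Real.iSup_nonneg fun _ => abs_nonneg _
  exact lt_of_le_of_ne h4 fun h => by rw [← h] at h1; norm_num at h1; linarith

lemma exists_avgWitness_ne_zero {n h k : ℕ} (hn : n = 2 * h + 1) (hk : k ≤ h) :
    ∃ x : Cube n, avgWitness k n x ≠ 0 := by
  by_contra hc
  push Not at hc
  have := iSup_abs_avgWitness_pos hn hk
  simp [hc] at this

lemma abs_witness_le_one (k n : ℕ) (x : Cube n) : |witness k n x| ≤ 1 := by
  rw [witness, abs_div]
  refine div_le_one_of_le₀ ?_ (abs_nonneg _)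
  exact (abs_avgWitness_le_iSup k n x).trans (le_abs_self _)

lemma sum_prod_units {n : ℕ} (f : Cube n → ℤˣ → ℝ) :
    ∑ z : Cube n × ℤˣ, f z.1 z.2 = ∑ x, (f x 1 + f x (-1)) := by
  rw [Fintype.sum_prod_type]
  exact sum_congr rfl fun x _ => sum_units _

lemma card_cube (n : ℕ) : (Fintype.card (Cube n) : ℝ) = 2 ^ n := by simp

lemma isProbMass_refDist (n : ℕ) : IsProbMass (refDist n) := by
  refine ⟨fun z => by unfold refDist; positivity, ?_⟩
  simp only [refDist]
  rw [sum_prod_units (fun _ _ => ((2 : ℝ) ^ (n + 1))⁻¹), sum_const, card_univ, nsmul_eq_mul,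
    card_cube]
  field_simp
  ring

lemma isProbMass_plantedDist (k n : ℕ) (u : Cube n) : IsProbMass (plantedDist k n u) := by
  refine ⟨fun z => ?_, ?_⟩
  · have h1 := abs_le.1 (abs_witness_le_one k n (u * z.1))
    unfold plantedDist
    refine mul_nonneg (by positivity) ?_
    rcases Int.units_eq_one_or z.2 with h | h <;> simp only [h, sgn_one, sgn_neg_one] <;> linarith
  · simp only [plantedDist]
    rw [sum_prod_units (fun x y => ((2 : ℝ) ^ (n + 1))⁻¹ * (1 + sgn y * witness k n (u * x)))]
    rw [sum_congr rfl fun x _ => show _ = 2 * ((2 : ℝ) ^ (n + 1))⁻¹ by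
      rw [sgn_one, sgn_neg_one]; ring, sum_const, card_univ, nsmul_eq_mul, card_cube]
    field_simp
    ring

lemma pairCorr_eq {n h : ℕ} (hn : n = 2 * h + 1) (k : ℕ) (u v : Cube n) :
    pairCorr (refDist n) (plantedDist k n u) (plantedDist k n v) =
      |∑ r ∈ range (h + 1), witnessCoeff k n r ^ 2 * esum (2 * r + 1) (u * v)| /
        (⨆ z : Cube n, |avgWitness k n z|) ^ 2 := by
  have hd : ∀ (w : Cube n) (z : Cube n × ℤˣ),
      plantedDist k n w z / refDist n z - 1 = sgn z.2 * witness k n (w * z.1) := by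
    intro w z
    rw [plantedDist, refDist]
    field_simp
    ring
  rw [pairCorr, expect]
  simp only [hd]
  simp only [refDist]
  rw [sum_prod_units (fun x y => ((2 : ℝ) ^ (n + 1))⁻¹ * (sgn y * witness k n (u * x) *
    (sgn y * witness k n (v * x))))]
  set N := ⨆ z : Cube n, |avgWitness k n z|
  have h1 : ∑ x : Cube n, (((2 : ℝ) ^ (n + 1))⁻¹ * (sgn 1 * witness k n (u * x) *
      (sgn 1 * witness k n (v * x))) + ((2 : ℝ) ^ (n + 1))⁻¹ * (sgn (-1) * witness k n (u * x) *
      (sgn (-1) * witness k n (v * x)))) = ((2 : ℝ) ^ n)⁻¹ / N ^ 2 *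
        ∑ x : Cube n, avgWitness k n (u * x) * avgWitness k n (v * x) := by
    rw [mul_sum]
    refine sum_congr rfl fun x _ => ?_
    rw [sgn_one, sgn_neg_one, witness, witness, pow_succ, mul_inv]
    ring
  rw [h1, sum_avgWitness_mul hn, div_mul_eq_mul_div, ← mul_assoc, inv_mul_cancel₀ (by positivity),
    one_mul, abs_div, abs_of_nonneg (sq_nonneg N)]

/-- Interpolation between the moments `0` and `2k + 2`: for `B = 12000k` one has `(d/B)^{2p} ≤ 1 +
(d/B)^{2k+2}`. Parseval bounds both resulting sums by `N²`. -/
lemma sum_levelWeight_mul_pow_two_mul_le {n h k p : ℕ} (hn : n = 2 * h + 1) (hk : 1 ≤ k)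
    (hkh : k ≤ h) (hp : p ≤ k + 1) :
    ∑ r ∈ range (h + 1), levelWeight k n r * ((2 * r + 1 : ℕ) : ℝ) ^ (2 * p) ≤
      2 * (12000 * (k : ℝ)) ^ (2 * p) * (⨆ z : Cube n, |avgWitness k n z|) ^ 2 := by
  set N := ⨆ z : Cube n, |avgWitness k n z|
  have hk0 : (0 : ℝ) < k := by exact_mod_cast hk
  set B : ℝ := 12000 * k with hB
  have hB0 : 0 < B := by positivity
  have h1 := sum_levelWeight_le hn k
  have h2 := sum_levelWeight_mul_pow_le hk n (h + 1)
  have h3 := single_le_sum (f := levelWeight k n) (fun r _ => levelWeight_nonneg k n r)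
    (mem_range.2 (by omega) : k ∈ range (h + 1))
  have hpt : ∀ d : ℝ, 0 ≤ d → d ^ (2 * p) ≤ B ^ (2 * p) * (1 + d ^ (2 * k + 2) / B ^ (2 * k + 2)) := by
    intro d hd
    rw [← div_pow, ← div_le_iff₀' (by positivity), ← div_pow]
    have ha : 0 ≤ d / B := by positivity
    rcases le_total (d / B) 1 with h | h
    · have := pow_le_one₀ ha h (n := 2 * p)
      have := pow_nonneg ha (2 * k + 2)
      linarith
    · have := pow_le_pow_right₀ h (show 2 * p ≤ 2 * k + 2 by omega)
      linarith
  calc _ ≤ ∑ r ∈ range (h + 1), B ^ (2 * p) * (levelWeight k n r +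
        levelWeight k n r * ((2 * r + 1 : ℕ) : ℝ) ^ (2 * k + 2) / B ^ (2 * k + 2)) := by
        refine sum_le_sum fun r _ => ?_
        calc _ ≤ levelWeight k n r * (B ^ (2 * p) *
              (1 + ((2 * r + 1 : ℕ) : ℝ) ^ (2 * k + 2) / B ^ (2 * k + 2))) :=
              mul_le_mul_of_nonneg_left (hpt _ (by positivity)) (levelWeight_nonneg _ _ _)
          _ = _ := by ring
    _ = B ^ (2 * p) * (∑ r ∈ range (h + 1), levelWeight k n r +
        (∑ r ∈ range (h + 1), levelWeight k n r * ((2 * r + 1 : ℕ) : ℝ) ^ (2 * k + 2)) /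
          B ^ (2 * k + 2)) := by
        rw [← mul_sum, sum_add_distrib, sum_div]
    _ ≤ B ^ (2 * p) * (N ^ 2 + N ^ 2) := by
        gcongr
        rw [div_le_iff₀ (by positivity), mul_comm (N ^ 2)]
        exact h2.trans (mul_le_mul_of_nonneg_left (h3.trans h1) (by positivity))
    _ = _ := by ring

/-- The bound on `e_d` is summed against the level weights, and the factor `N²` cancels the
normalization. Since `p ≥ 1`, the two factors `2` are absorbed by `4 ≤ 4^p`, which turns `12 ·
12000²` into `48 · 12000²`. -/
lemma pairCorr_le {n h k : ℕ} (hn : n = 2 * h + 1) (hk : 1 ≤ k) (hkh : k ≤ h) {δ : ℝ}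
    (hδ : 0 ≤ δ) (hδ1 : δ ≤ 1) {u v : Cube n} (huv : |dot u v| ≤ δ * n) :
    pairCorr (refDist n) (plantedDist k n u) (plantedDist k n v) ≤
      δ ^ (2 * k + 1) + ∑ p ∈ Icc 1 (k + 1),
        (48 * 12000 ^ 2) ^ p * ((k : ℝ) ^ (2 * p) / (n : ℝ) ^ p) * δ ^ (2 * k + 1 - 2 * p) := by
  rw [pairCorr_eq hn]
  have hN := iSup_abs_avgWitness_pos hn hkh
  have hW := sum_levelWeight_le hn k
  have hM := fun p => sum_levelWeight_mul_pow_two_mul_le (p := p) hn hk hkh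
  set N := ⨆ z : Cube n, |avgWitness k n z|
  have hn0 : (0 : ℝ) < n := by rw [hn]; positivity
  rw [dot_eq_coordSum] at huv
  rw [div_le_iff₀ (by positivity)]
  calc _ ≤ ∑ r ∈ range (h + 1), levelWeight k n r * (δ ^ (2 * k + 1) +
        ∑ p ∈ Icc 1 (k + 1), 2 * (12 * ((2 * r + 1 : ℕ) : ℝ) ^ 2 / n) ^ p *
          δ ^ (2 * k + 1 - 2 * p)) := by
        refine (abs_sum_le_sum_abs _ _).trans (sum_le_sum fun r hr => ?_)
        rw [mem_range] at hr
        rw [abs_mul, abs_of_nonneg (sq_nonneg _)]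
        -- Below level `k` the coefficient itself is zero, because the binomial factor of the level
        -- weight is positive; only degrees at least `2k + 1` need the estimate.
        rcases lt_or_ge r k with hrk | hrk
        · have h0 := levelWeight_of_lt (n := n) hrk
          rw [h0, zero_mul]
          rw [levelWeight, mul_eq_zero] at h0
          rcases h0 with h0 | h0
          · rw [h0, zero_mul]
          · have := Nat.choose_pos (show 2 * r + 1 ≤ n by omega)
            simp only [Nat.cast_eq_zero] at h0
            omega
        · have := abs_esum_le_sum (u * v) hδ hδ1 huv (k := k) (d := 2 * r + 1) (by omega) (by omega)
          rw [levelWeight, mul_assoc]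
          gcongr
    _ = δ ^ (2 * k + 1) * ∑ r ∈ range (h + 1), levelWeight k n r +
        ∑ p ∈ Icc 1 (k + 1), 2 * (12 / n) ^ p * δ ^ (2 * k + 1 - 2 * p) *
          ∑ r ∈ range (h + 1), levelWeight k n r * ((2 * r + 1 : ℕ) : ℝ) ^ (2 * p) := by
        simp only [mul_add, sum_add_distrib, mul_sum]
        congr 1
        · exact sum_congr rfl fun r _ => mul_comm _ _
        · rw [sum_comm]
          refine sum_congr rfl fun p _ => sum_congr rfl fun r _ => ?_
          rw [div_pow, div_pow, mul_pow, pow_mul]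
          ring
    _ ≤ δ ^ (2 * k + 1) * N ^ 2 + ∑ p ∈ Icc 1 (k + 1), 2 * (12 / n) ^ p *
          δ ^ (2 * k + 1 - 2 * p) * (2 * (12000 * (k : ℝ)) ^ (2 * p) * N ^ 2) := by
        gcongr with p hp
        exact hM p (mem_Icc.1 hp).2
    _ ≤ _ := by
        rw [add_mul, sum_mul]
        refine add_le_add le_rfl (sum_le_sum fun p hp => ?_)
        have hp1 : (4 : ℝ) ≤ 4 ^ p := le_self_pow₀ (by norm_num) (by have := (mem_Icc.1 hp).1; omega)
        calc _ = 4 * (12 ^ p * (12000 ^ 2) ^ p * ((k : ℝ) ^ (2 * p) / (n : ℝ) ^ p) *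
              δ ^ (2 * k + 1 - 2 * p) * N ^ 2) := by
              rw [div_pow, mul_pow, pow_mul 12000]; ring
          _ ≤ 4 ^ p * (12 ^ p * (12000 ^ 2) ^ p * ((k : ℝ) ^ (2 * p) / (n : ℝ) ^ p) *
              δ ^ (2 * k + 1 - 2 * p) * N ^ 2) := by gcongr
          _ = _ := by
              rw [show (48 : ℝ) * 12000 ^ 2 = 4 * (12 * 12000 ^ 2) by norm_num, mul_pow 4, mul_pow 12]
              ring

end

end HiddenDirection

namespace HiddenDirection

noncomputable section

open Finset

/-! ### Large families of nearly orthogonal sign vectors -/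

lemma sum_exp_mul_coordSum_le (n : ℕ) (t : ℝ) :
    ∑ x : Cube n, Real.exp (t * coordSum x) ≤ 2 ^ n * Real.exp (n * (t ^ 2 / 2)) := by
  have h1 : ∀ x : Cube n, Real.exp (t * coordSum x) = ∏ i, Real.exp (t * sgn (x i)) := by
    intro x
    rw [coordSum, mul_sum, Real.exp_sum]
  simp_rw [h1]
  rw [sum_cube_prod fun _ y => Real.exp (t * sgn y), Real.exp_nat_mul, ← mul_pow, prod_const,
    card_univ, Fintype.card_fin]
  refine pow_le_pow_left₀ (by positivity) ?_ n
  have := Real.cosh_le_exp_half_sq t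
  rw [Real.cosh_eq] at this
  rw [sgn_one, sgn_neg_one, mul_one, mul_neg_one]
  linarith

/-- Chernoff's bound at the optimal parameters `t = ±δ`, one for each tail. -/
lemma card_lt_abs_coordSum_le (n : ℕ) {δ : ℝ} (hδ : 0 ≤ δ) :
    (#{x : Cube n | δ * n < |coordSum x|} : ℝ) ≤ 2 * 2 ^ n * Real.exp (-(δ ^ 2 * n / 2)) := by
  have h1 := sum_exp_mul_coordSum_le n δ
  have h2 := sum_exp_mul_coordSum_le n (-δ)
  have h3 : (#{x : Cube n | δ * n < |coordSum x|} : ℝ) ≤ ∑ x : Cube n,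
      (Real.exp (δ * coordSum x) + Real.exp (-δ * coordSum x)) * Real.exp (-(δ ^ 2 * n)) := by
    rw [card_eq_sum_ones, sum_filter]
    push_cast
    refine sum_le_sum fun x _ => ?_
    split_ifs with h
    · rw [add_mul, ← Real.exp_add, ← Real.exp_add]
      rcases le_total 0 (coordSum x) with h0 | h0
      · rw [abs_of_nonneg h0] at h
        have : 1 ≤ Real.exp (δ * coordSum x + -(δ ^ 2 * n)) := Real.one_le_exp (by nlinarith)
        linarith [Real.exp_nonneg (-δ * coordSum x + -(δ ^ 2 * n))]
      · rw [abs_of_nonpos h0] at h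
        have : 1 ≤ Real.exp (-δ * coordSum x + -(δ ^ 2 * n)) := Real.one_le_exp (by nlinarith)
        linarith [Real.exp_nonneg (δ * coordSum x + -(δ ^ 2 * n))]
    · positivity
  rw [← sum_mul, sum_add_distrib] at h3
  refine h3.trans ?_
  rw [neg_sq] at h2
  calc _ ≤ (2 ^ n * Real.exp (n * (δ ^ 2 / 2)) + 2 ^ n * Real.exp (n * (δ ^ 2 / 2))) *
        Real.exp (-(δ ^ 2 * n)) := by gcongr
    _ = 2 * 2 ^ n * (Real.exp (n * (δ ^ 2 / 2)) * Real.exp (-(δ ^ 2 * n))) := by ring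
    _ = _ := by
      rw [← Real.exp_add]
      congr 2
      ring

lemma dot_comm {n : ℕ} (u v : Cube n) : dot u v = dot v u := by
  simp only [dot, mul_comm]

lemma dot_self {n : ℕ} (u : Cube n) : dot u u = n := by
  simp [dot, sgn_mul_self]

/-- A family of maximal size cannot be enlarged, so every vector has inner product above `δn` with
some member. Since `δ < 1`, this also holds trivially for members. The cube is thus covered by `#U`
translates of the two tails, whence `exp(δ²n/2) ≤ 2 #U`. -/
lemma exists_nearly_orthogonal {n : ℕ} (hn : 0 < n) {δ : ℝ} (hδ : 0 < δ) (hδ1 : δ < 1) :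
    ∃ U : Finset (Cube n), ⌊Real.exp (1 / 4 * δ ^ 2 * n)⌋₊ ≤ U.card ∧
      ∀ u ∈ U, ∀ v ∈ U, u ≠ v → |dot u v| ≤ δ * n := by
  classical
  have hn0 : (0 : ℝ) < n := by exact_mod_cast hn
  let P : Finset (Cube n) → Prop := fun U => ∀ u ∈ U, ∀ v ∈ U, u ≠ v → |dot u v| ≤ δ * n
  obtain ⟨U, hU, hmax⟩ := exists_max_image ({U : Finset (Cube n) | P U}) card
    ⟨∅, by simp [P]⟩
  rw [mem_filter] at hU
  have hP : P U := hU.2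
  refine ⟨U, ?_, hP⟩
  have hcover : ∀ w : Cube n, ∃ u ∈ U, δ * n < |dot u w| := by
    intro w
    by_contra hc
    push Not at hc
    have hw : w ∉ U := fun hw => by
      have := hc w hw
      rw [dot_self, abs_of_pos hn0] at this
      nlinarith
    have hPi : P (insert w U) := by
      intro u hu v hv huv
      rw [mem_insert] at hu hv
      rcases hu with rfl | hu <;> rcases hv with rfl | hv
      · exact absurd rfl huv
      · rw [dot_comm]; exact hc v hv
      · exact hc u hu
      · exact hP u hu v hv huv
    have := hmax (insert w U) (by simpa using hPi)
    rw [card_insert_of_notMem hw] at this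
    omega
  have hcard : (2 : ℝ) ^ n ≤ #U * (2 * 2 ^ n * Real.exp (-(δ ^ 2 * n / 2))) := by
    have h1 : (univ : Finset (Cube n)) ⊆ U.biUnion fun u => {w | δ * n < |dot u w|} := by
      intro w _
      obtain ⟨u, hu, huw⟩ := hcover w
      exact mem_biUnion.2 ⟨u, hu, by simpa using huw⟩
    have h2 := (card_le_card h1).trans card_biUnion_le
    have h3 : ∀ u ∈ U, #{w | δ * n < |dot u w|} = #{x : Cube n | δ * n < |coordSum x|} := by
      intro u _
      refine card_bij' (fun w _ => u * w) (fun w _ => u⁻¹ * w) ?_ ?_ (by simp) (by simp)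
      · intro w hw; simpa [dot_eq_coordSum] using hw
      · intro w hw; simpa [dot_eq_coordSum] using hw
    rw [sum_congr rfl h3, sum_const, smul_eq_mul] at h2
    have h4 : (Fintype.card (Cube n) : ℝ) ≤ #U * #{x : Cube n | δ * n < |coordSum x|} := by
      exact_mod_cast h2
    rw [card_cube] at h4
    exact h4.trans (by gcongr; exact card_lt_abs_coordSum_le n hδ.le)
  set E := Real.exp (1 / 4 * δ ^ 2 * n)
  have hE : 0 < E := Real.exp_pos _
  have hE2 : E ^ 2 ≤ 2 * #U := by
    have e1 : Real.exp (-(δ ^ 2 * n / 2)) = (E ^ 2)⁻¹ := by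
      rw [← Real.exp_nat_mul, ← Real.exp_neg]
      congr 1
      push_cast
      ring
    rw [e1] at hcard
    have h2 : (0 : ℝ) < 2 ^ n := by positivity
    have : 2 ^ n * E ^ 2 ≤ 2 ^ n * (2 * #U) := by
      calc 2 ^ n * E ^ 2 ≤ (#U * (2 * 2 ^ n * (E ^ 2)⁻¹)) * E ^ 2 := by gcongr
        _ = _ := by field_simp
    exact le_of_mul_le_mul_left this h2
  -- The factor `2` is lost only when `E < 2`, where the floor is at most `1` and `U` is nonempty;
  -- otherwise `E ≤ E²/2 ≤ #U`.
  rcases lt_or_ge E 2 with h | h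
  · have hf : ⌊E⌋₊ < 2 := (Nat.floor_lt hE.le).2 (by exact_mod_cast h)
    obtain ⟨u, hu, -⟩ := hcover 1
    have := card_pos.2 ⟨u, hu⟩
    omega
  · refine Nat.floor_le_of_le ?_
    nlinarith

/-! ### The correlation with the smoothed halfspace -/

lemma Gamma_nat_add_half_eq (r : ℕ) :
    Real.Gamma (r + 1 / 2) = √Real.pi * r.factorial * (r.centralBinom / 4 ^ r) := by
  induction r with
  | zero => simp [-one_div, Real.Gamma_one_half_eq]
  | succ r ih =>
    rw [show ((r + 1 : ℕ) : ℝ) + 1 / 2 = (r + 1 / 2) + 1 by push_cast; ring,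
      Real.Gamma_add_one (by positivity), ih, Nat.factorial_succ]
    have h : ((r : ℝ) + 1) * (r + 1).centralBinom = 2 * (2 * r + 1) * r.centralBinom := by
      exact_mod_cast Nat.succ_mul_centralBinom_succ r
    push_cast
    rw [pow_succ]
    field_simp
    linear_combination (-2 : ℝ) * h

/-- The right side is `1` at `r = 0` and increases, since `(2r+1)²(4r+5) ≥ (2r+2)²(4r+1)`. The
companion upper bound is the analogous monotonicity with `2r + 1`. -/
lemma one_le_centralBinom_sq_mul (r : ℕ) : 1 ≤ ((r.centralBinom : ℝ) / 4 ^ r) ^ 2 * (4 * r + 1) := by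
  induction r with
  | zero => simp
  | succ r ih =>
    refine ih.trans ?_
    have h : ((r + 1).centralBinom : ℝ) = 2 * (2 * r + 1) * r.centralBinom / (r + 1) := by
      rw [eq_div_iff (by positivity), mul_comm]
      exact_mod_cast Nat.succ_mul_centralBinom_succ r
    rw [h, show 2 * (2 * (r : ℝ) + 1) * r.centralBinom / (r + 1) / 4 ^ (r + 1) =
      (r.centralBinom / 4 ^ r) * ((2 * r + 1) / (2 * r + 2)) by rw [pow_succ]; field_simp; ring,
      mul_pow, mul_assoc]
    gcongr
    rw [div_pow, div_mul_eq_mul_div, le_div_iff₀ (by positivity)]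
    push_cast
    nlinarith

lemma centralBinom_sq_mul_le_one (r : ℕ) : ((r.centralBinom : ℝ) / 4 ^ r) ^ 2 * (2 * r + 1) ≤ 1 := by
  induction r with
  | zero => simp
  | succ r ih =>
    refine le_trans ?_ ih
    have h : ((r + 1).centralBinom : ℝ) = 2 * (2 * r + 1) * r.centralBinom / (r + 1) := by
      rw [eq_div_iff (by positivity), mul_comm]
      exact_mod_cast Nat.succ_mul_centralBinom_succ r
    rw [h, show 2 * (2 * (r : ℝ) + 1) * r.centralBinom / (r + 1) / 4 ^ (r + 1) =
      (r.centralBinom / 4 ^ r) * ((2 * r + 1) / (2 * r + 2)) by rw [pow_succ]; field_simp; ring,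
      mul_pow, mul_assoc]
    gcongr
    rw [div_pow, div_mul_eq_mul_div, div_le_iff₀ (by positivity)]
    push_cast
    nlinarith

/-- In fair coin tossing, each side is the first to reach `a + 1` successes with probability `1/2`,
split according to the opponent's score `i`. The proof uses Pascal's rule, which expresses the next
sum as the present one plus half of itself. -/
lemma sum_choose_div_two_pow (a : ℕ) :
    ∑ i ∈ range (a + 1), ((a + i).choose a : ℝ) / 2 ^ i = 2 ^ a := by
  induction a with
  | zero => simp
  | succ a ih =>
    set f := ∑ i ∈ range (a + 1 + 1), ((a + 1 + i).choose (a + 1) : ℝ) / 2 ^ i with hf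
    have h1 : f = ∑ i ∈ range (a + 1 + 1), ((a + i).choose a : ℝ) / 2 ^ i +
        ∑ i ∈ range (a + 1 + 1), ((a + i).choose (a + 1) : ℝ) / 2 ^ i := by
      rw [hf, ← sum_add_distrib]
      refine sum_congr rfl fun i _ => ?_
      rw [show a + 1 + i = (a + i) + 1 by ring, Nat.choose_succ_succ]
      push_cast
      ring
    have h2 : ∑ i ∈ range (a + 1 + 1), ((a + i).choose (a + 1) : ℝ) / 2 ^ i =
        1 / 2 * ∑ i ∈ range (a + 1), ((a + 1 + i).choose (a + 1) : ℝ) / 2 ^ i := by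
      rw [sum_range_succ', mul_sum]
      simp only [add_zero, Nat.choose_succ_self, Nat.cast_zero, zero_div]
      refine sum_congr rfl fun i _ => ?_
      rw [show a + (i + 1) = a + 1 + i by ring, pow_succ]
      ring
    have h3 := hf
    rw [sum_range_succ] at h1 h3
    rw [ih, h2] at h1
    have h4 : ((a + 1 + (a + 1)).choose (a + 1) : ℝ) = 2 * (a + (a + 1)).choose a := by
      have e1 : (a + 1 + (a + 1)).choose (a + 1) =
          (a + (a + 1)).choose a + (a + (a + 1)).choose (a + 1) := by
        rw [show a + 1 + (a + 1) = (a + (a + 1)) + 1 by ring, Nat.choose_succ_succ]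
      have e2 : (a + (a + 1)).choose (a + 1) = (a + (a + 1)).choose a :=
        (Nat.choose_symm_add (a := a) (b := a + 1)).symm
      rw [e1, e2]; push_cast; ring
    rw [h4] at h3
    rw [pow_succ]
    linarith [show 2 * ((a + (a + 1)).choose a : ℝ) / 2 ^ (a + 1) =
      2 * (((a + (a + 1)).choose a : ℝ) / 2 ^ (a + 1)) by ring]

lemma centralBinom_div_le {a : ℕ} (ha : 2 ≤ a) : (a.centralBinom : ℝ) / 4 ^ a ≤ 3 / 8 := by
  induction a, ha using Nat.le_induction with
  | base => norm_num [Nat.centralBinom, Nat.choose]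
  | succ r _ ih =>
    refine le_trans ?_ ih
    have h : ((r : ℝ) + 1) * (r + 1).centralBinom = 2 * (2 * r + 1) * r.centralBinom := by
      exact_mod_cast Nat.succ_mul_centralBinom_succ r
    have h0 : (0 : ℝ) ≤ r.centralBinom := by positivity
    have h1 : (((r + 1).centralBinom : ℕ) : ℝ) ≤ 4 * r.centralBinom := by
      have : (0 : ℝ) < r + 1 := by positivity
      refine le_of_mul_le_mul_left ?_ this
      rw [h]; nlinarith
    rw [pow_succ, div_le_div_iff₀ (by positivity) (by positivity)]
    have : (0 : ℝ) ≤ 4 ^ r := by positivity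
    nlinarith

/-- Extended by its next two terms the sum equals `1`; each of these is `C(2k+2,k+1)/4^{k+1} ≤ 3/8`.
-/
lemma quarter_le_sum_choose {k : ℕ} (hk : 1 ≤ k) :
    1 / 4 ≤ ∑ i ∈ range k, ((k + i + 1).choose (k + 1) : ℝ) / 2 ^ (k + i + 1) := by
  have h1 := sum_choose_div_two_pow (k + 1)
  rw [sum_range_succ, sum_range_succ] at h1
  have h2 : ∑ i ∈ range k, ((k + i + 1).choose (k + 1) : ℝ) / 2 ^ (k + i + 1) =
      (∑ i ∈ range k, ((k + 1 + i).choose (k + 1) : ℝ) / 2 ^ i) / 2 ^ (k + 1) := by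
    rw [sum_div]
    refine sum_congr rfl fun i _ => ?_
    rw [show k + i + 1 = k + 1 + i by ring, add_comm (k + 1) i, pow_add, div_div]
  have h3 := centralBinom_div_le (show 2 ≤ k + 1 by omega)
  have e1 : ((k + 1 + (k + 1)).choose (k + 1) : ℝ) = (k + 1).centralBinom := by
    rw [Nat.centralBinom, two_mul]
  have e2 : ((k + 1 + k).choose (k + 1) : ℝ) = (k + 1).centralBinom / 2 := by
    have : (k + 1).centralBinom = (k + 1 + k).choose (k + 1) + (k + 1 + k).choose (k + 1) := by
      rw [Nat.centralBinom, show 2 * (k + 1) = (k + 1 + k) + 1 by ring, Nat.choose_succ_succ,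
        Nat.choose_symm_add]
    rw [this]; push_cast; ring
  rw [e1, e2] at h1
  have h4 : (0 : ℝ) < 2 ^ (k + 1) := by positivity
  rw [h2, le_div_iff₀ h4]
  have e3 : ((k + 1).centralBinom : ℝ) / 2 / 2 ^ k = (k + 1).centralBinom / 4 ^ (k + 1) * 2 ^ (k + 1) := by
    rw [show (4 : ℝ) ^ (k + 1) = 2 ^ (k + 1) * 2 ^ (k + 1) by rw [← mul_pow]; norm_num]
    rw [pow_succ]
    field_simp
  have e4 : ((k + 1).centralBinom : ℝ) / 2 ^ (k + 1) =
      (k + 1).centralBinom / 4 ^ (k + 1) * 2 ^ (k + 1) := by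
    rw [show (4 : ℝ) ^ (k + 1) = 2 ^ (k + 1) * 2 ^ (k + 1) by rw [← mul_pow]; norm_num]
    field_simp
  rw [e3, e4] at h1
  nlinarith

end

end HiddenDirection

/-! ### The correlation with the smoothed halfspace, level by level -/

namespace HiddenDirection

noncomputable section

open Finset

/-- Translation by `u` removes the direction. The noise operator is self-adjoint and acts on degree
`d` as `ρ^d`, so it can be moved to the witness. -/
lemma expect_plantedDist {n h : ℕ} (hn : n = 2 * h + 1) (k : ℕ) (ρ : ℝ) (u : Cube n) :
    expect (plantedDist k n u) (fun z => sgn z.2 * smoothedHalfspace ρ u z.1) =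
      (∑ r ∈ range (h + 1), witnessCoeff k n r * ρ ^ (2 * r + 1) *
        ((∑ x : Cube n, Real.sign (coordSum x) * esum (2 * r + 1) x) / 2 ^ n)) /
        ⨆ z : Cube n, |avgWitness k n z| := by
  set N := ⨆ z : Cube n, |avgWitness k n z|
  set f : Cube n → ℝ := fun x => Real.sign (coordSum x)
  have hf : ∀ x, smoothedHalfspace ρ u x = noise ρ f (u * x) := by
    intro x
    rw [smoothedHalfspace, ← noise_comp_mul]
    simp only [dot_eq_coordSum, f]
  have h1 : expect (plantedDist k n u) (fun z => sgn z.2 * smoothedHalfspace ρ u z.1) =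
      ((2 : ℝ) ^ n)⁻¹ / N * ∑ x : Cube n, avgWitness k n x * noise ρ f x := by
    rw [← sum_mul_left_cube u fun x => avgWitness k n x * noise ρ f x, expect]
    simp only [plantedDist, hf]
    rw [sum_prod_units (fun x y => ((2 : ℝ) ^ (n + 1))⁻¹ * (1 + sgn y * witness k n (u * x)) *
      (sgn y * noise ρ f (u * x))), mul_sum]
    refine sum_congr rfl fun x _ => ?_
    rw [sgn_one, sgn_neg_one, witness, pow_succ, mul_inv]
    ring
  have h2 : ∑ x : Cube n, avgWitness k n x * noise ρ f x = ∑ r ∈ range (h + 1),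
      witnessCoeff k n r * ρ ^ (2 * r + 1) * ∑ x : Cube n, f x * esum (2 * r + 1) x := by
    simp_rw [avgWitness_eq hn, sum_mul]
    rw [sum_comm]
    refine sum_congr rfl fun r _ => ?_
    simp_rw [mul_assoc]
    rw [← mul_sum, noise_symm]
    simp_rw [noise_esum]
    congr 1
    rw [mul_sum]
    exact sum_congr rfl fun x _ => by ring
  rw [h1, h2, mul_sum, sum_div]
  refine sum_congr rfl fun r _ => ?_
  ring

lemma Gamma_add_three_half_div (r : ℕ) :
    Real.Gamma (r + 3 / 2) / (2 * r + 1) =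
      1 / 2 * (√Real.pi * r.factorial * (r.centralBinom / 4 ^ r)) := by
  rw [show (r : ℝ) + 3 / 2 = (r + 1 / 2) + 1 by ring, Real.Gamma_add_one (by positivity),
    ← Gamma_nat_add_half_eq]
  field_simp

/-- The signs `(-1)^r` of the witness and of majority multiply to `1`, leaving a product of
nonnegative factors. -/
lemma correlation_term_eq {n h : ℕ} (hn : n = 2 * h + 1) (k r : ℕ) (ρ : ℝ) :
    witnessCoeff k n r * ρ ^ (2 * r + 1) *
      ((∑ x : Cube n, Real.sign (coordSum x) * esum (2 * r + 1) x) / 2 ^ n) =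
    ρ ^ (2 * r + 1) * ((r + 1).choose (k + 1)) * (1 / 4 * √Real.pi * (r.centralBinom / 4 ^ r)) *
      (√n * (h.centralBinom / 4 ^ h)) * (h.descFactorial r / (n : ℝ) ^ r) := by
  subst hn
  set n := 2 * h + 1 with hn
  have hn0 : (0 : ℝ) < n := by positivity
  have h1 : (∑ x : Cube n, Real.sign (coordSum x) * esum (2 * r + 1) x) =
      2 * n * h.centralBinom * ((-1) ^ r * h.choose r) / (2 * r + 1) := by
    rw [eq_div_iff (by positivity), sum_sign_mul_esum]
    rw [hn]; push_cast; ring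
  have h2 := Gamma_add_three_half_div r
  have h3 : ((-1 : ℝ) ^ r) * (-1) ^ r = 1 := by rw [← mul_pow]; simp
  have h4 : √(n : ℝ) ^ (2 * r + 1) = n ^ r * √n := by
    rw [pow_succ, pow_mul, Real.sq_sqrt hn0.le]
  have h5 : (2 : ℝ) ^ n = 2 * 4 ^ h := by
    rw [hn, pow_succ, pow_mul]; norm_num; ring
  have hs : 0 < √(n : ℝ) := Real.sqrt_pos.2 hn0
  have h6 : (n : ℝ) = √n * √n := (Real.mul_self_sqrt hn0.le).symm
  rw [h1, witnessCoeff, h4, h5, Nat.descFactorial_eq_factorial_mul_choose]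
  push_cast
  calc _ = 1 / 2 * (((-1 : ℝ) ^ r) * (-1) ^ r) * ρ ^ (2 * r + 1) * ((r + 1).choose (k + 1)) *
        (Real.Gamma (r + 3 / 2) / (2 * r + 1)) * (n / √n) * (h.centralBinom / 4 ^ h) *
          (h.choose r / (n : ℝ) ^ r) := by
        field_simp
    _ = _ := by
        rw [h3, h2, show (n : ℝ) / √n = √n from Real.div_sqrt]
        ring

/-- Each factor of the falling factorial is at least `(n - 2r)/2`, and Bernoulli's inequality gives
`(1 - 2r/n)^r ≥ 1/2` when `4r² ≤ n`. -/
lemma half_le_descFactorial_div {n h r : ℕ} (hn : n = 2 * h + 1) (hr : 4 * r ^ 2 ≤ n) :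
    1 / 2 / 2 ^ r ≤ (h.descFactorial r : ℝ) / (n : ℝ) ^ r := by
  have hn0 : (0 : ℝ) < n := by rw [hn]; positivity
  have hrh : r ≤ h := by
    rcases Nat.eq_zero_or_pos r with h0 | h0
    · omega
    · nlinarith
  have h1 : ((h + 1 - r : ℕ) : ℝ) ^ r ≤ h.descFactorial r := by
    exact_mod_cast Nat.pow_sub_le_descFactorial h r
  rw [Nat.cast_sub (by omega)] at h1
  have hrn : 2 * r ≤ n := by omega
  have h2 : (1 / 2 : ℝ) ≤ (1 - 2 * r / n) ^ r := by
    have hb := one_add_mul_le_pow (a := -(2 * (r : ℝ) / n)) (by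
      rw [neg_le_neg_iff, div_le_iff₀ hn0]
      have : (2 : ℝ) * r ≤ n := by exact_mod_cast hrn
      linarith) r
    have h3 : (r : ℝ) * (2 * r / n) ≤ 1 / 2 := by
      rw [← mul_div_assoc, div_le_iff₀ hn0]
      have : (4 : ℝ) * r ^ 2 ≤ n := by exact_mod_cast hr
      nlinarith
    rw [sub_eq_add_neg]
    linarith
  calc (1 / 2 : ℝ) / 2 ^ r ≤ (1 - 2 * r / n) ^ r / 2 ^ r := by gcongr
    _ = ((1 - 2 * r / n) / 2) ^ r := by rw [div_pow]
    _ ≤ (((h + 1 : ℕ) - r : ℝ) / n) ^ r := by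
        have h3 : (2 : ℝ) * r ≤ n := by exact_mod_cast hrn
        refine pow_le_pow_left₀ ?_ ?_ r
        · have : 2 * (r : ℝ) / n ≤ 1 := by rw [div_le_one hn0]; exact h3
          linarith
        · rw [le_div_iff₀ hn0, div_mul_eq_mul_div, sub_mul, div_mul_cancel₀ _ hn0.ne', one_mul, hn]
          push_cast
          linarith
    _ ≤ _ := by rw [div_pow]; gcongr

/-- Only the levels `k ≤ r < 2k` are kept: there `2r + 1 ≤ 4k - 1 ≤ 2m + 1`, and
`C(r+1,k+1)/2^{r+1}` sums to at least `1/4`. -/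
lemma le_expect_plantedDist {n h k m : ℕ} (hn : n = 2 * h + 1) (hk : 1 ≤ k) (hkm : k ≤ m)
    (hm : 2 * k ≤ m + 1) (hkn : 16 * k ^ 2 ≤ n) {ρ : ℝ} (hρ : 0 < ρ) (hρ1 : ρ < 1) (u : Cube n) :
    1 / 128 / (⨆ z : Cube n, |avgWitness k n z|) * ρ ^ (2 * m + 1) / √m ≤
      expect (plantedDist k n u) (fun z => sgn z.2 * smoothedHalfspace ρ u z.1) := by
  have hkh : 2 * k ≤ h + 1 := by nlinarith
  have hN := iSup_abs_avgWitness_pos (k := k) hn (by omega)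
  rw [expect_plantedDist hn]
  set N := ⨆ z : Cube n, |avgWitness k n z|
  have hk0 : (0 : ℝ) < k := by exact_mod_cast hk
  have hn0 : (0 : ℝ) < n := by rw [hn]; positivity
  have hsk : 0 < √(k : ℝ) := Real.sqrt_pos.2 hk0
  have hterm0 : ∀ r, 0 ≤ witnessCoeff k n r * ρ ^ (2 * r + 1) *
      ((∑ x : Cube n, Real.sign (coordSum x) * esum (2 * r + 1) x) / 2 ^ n) := by
    intro r
    rw [correlation_term_eq hn]
    positivity
  have hc : (1 / 2 : ℝ) ≤ √n * (h.centralBinom / 4 ^ h) := by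
    have h1 := one_le_centralBinom_sq_mul h
    have h2 : (1 : ℝ) / 2 ≤ (√n * (h.centralBinom / 4 ^ h)) ^ 2 := by
      rw [mul_pow, Real.sq_sqrt hn0.le, hn]
      push_cast
      nlinarith [sq_nonneg ((h.centralBinom : ℝ) / 4 ^ h)]
    refine le_of_sq_le_sq ?_ (by positivity)
    norm_num at h2 ⊢
    linarith
  -- The `32` collects `1/4` from the term, `1/(4√k)` from the central binomial at `r`, `1/2` from
  -- `d1` and `1/2` from `hc`, with one factor `1/2` moved into `2^{-(r+1)}`.
  have hterm : ∀ i ∈ range k, ρ ^ (2 * m + 1) / (32 * √k) *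
      (((k + i + 1).choose (k + 1) : ℝ) / 2 ^ (k + i + 1)) ≤
      witnessCoeff k n (k + i) * ρ ^ (2 * (k + i) + 1) *
      ((∑ x : Cube n, Real.sign (coordSum x) * esum (2 * (k + i) + 1) x) / 2 ^ n) := by
    intro i hi
    rw [mem_range] at hi
    set r := k + i with hr
    rw [correlation_term_eq hn]
    have d1 : 1 / 2 / 2 ^ r ≤ (h.descFactorial r : ℝ) / (n : ℝ) ^ r := by
      refine half_le_descFactorial_div hn (le_trans ?_ hkn)
      have : r ≤ 2 * k := by omega
      nlinarith
    have d2 : ρ ^ (2 * m + 1) ≤ ρ ^ (2 * r + 1) :=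
      pow_le_pow_of_le_one hρ.le hρ1.le (by omega)
    have d3 : 1 / (4 * √k) ≤ (r.centralBinom : ℝ) / 4 ^ r := by
      refine le_of_sq_le_sq ?_ (by positivity)
      have h1 := one_le_centralBinom_sq_mul r
      have hr8 : (4 * (r : ℝ) + 1) ≤ 16 * k := by
        have : 4 * r + 1 ≤ 16 * k := by omega
        exact_mod_cast this
      rw [div_pow, mul_pow, Real.sq_sqrt hk0.le, div_le_iff₀ (by positivity)]
      nlinarith [sq_nonneg ((r.centralBinom : ℝ) / 4 ^ r)]
    have d4 : 1 ≤ √Real.pi := Real.one_le_sqrt.2 (by linarith [Real.pi_gt_three])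
    calc ρ ^ (2 * m + 1) / (32 * √k) * (((r + 1).choose (k + 1) : ℝ) / 2 ^ (r + 1))
        = ρ ^ (2 * m + 1) * ((r + 1).choose (k + 1)) * (1 / 4 * 1 * (1 / (4 * √k))) *
            (1 / 2) * (1 / 2 / 2 ^ r) := by
          rw [pow_succ 2]; field_simp; ring
      _ ≤ _ := by gcongr
  have hsum := sum_le_sum hterm
  rw [← mul_sum] at hsum
  have hq := quarter_le_sum_choose hk
  have hsub : ∑ i ∈ range k, witnessCoeff k n (k + i) * ρ ^ (2 * (k + i) + 1) *
      ((∑ x : Cube n, Real.sign (coordSum x) * esum (2 * (k + i) + 1) x) / 2 ^ n) ≤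
      ∑ r ∈ range (h + 1), witnessCoeff k n r * ρ ^ (2 * r + 1) *
      ((∑ x : Cube n, Real.sign (coordSum x) * esum (2 * r + 1) x) / 2 ^ n) := by
    rw [← sum_image (s := range k) (g := fun i => k + i) (f := fun r => witnessCoeff k n r *
      ρ ^ (2 * r + 1) * ((∑ x : Cube n, Real.sign (coordSum x) * esum (2 * r + 1) x) / 2 ^ n))
      (by intro a _ b _ hab; simpa using hab)]
    refine sum_le_sum_of_subset_of_nonneg ?_ fun r _ _ => hterm0 r
    intro r hr
    obtain ⟨i, hi, rfl⟩ := mem_image.1 hr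
    rw [mem_range] at hi ⊢
    omega
  have hkm' : √(k : ℝ) ≤ √m := Real.sqrt_le_sqrt (by exact_mod_cast hkm)
  calc 1 / 128 / N * ρ ^ (2 * m + 1) / √m ≤ 1 / 128 / N * ρ ^ (2 * m + 1) / √k := by gcongr
    _ = ρ ^ (2 * m + 1) / (32 * √k) * (1 / 4) / N := by field_simp; norm_num
    _ ≤ _ := by
        gcongr
        refine le_trans ?_ (hsum.trans hsub)
        gcongr

end

end HiddenDirection

namespace HiddenDirection

noncomputable section

open Finset Polynomial MeasureTheory

/-! ### Integrals of polynomials against Gaussian exponentials -/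

/-- Powers are dominated through `|t|^m ≤ m!(e^t + e^{-t})`, and the exponentials only shift `c` by
`±1`. -/
lemma integrable_eval_mul_cexp {b : ℝ} (hb : 0 < b) (c : ℂ) (p : ℂ[X]) :
    Integrable fun t : ℝ => p.eval (t : ℂ) * Complex.exp (-b * (t : ℂ) ^ 2 + c * t) := by
  have h0 : ∀ c : ℂ, Integrable fun t : ℝ => Complex.exp (-b * (t : ℂ) ^ 2 + c * t) := by
    intro c
    have := integrable_cexp_quadratic' (b := -(b : ℂ)) (by simpa using hb) c 0
    simpa using this
  induction p using Polynomial.induction_on' with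
  | add p q hp hq =>
    simp only [eval_add, add_mul]
    exact hp.add hq
  | monomial m a =>
    have hm : Integrable fun t : ℝ => (t : ℂ) ^ m * Complex.exp (-b * (t : ℂ) ^ 2 + c * t) := by
      have hg := (((h0 (c + 1)).norm.add (h0 (c - 1)).norm).const_mul (m.factorial : ℝ))
      refine hg.mono' (by fun_prop) (Filter.Eventually.of_forall fun t => ?_)
      have h1 : ∀ d : ℝ, ‖Complex.exp (-b * (t : ℂ) ^ 2 + (c + d) * t)‖ =
          ‖Complex.exp (-b * (t : ℂ) ^ 2 + c * t)‖ * Real.exp (d * t) := by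
        intro d
        rw [show -b * (t : ℂ) ^ 2 + (c + d) * t = (-b * (t : ℂ) ^ 2 + c * t) + ((d * t : ℝ) : ℂ) by
          push_cast; ring, Complex.exp_add, norm_mul, Complex.norm_exp_ofReal]
      have h2 : ‖Complex.exp (-b * (t : ℂ) ^ 2 + (c + 1) * t)‖ =
          ‖Complex.exp (-b * (t : ℂ) ^ 2 + c * t)‖ * Real.exp t := by simpa using h1 1
      have h3 : ‖Complex.exp (-b * (t : ℂ) ^ 2 + (c - 1) * t)‖ =
          ‖Complex.exp (-b * (t : ℂ) ^ 2 + c * t)‖ * Real.exp (-t) := by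
        simpa [sub_eq_add_neg] using h1 (-1)
      rw [norm_mul, norm_pow, Complex.norm_real, Real.norm_eq_abs]
      simp only [Pi.add_apply]
      rw [h2, h3, ← mul_add]
      have h4 : |t| ^ m ≤ m.factorial * (Real.exp t + Real.exp (-t)) := by
        have h5 := Real.pow_div_factorial_le_exp _ (abs_nonneg t) m
        rw [div_le_iff₀ (by positivity), mul_comm] at h5
        refine h5.trans (mul_le_mul_of_nonneg_left ?_ (by positivity))
        rcases abs_cases t with ⟨h, _⟩ | ⟨h, _⟩ <;> rw [h] <;>
          linarith [Real.exp_nonneg t, Real.exp_nonneg (-t)]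
      calc _ ≤ (m.factorial * (Real.exp t + Real.exp (-t))) *
            ‖Complex.exp (-b * (t : ℂ) ^ 2 + c * t)‖ := by gcongr
        _ = _ := by ring
    refine (hm.const_mul a).congr (Filter.Eventually.of_forall fun t => ?_)
    simp only [eval_monomial]
    ring

/-- The functional `p ↦ ∫ p(t) exp (-b t² + c t) dt` on polynomials. -/
def gaussInt {b : ℝ} (hb : 0 < b) (c : ℂ) : ℂ[X] →ₗ[ℂ] ℂ where
  toFun p := ∫ t : ℝ, p.eval (t : ℂ) * Complex.exp (-b * (t : ℂ) ^ 2 + c * t)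
  map_add' p q := by
    simp only [eval_add, add_mul]
    exact integral_add (integrable_eval_mul_cexp hb c p) (integrable_eval_mul_cexp hb c q)
  map_smul' a p := by
    simp only [eval_smul, smul_eq_mul, mul_assoc, RingHom.id_apply]
    exact integral_const_mul _ _

lemma gaussInt_apply {b : ℝ} (hb : 0 < b) (c : ℂ) (p : ℂ[X]) :
    gaussInt hb c p = ∫ t : ℝ, p.eval (t : ℂ) * Complex.exp (-b * (t : ℂ) ^ 2 + c * t) := rfl

lemma gaussInt_derivative {b : ℝ} (hb : 0 < b) (c : ℂ) (p : ℂ[X]) :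
    gaussInt hb c (derivative p) = gaussInt hb c ((C (2 * b : ℂ) * X - C c) * p) := by
  rw [← sub_eq_zero, ← map_sub, gaussInt_apply]
  refine integral_eq_zero_of_hasDerivAt_of_integrable
    (f := fun t : ℝ => p.eval (t : ℂ) * Complex.exp (-b * (t : ℂ) ^ 2 + c * t)) (fun t => ?_)
    (integrable_eval_mul_cexp hb c _) (integrable_eval_mul_cexp hb c p)
  have h1 : HasDerivAt (fun t : ℝ => p.eval (t : ℂ)) ((derivative p).eval (t : ℂ)) t :=
    (p.hasDerivAt (t : ℂ)).comp_ofReal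
  have h2 : HasDerivAt (fun z : ℂ => Complex.exp (-b * z ^ 2 + c * z))
      (Complex.exp (-b * (t : ℂ) ^ 2 + c * t) * (-b * (2 * t) + c)) (t : ℂ) := by
    have := (((hasDerivAt_pow 2 (t : ℂ)).const_mul (-b : ℂ)).add
      ((hasDerivAt_id (t : ℂ)).const_mul c)).cexp
    simpa using this
  refine (h1.mul h2.comp_ofReal).congr_deriv ?_
  simp only [eval_sub, eval_mul, eval_C, eval_X]
  ring

lemma gaussInt_one_zero_one : gaussInt one_pos 0 1 = (√Real.pi : ℝ) := by
  have h1 := integral_gaussian 1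
  rw [div_one] at h1
  rw [gaussInt_apply, ← h1, ← integral_complex_ofReal]
  refine integral_congr_ae (Filter.Eventually.of_forall fun t => ?_)
  simp

lemma gaussInt_half_zero_one : gaussInt one_half_pos 0 1 = (√(2 * Real.pi) : ℝ) := by
  have h1 := integral_gaussian (1 / 2)
  rw [show Real.pi / (1 / 2) = 2 * Real.pi by ring] at h1
  rw [gaussInt_apply, ← h1, ← integral_complex_ofReal]
  refine integral_congr_ae (Filter.Eventually.of_forall fun t => ?_)
  simp

lemma integral_eval_mul_exp_eq {b : ℝ} (hb : 0 < b) (p : ℝ[X]) :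
    Integrable (fun t : ℝ => p.eval t * Real.exp (-b * t ^ 2)) ∧
      ((∫ t : ℝ, p.eval t * Real.exp (-b * t ^ 2) : ℝ) : ℂ) =
        gaussInt hb 0 (p.map Complex.ofRealHom) := by
  have e : ∀ t : ℝ, (p.map Complex.ofRealHom).eval (t : ℂ) *
      Complex.exp (-b * (t : ℂ) ^ 2 + 0 * t) = ((p.eval t * Real.exp (-b * t ^ 2) : ℝ) : ℂ) := by
    intro t
    rw [show (t : ℂ) = Complex.ofRealHom t from rfl, eval_map_apply]
    push_cast
    simp
  constructor
  · have := (integrable_eval_mul_cexp hb 0 (p.map Complex.ofRealHom)).re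
    refine this.congr (Filter.Eventually.of_forall fun t => ?_)
    simp only [e]
    exact Complex.ofReal_re _
  · rw [gaussInt_apply, ← integral_complex_ofReal]
    exact integral_congr_ae (Filter.Eventually.of_forall fun t => (e t).symm)

lemma integral_derivative_sub_eq_zero (p : ℝ[X]) :
    ∫ t : ℝ, (derivative p - 2 * X * p).eval t * Real.exp (-t ^ 2) = 0 := by
  have h := (integral_eval_mul_exp_eq one_pos (derivative p - 2 * X * p)).2
  simp only [neg_one_mul] at h
  rw [← Complex.ofReal_eq_zero, h]
  have h2 := gaussInt_derivative one_pos 0 (p.map Complex.ofRealHom)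
  rw [← sub_eq_zero, ← map_sub] at h2
  refine Eq.trans (congrArg _ ?_) h2
  simp [derivative_map, mul_assoc, C_ofNat]

/-! ### Hermite polynomials -/

/-- The physicists' Hermite polynomials. -/
def physHermite : ℕ → ℝ[X]
  | 0 => 1
  | m + 1 => 2 * X * physHermite m - derivative (physHermite m)

lemma derivative_physHermite_succ (m : ℕ) :
    derivative (physHermite (m + 1)) = C (2 * (m + 1) : ℝ) * physHermite m := by
  induction m with
  | zero => simp [physHermite, C_ofNat]
  | succ m ih =>
    rw [physHermite, derivative_sub, ih]
    have e : physHermite (m + 1) = 2 * X * physHermite m - derivative (physHermite m) := rfl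
    simp only [derivative_mul, derivative_ofNat, derivative_X, ih, map_mul, map_add, map_one,
      map_natCast, map_ofNat, derivative_natCast, derivative_one]
    push_cast
    linear_combination (-(2 * ((m : ℝ[X]) + 1))) * e

lemma physHermite_add_two (m : ℕ) : physHermite (m + 2) =
    2 * X * physHermite (m + 1) - C (2 * (m + 1) : ℝ) * physHermite m := by
  rw [physHermite, derivative_physHermite_succ]

lemma derivative_derivative_physHermite (m : ℕ) :
    derivative (derivative (physHermite m)) =
      2 * X * derivative (physHermite m) - C (2 * m : ℝ) * physHermite m := by
  cases m with
  | zero => simp [physHermite]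
  | succ m =>
    rw [derivative_physHermite_succ, derivative_C_mul]
    conv_rhs => rw [physHermite]
    push_cast
    ring

/-- The normalized Hermite polynomial `H_{2j} / (4^j j!)`. -/
def normHermite (j : ℕ) : ℝ[X] := C (1 / (4 ^ j * j.factorial) : ℝ) * physHermite (2 * j)

/-- The normalized Hermite polynomial as a complex polynomial. -/
def normHermiteC (j : ℕ) : ℂ[X] := (normHermite j).map Complex.ofRealHom

lemma derivative_derivative_normHermite (j : ℕ) :
    derivative (derivative (normHermite j)) =
      2 * X * derivative (normHermite j) - C (4 * j : ℝ) * normHermite j := by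
  simp only [normHermite, derivative_C_mul, derivative_derivative_physHermite]
  rw [show (4 * j : ℝ) = 2 * (2 * j : ℕ) by push_cast; ring]
  ring

lemma derivative_derivative_normHermiteC (j : ℕ) :
    derivative (derivative (normHermiteC j)) =
      2 * X * derivative (normHermiteC j) - C (4 * j : ℂ) * normHermiteC j := by
  have := congrArg (Polynomial.map Complex.ofRealHom) (derivative_derivative_normHermite j)
  simpa [normHermiteC, derivative_map] using this

/-- Rodrigues' formula in weak form: integration by parts against `exp(-t²)` trades each Hermite
raising step for a derivative of `p`. -/
lemma gaussInt_mul_physHermite (m : ℕ) : ∀ p : ℂ[X],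
    gaussInt one_pos 0 (p * (physHermite m).map Complex.ofRealHom) =
      gaussInt one_pos 0 (derivative^[m] p) := by
  induction m with
  | zero => intro p; simp [physHermite]
  | succ m ih =>
    intro p
    rw [Function.iterate_succ_apply, ← ih (derivative p)]
    have h := gaussInt_derivative one_pos 0 (p * (physHermite m).map Complex.ofRealHom)
    rw [derivative_mul, map_add] at h
    rw [eq_sub_of_add_eq h, ← map_sub, physHermite]
    congr 1
    simp [derivative_map, C_ofNat]
    ring

lemma gaussInt_X_pow_add_two (m : ℕ) :
    gaussInt one_pos 0 (X ^ (m + 2)) = (m + 1) / 2 * gaussInt one_pos 0 (X ^ m) := by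
  have h := gaussInt_derivative one_pos 0 (X ^ (m + 1) : ℂ[X])
  rw [derivative_X_pow, Nat.add_sub_cancel, ← smul_eq_C_mul, map_smul,
    show (C (2 * (1 : ℝ) : ℂ) * X - C (0 : ℂ)) * X ^ (m + 1) = (2 : ℂ) • (X ^ (m + 2) : ℂ[X]) by
      rw [smul_eq_C_mul]; simp; ring, map_smul] at h
  simp only [smul_eq_mul] at h
  push_cast at h
  linear_combination (-1 / 2 : ℂ) * h

lemma gaussInt_X_pow_even (i : ℕ) :
    gaussInt one_pos 0 (X ^ (2 * i)) = (Real.Gamma (i + 1 / 2) : ℝ) := by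
  induction i with
  | zero => simp only [mul_zero, pow_zero, gaussInt_one_zero_one]; simp [Real.Gamma_one_half_eq, -one_div]
  | succ i ih =>
    rw [show 2 * (i + 1) = 2 * i + 2 by ring, gaussInt_X_pow_add_two, ih,
      show ((i + 1 : ℕ) : ℝ) + 1 / 2 = (i + 1 / 2) + 1 by push_cast; ring,
      Real.Gamma_add_one (by positivity)]
    push_cast
    ring

lemma gaussInt_X_pow_odd (i : ℕ) : gaussInt one_pos 0 (X ^ (2 * i + 1)) = 0 := by
  induction i with
  | zero =>
    have h := gaussInt_derivative one_pos 0 (1 : ℂ[X])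
    rw [derivative_one, map_zero, show (C (2 * (1 : ℝ) : ℂ) * X - C (0 : ℂ)) * 1 =
      (2 : ℂ) • (X : ℂ[X]) by rw [smul_eq_C_mul]; simp, map_smul, smul_eq_mul] at h
    simpa using h.symm
  | succ i ih =>
    rw [show 2 * (i + 1) + 1 = 2 * i + 1 + 2 by ring, gaussInt_X_pow_add_two, ih, mul_zero]

lemma gaussInt_mul_normHermiteC (j : ℕ) (p : ℂ[X]) :
    gaussInt one_pos 0 (p * normHermiteC j) =
      1 / (4 ^ j * j.factorial) * gaussInt one_pos 0 (derivative^[2 * j] p) := by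
  rw [← gaussInt_mul_physHermite, normHermiteC, normHermite, Polynomial.map_mul, map_C,
    mul_left_comm, ← smul_eq_C_mul, map_smul, smul_eq_mul]
  simp

lemma gaussInt_X_pow_odd_mul_normHermiteC (j r : ℕ) :
    gaussInt one_pos 0 (X ^ (2 * r + 1) * normHermiteC j) = 0 := by
  rw [gaussInt_mul_normHermiteC, iterate_derivative_X_pow_eq_smul, map_smul]
  rcases le_or_gt (2 * j) (2 * r) with h | h
  · rw [show 2 * r + 1 - 2 * j = 2 * (r - j) + 1 by omega, gaussInt_X_pow_odd]
    simp
  · rw [Nat.descFactorial_eq_zero_iff_lt.2 (by omega)]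
    simp

/-- The same combination of binomial and Gamma factors as in the Laguerre moments, reflecting
`H_{2j}(t) = (-1)^j 4^j j! L_j^{(-1/2)}(t²)`. It is what allows the witness to be rewritten as a
Gaussian integral. -/
lemma gaussInt_X_pow_even_mul_normHermiteC (j r : ℕ) :
    gaussInt one_pos 0 (X ^ (2 * r) * normHermiteC j) =
      (r.choose j * Real.Gamma (r + 1 / 2) : ℝ) := by
  rw [gaussInt_mul_normHermiteC, iterate_derivative_X_pow_eq_smul, map_smul]
  rcases le_or_gt j r with h | h
  · obtain ⟨i, rfl⟩ := Nat.exists_eq_add_of_le h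
    rw [show 2 * (j + i) - 2 * j = 2 * i by omega, gaussInt_X_pow_even, Gamma_nat_add_half_eq,
      Gamma_nat_add_half_eq]
    have e1 : (2 * (j + i)).descFactorial (2 * j) * (2 * i).factorial = (2 * (j + i)).factorial := by
      rw [mul_comm, ← Nat.factorial_mul_descFactorial (show 2 * j ≤ 2 * (j + i) by omega)]
      congr 2
      omega
    have e2 : ∀ m : ℕ, m.centralBinom * (m.factorial * m.factorial) = (2 * m).factorial := by
      intro m
      have := Nat.choose_mul_factorial_mul_factorial (show m ≤ 2 * m by omega)
      rw [show 2 * m - m = m by omega, mul_assoc] at this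
      exact this
    have e3 : (j + i).choose j * (j.factorial * i.factorial) = (j + i).factorial := by
      have := Nat.choose_mul_factorial_mul_factorial (show j ≤ j + i by omega)
      rw [show j + i - j = i by omega, mul_assoc] at this
      exact this
    have g1 : ((j + i).factorial : ℂ) ≠ 0 := by exact_mod_cast Nat.factorial_ne_zero _
    have g2 : (j.factorial : ℂ) ≠ 0 := by exact_mod_cast Nat.factorial_ne_zero _
    have g3 : (i.factorial : ℂ) ≠ 0 := by exact_mod_cast Nat.factorial_ne_zero _
    have f1 : ((i.centralBinom : ℂ)) = (2 * i).factorial / (i.factorial * i.factorial) := by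
      rw [eq_div_iff (mul_ne_zero g3 g3)]; exact_mod_cast e2 i
    have f2 : (((j + i).centralBinom : ℂ)) =
        (2 * (j + i)).factorial / ((j + i).factorial * (j + i).factorial) := by
      rw [eq_div_iff (mul_ne_zero g1 g1)]; exact_mod_cast e2 (j + i)
    have f3 : ((j + i).choose j : ℂ) = (j + i).factorial / (j.factorial * i.factorial) := by
      rw [eq_div_iff (mul_ne_zero g2 g3)]; exact_mod_cast e3
    have f4 : ((2 * (j + i)).factorial : ℂ) =
        (2 * (j + i)).descFactorial (2 * j) * (2 * i).factorial := by exact_mod_cast e1.symm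
    push_cast
    rw [f1, f2, f3, f4, pow_add, smul_eq_mul]
    field_simp
  · rw [Nat.descFactorial_eq_zero_iff_lt.2 (by omega), Nat.choose_eq_zero_of_lt h]
    simp

end

end HiddenDirection

namespace HiddenDirection

noncomputable section

open Finset Polynomial MeasureTheory Filter

/-! ### Sonin's bound for the harmonic oscillator equation -/

/-- For `f'' = (s² - λ)f` the energy `E = f'² + (λ - s²)f²` has derivative `-2s f²`, so on `s ≥ 0`
it decreases to its limit `0` and stays between `0` and `E(0)`. For `s² ≤ λ` both summands are
nonnegative, which gives both claims. -/
lemma sonin_bound {f g : ℝ → ℝ} {lam : ℝ} (h0 : 0 ≤ lam) (hf : ∀ s, HasDerivAt f (g s) s)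
    (hg : ∀ s, HasDerivAt g ((s ^ 2 - lam) * f s) s) (hf0 : Tendsto f atTop (nhds 0))
    (hg0 : Tendsto g atTop (nhds 0)) (hfg0 : Tendsto (fun s => (s ^ 2 - lam) * f s) atTop (nhds 0))
    {s : ℝ} (hs : 0 ≤ s) :
    g s ^ 2 ≤ g 0 ^ 2 + lam * f 0 ^ 2 ∧
      |lam - s ^ 2| * f s ^ 2 ≤ g 0 ^ 2 + lam * f 0 ^ 2 := by
  set E : ℝ → ℝ := fun s => g s ^ 2 + (lam - s ^ 2) * f s ^ 2 with hE
  have hEd : ∀ s, HasDerivAt E (-(2 * s) * f s ^ 2) s := by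
    intro s
    have h1 := ((hg s).pow 2).add ((((hasDerivAt_id s).pow 2).const_sub lam).mul ((hf s).pow 2))
    refine h1.congr_deriv ?_
    simp
    ring
  have hEanti : AntitoneOn E (Set.Ici 0) := by
    refine antitoneOn_of_deriv_nonpos (convex_Ici 0)
      (fun s _ => (hEd s).continuousAt.continuousWithinAt)
      (fun s _ => (hEd s).differentiableAt.differentiableWithinAt) fun s hs => ?_
    rw [interior_Ici] at hs
    rw [(hEd s).deriv]
    have : (0 : ℝ) < s := hs
    have := sq_nonneg (f s)
    nlinarith
  have hE0 : Tendsto E atTop (nhds 0) := by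
    have h1 := (hg0.pow 2).sub (hfg0.mul hf0)
    refine (h1.congr fun s => ?_).trans_eq (by simp)
    simp only [hE]; ring
  have hEnonneg : ∀ s, 0 ≤ s → 0 ≤ E s := fun s hs =>
    le_of_tendsto hE0 (by
      filter_upwards [eventually_ge_atTop s] with u hu
      exact hEanti (Set.mem_Ici.2 hs) (Set.mem_Ici.2 (hs.trans hu)) hu)
  have hEs : ∀ s, 0 ≤ s → E s ≤ g 0 ^ 2 + lam * f 0 ^ 2 := fun s hs => by
    have := hEanti (Set.mem_Ici.2 le_rfl) (Set.mem_Ici.2 hs) hs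
    simpa [hE] using this
  rcases le_total (s ^ 2) lam with h | h
  · have h1 := hEs s hs
    simp only [hE] at h1
    rw [abs_of_nonneg (by linarith)]
    constructor
    · nlinarith [mul_nonneg (sub_nonneg.2 h) (sq_nonneg (f s))]
    · nlinarith [sq_nonneg (g s)]
  -- Beyond the turning point `f f'` increases to `0`, hence is nonpositive. So `f'²` decreases from
  -- its value at `√λ`, which is `E(√λ)`, and `E ≥ 0` then bounds `(s² - λ)f²` by `f'²`.
  · set a := √lam with ha
    have hlam : lam ≤ a ^ 2 := by rw [ha, Real.sq_sqrt h0]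
    have has : a ≤ s := by
      rw [ha, ← Real.sqrt_sq hs]; exact Real.sqrt_le_sqrt h
    have ha0 : 0 ≤ a := Real.sqrt_nonneg _
    have hge : ∀ u, a ≤ u → lam ≤ u ^ 2 := fun u hu =>
      hlam.trans (pow_le_pow_left₀ ha0 hu 2)
    set G : ℝ → ℝ := fun s => f s * g s with hG
    have hGd : ∀ s, HasDerivAt G (g s * g s + f s * ((s ^ 2 - lam) * f s)) s := fun s =>
      (hf s).mul (hg s)
    have hGmono : MonotoneOn G (Set.Ici a) := by
      refine monotoneOn_of_deriv_nonneg (convex_Ici a)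
        (fun s _ => (hGd s).continuousAt.continuousWithinAt)
        (fun s _ => (hGd s).differentiableAt.differentiableWithinAt) fun u hu => ?_
      rw [interior_Ici] at hu
      rw [(hGd u).deriv]
      have := mul_nonneg (sub_nonneg.2 (hge u (le_of_lt hu))) (sq_nonneg (f u))
      nlinarith [sq_nonneg (g u)]
    have hG0 : Tendsto G atTop (nhds 0) := by simpa using hf0.mul hg0
    have hGneg : ∀ u, a ≤ u → G u ≤ 0 := fun u hu =>
      ge_of_tendsto hG0 (by
        filter_upwards [eventually_ge_atTop u] with v hv
        exact hGmono (Set.mem_Ici.2 hu) (Set.mem_Ici.2 (hu.trans hv)) hv)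
    have hgd : ∀ s, HasDerivAt (fun s => g s ^ 2) (2 * (s ^ 2 - lam) * G s) s := by
      intro s
      refine ((hg s).pow 2).congr_deriv ?_
      simp only [hG]; ring
    have hganti : AntitoneOn (fun s => g s ^ 2) (Set.Ici a) := by
      refine antitoneOn_of_deriv_nonpos (convex_Ici a)
        (fun s _ => (hgd s).continuousAt.continuousWithinAt)
        (fun s _ => (hgd s).differentiableAt.differentiableWithinAt) fun u hu => ?_
      rw [interior_Ici] at hu
      rw [(hgd u).deriv]
      have h1 := hge u (le_of_lt hu)
      have h2 := hGneg u (le_of_lt hu)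
      nlinarith
    have h1 : g s ^ 2 ≤ g a ^ 2 := hganti (Set.mem_Ici.2 le_rfl) (Set.mem_Ici.2 has) has
    have h2 : g a ^ 2 ≤ g 0 ^ 2 + lam * f 0 ^ 2 := by
      have := hEs a ha0
      simp only [hE] at this
      rw [ha, Real.sq_sqrt h0, sub_self, zero_mul, add_zero] at this
      exact this
    refine ⟨h1.trans h2, ?_⟩
    have h3 := hEnonneg s hs
    simp only [hE] at h3
    rw [abs_of_nonpos (by linarith)]
    linarith

/-! ### The Fourier transform of the Hermite functions -/

/-- The Fourier-type transform `∫ p(t) exp (-t²/2 + i s t) dt`. -/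
def fourierGauss (p : ℂ[X]) (s : ℝ) : ℂ := gaussInt one_half_pos (Complex.I * s) p

/-- The absolute integral `∫ |p(t)| exp (-t²/2) dt`. -/
def absGaussInt (p : ℂ[X]) : ℝ := ∫ t : ℝ, ‖p.eval (t : ℂ)‖ * Real.exp (-t ^ 2 / 2)

lemma norm_cexp_half (s t : ℝ) :
    ‖Complex.exp (-((1 / 2 : ℝ) : ℂ) * (t : ℂ) ^ 2 + Complex.I * s * t)‖ =
      Real.exp (-t ^ 2 / 2) := by
  rw [Complex.norm_exp]
  congr 1
  simp [← Complex.ofReal_pow]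
  ring

lemma integrable_norm_eval_mul_exp (p : ℂ[X]) :
    Integrable fun t : ℝ => ‖p.eval (t : ℂ)‖ * Real.exp (-t ^ 2 / 2) := by
  refine (integrable_eval_mul_cexp one_half_pos (Complex.I * (0 : ℝ)) p).norm.congr
    (Eventually.of_forall fun t => ?_)
  simp only [norm_mul, norm_cexp_half]

lemma norm_fourierGauss_le (p : ℂ[X]) (s : ℝ) : ‖fourierGauss p s‖ ≤ absGaussInt p := by
  refine (norm_integral_le_integral_norm _).trans_eq ?_
  refine integral_congr_ae (Eventually.of_forall fun t => ?_)
  simp only [norm_mul, norm_cexp_half]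

lemma hasDerivAt_fourierGauss (p : ℂ[X]) (s : ℝ) :
    HasDerivAt (fourierGauss p) (Complex.I * fourierGauss (X * p) s) s := by
  let F : ℝ → ℝ → ℂ := fun s t => p.eval (t : ℂ) *
    Complex.exp (-((1 / 2 : ℝ) : ℂ) * (t : ℂ) ^ 2 + Complex.I * s * t)
  let F' : ℝ → ℝ → ℂ := fun s t => Complex.I * ((X * p).eval (t : ℂ) *
    Complex.exp (-((1 / 2 : ℝ) : ℂ) * (t : ℂ) ^ 2 + Complex.I * s * t))
  have hF : ∀ s, Integrable (F s) := fun s =>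
    integrable_eval_mul_cexp one_half_pos (Complex.I * s) p
  have hF' : Integrable (F' s) :=
    (integrable_eval_mul_cexp one_half_pos (Complex.I * s) (X * p)).const_mul _
  have hb : ∀ s t : ℝ, ‖F' s t‖ ≤ ‖(X * p).eval (t : ℂ)‖ * Real.exp (-t ^ 2 / 2) := by
    intro s t
    simp only [F']
    rw [norm_mul, norm_mul, norm_cexp_half, Complex.norm_I, one_mul]
  have hd : ∀ s t : ℝ, HasDerivAt (fun s => F s t) (F' s t) s := by
    intro s t
    have h1 : HasDerivAt (fun z : ℂ => Complex.exp (-((1 / 2 : ℝ) : ℂ) * (t : ℂ) ^ 2 +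
        Complex.I * z * t)) (Complex.exp (-((1 / 2 : ℝ) : ℂ) * (t : ℂ) ^ 2 +
        Complex.I * s * t) * (Complex.I * t)) (s : ℂ) := by
      have := ((((hasDerivAt_id (s : ℂ)).const_mul Complex.I).mul_const (t : ℂ)).const_add
        (-((1 / 2 : ℝ) : ℂ) * (t : ℂ) ^ 2)).cexp
      simpa using this
    refine (h1.comp_ofReal.const_mul (p.eval (t : ℂ))).congr_deriv ?_
    simp only [F', eval_mul, eval_X]
    ring
  have h := (hasDerivAt_integral_of_dominated_loc_of_deriv_le (μ := volume) (F := F) (F' := F')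
    (x₀ := s) (s := Set.univ) univ_mem (Eventually.of_forall fun s => (hF s).aestronglyMeasurable)
    (hF s) hF'.aestronglyMeasurable (Eventually.of_forall fun t s _ => hb s t)
    (integrable_norm_eval_mul_exp _) (Eventually.of_forall fun t s _ => hd s t)).2
  simp only [F'] at h
  rw [integral_const_mul] at h
  exact h

lemma fourierGauss_add (p q : ℂ[X]) (s : ℝ) :
    fourierGauss (p + q) s = fourierGauss p s + fourierGauss q s := map_add _ _ _

lemma fourierGauss_sub (p q : ℂ[X]) (s : ℝ) :
    fourierGauss (p - q) s = fourierGauss p s - fourierGauss q s := map_sub _ _ _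

lemma fourierGauss_C_mul (a : ℂ) (p : ℂ[X]) (s : ℝ) :
    fourierGauss (C a * p) s = a * fourierGauss p s := by
  rw [← smul_eq_C_mul]; exact map_smul _ _ _

lemma fourierGauss_derivative (p : ℂ[X]) (s : ℝ) :
    fourierGauss (derivative p) s =
      fourierGauss (X * p) s - Complex.I * s * fourierGauss p s := by
  have h := gaussInt_derivative one_half_pos (Complex.I * s) p
  rw [show (C (2 * ((1 / 2 : ℝ) : ℂ)) * X - C (Complex.I * s)) * p =
    X * p - C (Complex.I * s) * p by
      rw [show (2 * ((1 / 2 : ℝ) : ℂ)) = 1 by push_cast; norm_num]; simp; ring] at h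
  unfold fourierGauss
  rw [h, map_sub, ← smul_eq_C_mul, map_smul, smul_eq_mul]

/-- A quantitative Riemann–Lebesgue lemma: one integration by parts gains `1/s`. -/
lemma tendsto_fourierGauss (p : ℂ[X]) : Tendsto (fourierGauss p) atTop (nhds 0) := by
  set K := absGaussInt (X * p) + absGaussInt (derivative p)
  refine squeeze_zero_norm' (a := fun s : ℝ => K / s) ?_ (tendsto_const_nhds.div_atTop tendsto_id)
  filter_upwards [eventually_gt_atTop 0] with s hs
  rw [le_div_iff₀ hs]
  have h := fourierGauss_derivative p s
  have h1 : ‖fourierGauss p s‖ * s = ‖Complex.I * s * fourierGauss p s‖ := by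
    rw [norm_mul, norm_mul, Complex.norm_I, one_mul, Complex.norm_real, Real.norm_eq_abs,
      abs_of_pos hs, mul_comm]
  rw [h1, show Complex.I * s * fourierGauss p s = fourierGauss (X * p) s -
    fourierGauss (derivative p) s by rw [h]; ring]
  exact (norm_sub_le _ _).trans (add_le_add (norm_fourierGauss_le _ _) (norm_fourierGauss_le _ _))

/-- The Fourier transform of `t ^ b` times the normalized Hermite function. -/
def hermiteFT (j b : ℕ) (s : ℝ) : ℂ := fourierGauss (X ^ b * normHermiteC j) s

lemma hasDerivAt_hermiteFT (j b : ℕ) (s : ℝ) :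
    HasDerivAt (hermiteFT j b) (Complex.I * hermiteFT j (b + 1) s) s := by
  have h := hasDerivAt_fourierGauss (X ^ b * normHermiteC j) s
  rw [← mul_assoc, ← pow_succ'] at h
  exact h

lemma hermiteFT_two (j : ℕ) (s : ℝ) :
    hermiteFT j 2 s = ((4 * j + 1 : ℝ) - s ^ 2 : ℝ) * hermiteFT j 0 s := by
  have h1 := fourierGauss_derivative (normHermiteC j) s
  have h2 := fourierGauss_derivative (derivative (normHermiteC j)) s
  have h3 := fourierGauss_derivative (X * normHermiteC j) s
  rw [derivative_derivative_normHermiteC, fourierGauss_sub, fourierGauss_C_mul,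
    show (2 * X * derivative (normHermiteC j) : ℂ[X]) = C 2 * (X * derivative (normHermiteC j)) by
      rw [C_ofNat]; ring, fourierGauss_C_mul] at h2
  rw [derivative_mul, derivative_X, one_mul, fourierGauss_add, ← mul_assoc, ← sq] at h3
  unfold hermiteFT
  rw [pow_zero, one_mul]
  push_cast
  have hI := Complex.I_sq
  linear_combination (-1 : ℂ) * h3 + h2 + (-Complex.I * s) * h1 +
    ((s : ℂ) ^ 2 * fourierGauss (normHermiteC j) s) * hI

/-- Leibniz differentiation of `hermiteFT_two`, `b` times. The truncated indices `b - 1` and `b - 2`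
are harmless because their prefactors vanish where truncation occurs. -/
lemma hermiteFT_add_two (j b : ℕ) : ∀ s : ℝ,
    hermiteFT j (b + 2) s = ((4 * j + 1 : ℝ) - s ^ 2 : ℝ) * hermiteFT j b s +
      2 * b * Complex.I * s * hermiteFT j (b - 1) s + b * (b - 1) * hermiteFT j (b - 2) s := by
  induction b with
  | zero => intro s; rw [hermiteFT_two]; simp
  | succ b ih =>
    intro s
    have hl := hasDerivAt_hermiteFT j (b + 2) s
    have hA := hasDerivAt_hermiteFT j b s
    have hB := hasDerivAt_hermiteFT j (b - 1) s
    have hC := hasDerivAt_hermiteFT j (b - 2) s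
    have hs : HasDerivAt (fun s : ℝ => (s : ℂ)) 1 s := (hasDerivAt_id (s : ℂ)).comp_ofReal
    have hq : HasDerivAt (fun s : ℝ => (((4 * j + 1 : ℝ) - s ^ 2 : ℝ) : ℂ)) (-(2 * s)) s := by
      have := (((hasDerivAt_id s).pow 2).const_sub (4 * (j : ℝ) + 1)).ofReal_comp
      refine this.congr_deriv ?_
      simp
    have hr := ((hq.mul hA).add (((hs.const_mul (2 * b * Complex.I)).mul hB))).add
      (hC.const_mul ((b : ℂ) * (b - 1)))
    have hr' : HasDerivAt (hermiteFT j (b + 2)) _ s :=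
      hr.congr_of_eventuallyEq (Eventually.of_forall fun s => ih s)
    have h := hl.unique hr'
    have hI := Complex.I_mul_I
    rcases b with _ | _ | b
    · simp at h ⊢
      linear_combination (-Complex.I) * h +
        (hermiteFT j 3 s - (4 * j + 1 - s ^ 2) * hermiteFT j 1 s) * hI
    · simp at h ⊢
      linear_combination (-Complex.I) * h + (hermiteFT j 4 s - (4 * j + 1 - s ^ 2) *
        hermiteFT j 2 s - 2 * Complex.I * s * hermiteFT j 1 s - 2 * hermiteFT j 0 s) * hI
    · simp at h ⊢
      linear_combination (-Complex.I) * h + (hermiteFT j (b + 2 + 3) s - (4 * j + 1 - s ^ 2) *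
        hermiteFT j (b + 2 + 1) s - 2 * (b + 2) * Complex.I * s * hermiteFT j (b + 2) s -
          ((b + 2) ^ 2 + (b + 2)) * hermiteFT j (b + 1) s) * hI

end

end HiddenDirection

namespace HiddenDirection

noncomputable section

open Finset Polynomial MeasureTheory Filter

/-! ### Bounds for the transforms and the moments of the Hermite functions -/

lemma fourierGauss_zero_physHermite_add_two (m : ℕ) :
    fourierGauss ((physHermite (m + 2)).map Complex.ofRealHom) 0 =
      2 * (m + 1) * fourierGauss ((physHermite m).map Complex.ofRealHom) 0 := by
  have h := fourierGauss_derivative ((physHermite (m + 1)).map Complex.ofRealHom) 0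
  rw [derivative_map] at h
  have e : (physHermite (m + 2)).map Complex.ofRealHom =
      C 2 * (X * (physHermite (m + 1)).map Complex.ofRealHom) -
        (derivative (physHermite (m + 1))).map Complex.ofRealHom := by
    rw [physHermite]
    simp [C_ofNat, mul_assoc]
  have e2 : (derivative (physHermite (m + 1))).map Complex.ofRealHom =
      C (2 * (m + 1) : ℂ) * (physHermite m).map Complex.ofRealHom := by
    rw [derivative_physHermite_succ]
    simp
  have h2 : fourierGauss (X * (physHermite (m + 1)).map Complex.ofRealHom) 0 =
      fourierGauss ((derivative (physHermite (m + 1))).map Complex.ofRealHom) 0 := by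
    rw [h]; simp
  rw [e, fourierGauss_sub, fourierGauss_C_mul, h2, e2, fourierGauss_C_mul]
  ring

lemma fourierGauss_zero_physHermite_odd (i : ℕ) :
    fourierGauss ((physHermite (2 * i + 1)).map Complex.ofRealHom) 0 = 0 := by
  induction i with
  | zero =>
    have h := fourierGauss_derivative 1 0
    have e : (physHermite (2 * 0 + 1)).map Complex.ofRealHom = C 2 * (X * 1) := by
      simp [physHermite, C_ofNat]
    rw [e, fourierGauss_C_mul]
    have h0 : fourierGauss 0 0 = 0 := map_zero (gaussInt one_half_pos _)
    simp only [derivative_one, h0, Complex.ofReal_zero, mul_zero, zero_mul, sub_zero] at h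
    rw [← h, mul_zero]
  | succ i ih =>
    rw [show 2 * (i + 1) + 1 = 2 * i + 1 + 2 by ring, fourierGauss_zero_physHermite_add_two, ih,
      mul_zero]

lemma fourierGauss_zero_physHermite_even (i : ℕ) :
    fourierGauss ((physHermite (2 * i)).map Complex.ofRealHom) 0 =
      (√(2 * Real.pi) * (i.factorial * i.centralBinom) : ℝ) := by
  induction i with
  | zero =>
    have := gaussInt_half_zero_one
    simp only [physHermite, fourierGauss]
    simpa using this
  | succ i ih =>
    rw [show 2 * (i + 1) = 2 * i + 2 by ring, fourierGauss_zero_physHermite_add_two, ih]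
    have h : ((i : ℂ) + 1) * (i + 1).centralBinom = 2 * (2 * i + 1) * i.centralBinom := by
      exact_mod_cast Nat.succ_mul_centralBinom_succ i
    rw [Nat.factorial_succ]
    push_cast
    linear_combination (-(√(2 * Real.pi) : ℂ) * i.factorial) * h

lemma hermiteFT_zero_zero (j : ℕ) :
    hermiteFT j 0 0 = (√(2 * Real.pi) * (j.centralBinom / 4 ^ j) : ℝ) := by
  rw [hermiteFT, pow_zero, one_mul, normHermiteC, normHermite, Polynomial.map_mul, map_C,
    fourierGauss_C_mul, fourierGauss_zero_physHermite_even]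
  have h : (j.factorial : ℂ) ≠ 0 := by exact_mod_cast Nat.factorial_ne_zero _
  simp
  field_simp

lemma hermiteFT_one_zero (j : ℕ) : hermiteFT j 1 0 = 0 := by
  have h := fourierGauss_derivative (normHermiteC j) 0
  rw [hermiteFT, pow_one]
  simp only [Complex.ofReal_zero, mul_zero, zero_mul, sub_zero] at h
  rw [← h, normHermiteC, derivative_map, normHermite, derivative_C_mul, Polynomial.map_mul, map_C,
    fourierGauss_C_mul]
  rcases j with _ | j
  · have h0 : fourierGauss 0 0 = 0 := map_zero (gaussInt one_half_pos _)
    simp [physHermite, h0]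
  · rw [show 2 * (j + 1) = (2 * j + 1) + 1 by ring, derivative_physHermite_succ, Polynomial.map_mul,
      map_C, fourierGauss_C_mul, fourierGauss_zero_physHermite_odd, mul_zero, mul_zero]

lemma hermiteFT_neg (j b : ℕ) (s : ℝ) :
    hermiteFT j b (-s) = (starRingEnd ℂ) (hermiteFT j b s) := by
  rw [hermiteFT, hermiteFT, fourierGauss, fourierGauss, gaussInt_apply, gaussInt_apply,
    ← integral_conj]
  refine integral_congr_ae (Eventually.of_forall fun t => ?_)
  have e : (X ^ b * normHermiteC j).eval (t : ℂ) =
      (((X ^ b * normHermite j).eval t : ℝ) : ℂ) := by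
    simp only [eval_mul, eval_pow, eval_X, normHermiteC]
    rw [show (t : ℂ) = Complex.ofRealHom t from rfl, eval_map_apply]
    push_cast
    rfl
  simp only [e, map_mul, Complex.conj_ofReal, ← Complex.exp_conj, map_add, map_neg, map_pow,
    Complex.conj_I]
  push_cast
  ring_nf

lemma norm_hermiteFT_abs (j b : ℕ) (s : ℝ) : ‖hermiteFT j b |s|‖ = ‖hermiteFT j b s‖ := by
  rcases abs_cases s with ⟨h, _⟩ | ⟨h, _⟩ <;> rw [h]
  rw [hermiteFT_neg, Complex.norm_conj]

lemma sonin_initial_le (j : ℕ) :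
    (4 * j + 1) * (√(2 * Real.pi) * (j.centralBinom / 4 ^ j)) ^ 2 ≤ 16 := by
  have h1 := centralBinom_sq_mul_le_one j
  rw [mul_pow, Real.sq_sqrt (by positivity)]
  have h2 := Real.pi_lt_four
  have h3 := Real.pi_pos
  set a := ((j.centralBinom : ℝ) / 4 ^ j) ^ 2
  have ha : 0 ≤ a := sq_nonneg _
  have h4 : (4 * (j : ℝ) + 1) * a ≤ 2 := by nlinarith
  calc _ = 2 * Real.pi * ((4 * (j : ℝ) + 1) * a) := by ring
    _ ≤ 2 * 4 * 2 := by gcongr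
    _ = 16 := by norm_num

/-- Sonin's bound is applied to real and imaginary parts. At `s = 0` the derivative vanishes, so the
initial energy is `(4j+1)` times the squared central value, at most `16` uniformly in `j`. -/
lemma hermiteFT_sonin (j : ℕ) (s : ℝ) :
    ‖hermiteFT j 1 s‖ ≤ 4 ∧ |(4 * j + 1 : ℝ) - s ^ 2| * ‖hermiteFT j 0 s‖ ^ 2 ≤ 16 := by
  suffices H : ∀ s : ℝ, 0 ≤ s →
      ‖hermiteFT j 1 s‖ ≤ 4 ∧ |(4 * j + 1 : ℝ) - s ^ 2| * ‖hermiteFT j 0 s‖ ^ 2 ≤ 16 by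
    have := H |s| (abs_nonneg s)
    rwa [norm_hermiteFT_abs, norm_hermiteFT_abs, sq_abs] at this
  intro s hs
  have h0 := hasDerivAt_hermiteFT j 0
  have h1 := hasDerivAt_hermiteFT j 1
  have t0 : Tendsto (hermiteFT j 0) atTop (nhds 0) := tendsto_fourierGauss _
  have t1 : Tendsto (hermiteFT j 1) atTop (nhds 0) := tendsto_fourierGauss _
  have t2 : Tendsto (hermiteFT j 2) atTop (nhds 0) := tendsto_fourierGauss _
  have hre : ∀ {f : ℝ → ℂ}, Tendsto f atTop (nhds 0) →
      Tendsto (fun s => (f s).re) atTop (nhds 0) := fun h =>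
    (Complex.continuous_re.tendsto 0).comp h
  have him : ∀ {f : ℝ → ℂ}, Tendsto f atTop (nhds 0) →
      Tendsto (fun s => (f s).im) atTop (nhds 0) := fun h =>
    (Complex.continuous_im.tendsto 0).comp h
  have hder_re : ∀ {f : ℝ → ℂ} {f' : ℂ} {s : ℝ}, HasDerivAt f f' s →
      HasDerivAt (fun s => (f s).re) f'.re s := fun h => by
    exact Complex.reCLM.hasFDerivAt.comp_hasDerivAt _ h
  have hder_im : ∀ {f : ℝ → ℂ} {f' : ℂ} {s : ℝ}, HasDerivAt f f' s →
      HasDerivAt (fun s => (f s).im) f'.im s := fun h => by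
    exact Complex.imCLM.hasFDerivAt.comp_hasDerivAt _ h
  have hlam : (0 : ℝ) ≤ 4 * j + 1 := by positivity
  have hR := sonin_bound (f := fun s => (hermiteFT j 0 s).re) (g := fun s => -(hermiteFT j 1 s).im)
    hlam (fun s => (hder_re (h0 s)).congr_deriv (by simp))
    (fun s => (hder_im (h1 s)).neg.congr_deriv (by
      rw [show 1 + 1 = 2 from rfl, hermiteFT_two]
      simp only [Complex.mul_im, Complex.I_re, Complex.I_im, Complex.re_ofReal_mul]
      ring)) (hre t0) (by simpa using (him t1).neg)
    (by
      have := (hre t2).neg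
      simp only [hermiteFT_two, Complex.re_ofReal_mul, neg_zero] at this
      refine this.congr fun s => ?_
      ring) hs
  have hI := sonin_bound (f := fun s => (hermiteFT j 0 s).im) (g := fun s => (hermiteFT j 1 s).re)
    hlam (fun s => (hder_im (h0 s)).congr_deriv (by simp))
    (fun s => (hder_re (h1 s)).congr_deriv (by
      rw [show 1 + 1 = 2 from rfl, hermiteFT_two]
      simp only [Complex.mul_re, Complex.I_re, Complex.I_im, Complex.im_ofReal_mul]
      ring)) (him t0) (hre t1)
    (by
      have := (him t2).neg
      simp only [hermiteFT_two, Complex.im_ofReal_mul, neg_zero] at this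
      refine this.congr fun s => ?_
      ring) hs
  have hini := sonin_initial_le j
  simp only [hermiteFT_zero_zero, hermiteFT_one_zero, Complex.zero_im, Complex.zero_re,
    Complex.ofReal_re, Complex.ofReal_im] at hR hI
  norm_num only [neg_zero, mul_zero, zero_add, add_zero] at hR hI
  have e : ∀ z : ℂ, ‖z‖ ^ 2 = z.re ^ 2 + z.im ^ 2 := fun z => by
    rw [Complex.sq_norm, Complex.normSq_apply]; ring
  constructor
  · refine le_of_sq_le_sq ?_ (by norm_num)
    rw [e]
    nlinarith [hR.1, hI.1]
  · rw [e]
    nlinarith [hR.2, hI.2]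

/-- The energy bound on the function degenerates at the turning point; integrating the uniform
derivative bound from `0` gives a weaker estimate valid everywhere. -/
lemma norm_hermiteFT_zero_le (j : ℕ) (s : ℝ) : ‖hermiteFT j 0 s‖ ≤ 4 + 4 * |s| := by
  have h0 : ‖hermiteFT j 0 0‖ ≤ 4 := by
    have h1 := (hermiteFT_sonin j 0).2
    have h2 : (1 : ℝ) ≤ |(4 * j + 1 : ℝ) - 0 ^ 2| := by
      rw [abs_of_nonneg (by norm_num; positivity)]
      have : (0 : ℝ) ≤ j := by positivity
      norm_num
    refine le_of_sq_le_sq ?_ (by norm_num)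
    nlinarith [sq_nonneg ‖hermiteFT j 0 0‖]
  have h := Convex.norm_image_sub_le_of_norm_hasDerivWithin_le (f := hermiteFT j 0) (C := 4)
    (s := Set.univ) (x := 0) (y := s) (fun x _ => (hasDerivAt_hermiteFT j 0 x).hasDerivWithinAt)
    (fun x _ => by
      rw [norm_mul, Complex.norm_I, one_mul]
      exact (hermiteFT_sonin j x).1) convex_univ (Set.mem_univ _) (Set.mem_univ _)
  rw [sub_zero, Real.norm_eq_abs] at h
  have := norm_sub_norm_le (hermiteFT j 0 s) (hermiteFT j 0 0)
  linarith

/-- By the recurrence, each extra power of `t` costs one factor `Z`, with constants independent of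
`j`. The first power is free, which is why the factor `t` in the Gaussian representation of the
witness matters. -/
lemma exists_norm_hermiteFT_succ_le (b : ℕ) : ∃ A : ℝ, 0 ≤ A ∧ ∀ (j : ℕ) (s Z : ℝ), 1 ≤ Z →
    (4 * j + 1 : ℝ) ≤ Z ^ 2 → |s| ≤ Z → ‖hermiteFT j (b + 1) s‖ ≤ A * Z ^ b := by
  induction b using Nat.strong_induction_on with
  | _ b ih =>
    have hlam : ∀ (j : ℕ) (s Z : ℝ), 1 ≤ Z → (4 * j + 1 : ℝ) ≤ Z ^ 2 → |s| ≤ Z →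
        |(4 * j + 1 : ℝ) - s ^ 2| ≤ Z ^ 2 := by
      intro j s Z hZ hj hs
      have h1 : s ^ 2 ≤ Z ^ 2 := by rw [← sq_abs]; exact pow_le_pow_left₀ (abs_nonneg _) hs 2
      have h2 : (0 : ℝ) ≤ 4 * j + 1 := by positivity
      rw [abs_le]
      constructor <;> nlinarith [sq_nonneg s]
    have hweak : ∀ i, i + 1 ≤ b → ∃ A : ℝ, 0 ≤ A ∧ ∀ (j : ℕ) (s Z : ℝ), 1 ≤ Z →
        (4 * j + 1 : ℝ) ≤ Z ^ 2 → |s| ≤ Z → ‖hermiteFT j i s‖ ≤ A * Z ^ (i + 1) := by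
      intro i hi
      rcases i with _ | i
      · refine ⟨8, by norm_num, fun j s Z hZ _ hs => ?_⟩
        have := norm_hermiteFT_zero_le j s
        rw [zero_add, pow_one]
        linarith
      · obtain ⟨A, hA, h⟩ := ih i (by omega)
        refine ⟨A, hA, fun j s Z hZ hj hs => (h j s Z hZ hj hs).trans ?_⟩
        exact mul_le_mul_of_nonneg_left (pow_le_pow_right₀ hZ (by omega)) hA
    rcases b with _ | _ | c
    · exact ⟨4, by norm_num, fun j s Z _ _ _ => by simpa using (hermiteFT_sonin j s).1⟩
    -- The square of `|λ - s²| ‖F‖` splits as `|λ - s²| ≤ Z²` times the Sonin quantity `≤ 16`, so no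
    -- loss occurs at the turning point.
    · refine ⟨4, by norm_num, fun j s Z hZ hj hs => ?_⟩
      have h1 := hlam j s Z hZ hj hs
      have h2 := (hermiteFT_sonin j s).2
      rw [show 0 + 1 + 1 = 2 from rfl, hermiteFT_two, norm_mul, Complex.norm_real,
        Real.norm_eq_abs]
      refine le_of_sq_le_sq ?_ (by positivity)
      calc _ = |(4 * j + 1 : ℝ) - s ^ 2| * (|(4 * j + 1 : ℝ) - s ^ 2| * ‖hermiteFT j 0 s‖ ^ 2) := by
            ring
        _ ≤ Z ^ 2 * 16 := by gcongr
        _ = _ := by ring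
    · obtain ⟨A₁, hA₁, h₁⟩ := ih c (by omega)
      obtain ⟨A₂, hA₂, h₂⟩ := hweak c (by omega)
      obtain ⟨A₃, hA₃, h₃⟩ := hweak (c - 1) (by omega)
      refine ⟨A₁ + 2 * (c + 1) * A₂ + (c + 1) * c * A₃, by positivity, fun j s Z hZ hj hs => ?_⟩
      have g1 := h₁ j s Z hZ hj hs
      have g2 := h₂ j s Z hZ hj hs
      have g3 := h₃ j s Z hZ hj hs
      have hZ0 : 0 ≤ Z := zero_le_one.trans hZ
      have g3' : (c : ℝ) * ‖hermiteFT j (c - 1) s‖ ≤ c * (A₃ * Z ^ (c + 2)) := by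
        refine mul_le_mul_of_nonneg_left (g3.trans ?_) (by positivity)
        exact mul_le_mul_of_nonneg_left (pow_le_pow_right₀ hZ (by omega)) hA₃
      rw [show c + 1 + 1 + 1 = (c + 1) + 2 by ring, hermiteFT_add_two]
      rw [show c + 1 - 1 = c by omega, show c + 1 - 2 = c - 1 by omega]
      refine (norm_add₃_le).trans ?_
      have n1 : ‖(((4 * j + 1 : ℝ) - s ^ 2 : ℝ) : ℂ) * hermiteFT j (c + 1) s‖ ≤
          Z ^ 2 * (A₁ * Z ^ c) := by
        rw [norm_mul, Complex.norm_real, Real.norm_eq_abs]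
        have := hlam j s Z hZ hj hs
        gcongr
      have n2 : ‖2 * ((c + 1 : ℕ) : ℂ) * Complex.I * s * hermiteFT j c s‖ ≤
          2 * (c + 1) * Z * (A₂ * Z ^ (c + 1)) := by
        simp only [norm_mul, Complex.norm_I, Complex.norm_real, Complex.norm_natCast,
          Complex.norm_ofNat, Real.norm_eq_abs, mul_one]
        push_cast
        gcongr
      have n3 : ‖((c + 1 : ℕ) : ℂ) * (((c + 1 : ℕ) : ℂ) - 1) * hermiteFT j (c - 1) s‖ ≤
          (c + 1) * (c * (A₃ * Z ^ (c + 2))) := by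
        rw [show ((c + 1 : ℕ) : ℂ) - 1 = (c : ℕ) by push_cast; ring, mul_assoc]
        simp only [norm_mul, Complex.norm_natCast]
        push_cast
        gcongr
      calc _ ≤ _ := add_le_add (add_le_add n1 n2) n3
        _ = _ := by ring

end

end HiddenDirection

/-! ### Even moments and weighted absolute integrals of the Hermite functions -/

namespace HiddenDirection

noncomputable section

open Finset Polynomial MeasureTheory Filter

lemma integrable_eval_mul_exp_neg_sq (p : ℝ[X]) :
    Integrable fun t : ℝ => p.eval t * Real.exp (-t ^ 2) := by
  simpa using (integral_eval_mul_exp_eq one_pos p).1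

/-- The functional `p ↦ ∫ p(t) exp (-t²) dt` on real polynomials. -/
def gaussMoment : ℝ[X] →ₗ[ℝ] ℝ where
  toFun p := ∫ t : ℝ, p.eval t * Real.exp (-t ^ 2)
  map_add' p q := by
    simp only [eval_add, add_mul]
    exact integral_add (integrable_eval_mul_exp_neg_sq p) (integrable_eval_mul_exp_neg_sq q)
  map_smul' a p := by
    simp only [eval_smul, smul_eq_mul, mul_assoc, RingHom.id_apply]
    exact integral_const_mul _ _

lemma gaussMoment_apply (p : ℝ[X]) :
    gaussMoment p = ∫ t : ℝ, p.eval t * Real.exp (-t ^ 2) := rfl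

lemma gaussMoment_nonneg {p : ℝ[X]} (hp : ∀ t, 0 ≤ p.eval t) : 0 ≤ gaussMoment p :=
  integral_nonneg fun t => mul_nonneg (hp t) (Real.exp_nonneg _)

lemma gaussMoment_C_mul (a : ℝ) (p : ℝ[X]) : gaussMoment (C a * p) = a * gaussMoment p := by
  rw [← smul_eq_C_mul, map_smul, smul_eq_mul]

/-- The moments `∫ t^{2b} h(t)² exp (-t²) dt` of the Hermite functions. -/
def hermiteMoment (j b : ℕ) : ℝ := gaussMoment (X ^ (2 * b) * normHermite j ^ 2)

lemma hermiteMoment_nonneg (j b : ℕ) : 0 ≤ hermiteMoment j b :=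
  gaussMoment_nonneg fun t => by
    rw [eval_mul, eval_pow, eval_pow, pow_mul, eval_X]
    positivity

lemma iterate_derivative_physHermite (m : ℕ) :
    derivative^[m] (physHermite m) = C (2 ^ m * m.factorial : ℝ) := by
  induction m with
  | zero => simp [physHermite]
  | succ m ih =>
    rw [Function.iterate_succ_apply, derivative_physHermite_succ, iterate_derivative_C_mul, ih,
      ← C_mul, Nat.factorial_succ]
    congr 1
    push_cast
    ring

lemma hermiteMoment_zero (j : ℕ) : hermiteMoment j 0 = √Real.pi * (j.centralBinom / 4 ^ j) := by
  have hC : ∀ a : ℂ, gaussInt one_pos 0 (C a) = a * (√Real.pi : ℝ) := fun a => by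
    rw [← mul_one (C a), ← smul_eq_C_mul, map_smul, gaussInt_one_zero_one, smul_eq_mul]
  have h := (integral_eval_mul_exp_eq one_pos (normHermite j * normHermite j)).2
  rw [Polynomial.map_mul, show (normHermite j).map Complex.ofRealHom = normHermiteC j from rfl,
    gaussInt_mul_normHermiteC, normHermiteC, iterate_derivative_map, normHermite,
    iterate_derivative_C_mul, iterate_derivative_physHermite, ← C_mul, map_C, hC] at h
  have h2 : (j.centralBinom : ℝ) * (j.factorial * j.factorial) = (2 * j).factorial := by
    have := Nat.choose_mul_factorial_mul_factorial (show j ≤ 2 * j by omega)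
    rw [show 2 * j - j = j by omega, mul_assoc] at this
    exact_mod_cast this
  have h3 : (j.factorial : ℝ) ≠ 0 := by exact_mod_cast Nat.factorial_ne_zero _
  have h4 : hermiteMoment j 0 = 1 / (4 ^ j * j.factorial) *
      (1 / (4 ^ j * j.factorial) * (2 ^ (2 * j) * (2 * j).factorial) * √Real.pi) := by
    have e : hermiteMoment j 0 =
        ∫ t : ℝ, (normHermite j * normHermite j).eval t * Real.exp (-1 * t ^ 2) := by
      simp [hermiteMoment, gaussMoment_apply, sq]
    rw [← Complex.ofReal_inj, e]
    unfold normHermite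
    rw [h]
    simp
  rw [h4, ← h2, pow_mul]
  norm_num
  field_simp

lemma hermiteMoment_zero_le (j : ℕ) : hermiteMoment j 0 ≤ 2 := by
  rw [hermiteMoment_zero]
  have h1 : √Real.pi ≤ 2 := by
    rw [Real.sqrt_le_left (by norm_num)]
    linarith [Real.pi_lt_four]
  have h2 := centralBinom_sq_mul_le_one j
  have h3 : (0 : ℝ) ≤ j.centralBinom / 4 ^ j := by positivity
  have h4 : (j.centralBinom : ℝ) / 4 ^ j ≤ 1 := by
    have : (0 : ℝ) ≤ j := by positivity
    refine le_of_sq_le_sq ?_ zero_le_one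
    nlinarith [sq_nonneg ((j.centralBinom : ℝ) / 4 ^ j)]
  nlinarith [Real.sqrt_nonneg Real.pi]

/-- Energy identity for the oscillator: kinetic plus potential energy equals `(4j+1)` times the
mass, and the kinetic term is dropped. -/
lemma hermiteMoment_one_le (j : ℕ) : hermiteMoment j 1 ≤ (4 * j + 1) * hermiteMoment j 0 := by
  set h := normHermite j with hh
  have h0 := integral_derivative_sub_eq_zero (h * (derivative h - X * h))
  rw [← gaussMoment_apply] at h0
  have e : derivative (h * (derivative h - X * h)) - 2 * X * (h * (derivative h - X * h)) =
      (derivative h - X * h) ^ 2 + X ^ (2 * 1) * h ^ 2 -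
        C (4 * j + 1 : ℝ) * (X ^ (2 * 0) * h ^ 2) := by
    simp only [derivative_mul, derivative_sub, derivative_X, hh, derivative_derivative_normHermite]
    simp only [map_add, map_mul, map_one]
    ring
  rw [e, map_sub, map_add, gaussMoment_C_mul] at h0
  have h1 : 0 ≤ gaussMoment ((derivative h - X * h) ^ 2) :=
    gaussMoment_nonneg fun t => by rw [eval_pow]; positivity
  simp only [hermiteMoment, ← hh]
  linarith

/-- The same identity with weight `t^{2(b+1)}`. The subtracted part of `q` cancels the cross term
produced by differentiating the weight. -/
lemma hermiteMoment_add_two_le (j b : ℕ) : hermiteMoment j (b + 2) ≤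
    (4 * j + 1) * hermiteMoment j (b + 1) + (b + 1) * (2 * b + 1) * hermiteMoment j b := by
  set h := normHermite j with hh
  set q := X ^ (2 * (b + 1)) * (h * (derivative h - X * h)) -
    C (b + 1 : ℝ) * (X ^ (2 * b + 1) * h ^ 2) with hq
  have h0 := integral_derivative_sub_eq_zero q
  rw [← gaussMoment_apply] at h0
  have e : derivative q - 2 * X * q =
      (X ^ (b + 1) * (derivative h - X * h)) ^ 2 + X ^ (2 * (b + 2)) * h ^ 2 -
        C (4 * j + 1 : ℝ) * (X ^ (2 * (b + 1)) * h ^ 2) -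
          C ((b + 1) * (2 * b + 1) : ℝ) * (X ^ (2 * b) * h ^ 2) := by
    simp only [hq, derivative_mul, derivative_sub, derivative_X, derivative_C,
      derivative_pow, hh, derivative_derivative_normHermite, Nat.add_sub_cancel,
      show 2 * (b + 1) - 1 = 2 * b + 1 by omega]
    simp only [map_add, map_mul, map_one, map_natCast, map_ofNat]
    push_cast
    ring
  rw [e, map_sub, map_sub, map_add, gaussMoment_C_mul, gaussMoment_C_mul] at h0
  have h1 : 0 ≤ gaussMoment ((X ^ (b + 1) * (derivative h - X * h)) ^ 2) :=
    gaussMoment_nonneg fun t => by rw [eval_pow]; positivity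
  simp only [hermiteMoment, ← hh]
  linarith

lemma exists_hermiteMoment_le (b : ℕ) : ∃ A : ℝ, 0 ≤ A ∧ ∀ (j : ℕ) (Z : ℝ), 1 ≤ Z →
    (4 * j + 1 : ℝ) ≤ Z ^ 2 → hermiteMoment j b ≤ A * Z ^ (2 * b) := by
  induction b using Nat.twoStepInduction with
  | zero => exact ⟨2, by norm_num, fun j Z _ _ => by simpa using hermiteMoment_zero_le j⟩
  | one =>
    refine ⟨2, by norm_num, fun j Z _ hj => (hermiteMoment_one_le j).trans ?_⟩
    have := hermiteMoment_zero_le j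
    calc _ ≤ (Z ^ 2) * 2 := mul_le_mul hj this (hermiteMoment_nonneg _ _) (sq_nonneg _)
      _ = _ := by ring
  | more b ih₀ ih₁ =>
    obtain ⟨A₀, hA₀, h₀⟩ := ih₀
    obtain ⟨A₁, hA₁, h₁⟩ := ih₁
    refine ⟨A₁ + (b + 1) * (2 * b + 1) * A₀, by positivity, fun j Z hZ hj =>
      (hermiteMoment_add_two_le j b).trans ?_⟩
    have hZ0 : 0 ≤ Z := zero_le_one.trans hZ
    have g₀ : hermiteMoment j b ≤ A₀ * Z ^ (2 * (b + 2)) :=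
      (h₀ j Z hZ hj).trans
        (mul_le_mul_of_nonneg_left (pow_le_pow_right₀ hZ (by omega)) hA₀)
    calc _ ≤ Z ^ 2 * (A₁ * Z ^ (2 * (b + 1))) +
          (b + 1) * (2 * b + 1) * (A₀ * Z ^ (2 * (b + 2))) := by
          refine add_le_add (mul_le_mul hj (h₁ j Z hZ hj) (hermiteMoment_nonneg _ _) (sq_nonneg _))
            (mul_le_mul_of_nonneg_left g₀ (by positivity))
      _ = _ := by ring

/-- The inequality `|w| ≤ ½(P/T + T w²/P)` with `T = 1 + t²` makes the first part integrable and the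
second a sum of two moments; `P = Z^b` balances the two. -/
lemma absGaussInt_le (j b : ℕ) {Z : ℝ} (hZ : 0 < Z) :
    absGaussInt (X ^ b * normHermiteC j) ≤
      1 / 2 * (Z ^ b * Real.pi + (hermiteMoment j b + hermiteMoment j (b + 1)) / Z ^ b) := by
  have hi1 : Integrable fun t : ℝ => (1 + t ^ 2)⁻¹ := integrable_inv_one_add_sq
  set q : ℝ[X] := X ^ (2 * b) * normHermite j ^ 2 + X ^ (2 * (b + 1)) * normHermite j ^ 2 with hq
  have hi2 := integrable_eval_mul_exp_neg_sq q
  have hm : hermiteMoment j b + hermiteMoment j (b + 1) =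
      ∫ t : ℝ, q.eval t * Real.exp (-t ^ 2) := by
    rw [← gaussMoment_apply, hq, map_add]; rfl
  rw [hm, ← integral_univ_inv_one_add_sq, ← integral_const_mul, ← integral_div,
    ← integral_add (hi1.const_mul _) (hi2.div_const _), ← integral_const_mul]
  refine integral_mono (integrable_norm_eval_mul_exp _)
    (((hi1.const_mul _).add (hi2.div_const _)).const_mul _) fun t => ?_
  have e : (X ^ b * normHermiteC j).eval (t : ℂ) =
      (((X ^ b * normHermite j).eval t : ℝ) : ℂ) := by
    simp only [eval_mul, eval_pow, eval_X, normHermiteC]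
    rw [show (t : ℂ) = Complex.ofRealHom t from rfl, eval_map_apply]
    push_cast
    rfl
  simp only [e, Complex.norm_real, Real.norm_eq_abs]
  set w := t ^ b * (normHermite j).eval t * Real.exp (-t ^ 2 / 2) with hw
  have h1 : |(X ^ b * normHermite j).eval t| * Real.exp (-t ^ 2 / 2) = |w| := by
    rw [hw, abs_mul, Real.abs_exp]; simp
  have h2 : q.eval t * Real.exp (-t ^ 2) = (1 + t ^ 2) * w ^ 2 := by
    rw [hw, mul_pow, ← Real.exp_nat_mul, hq]
    simp only [eval_add, eval_mul, eval_pow, eval_X]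
    rw [show ((2 : ℕ) : ℝ) * (-t ^ 2 / 2) = -t ^ 2 by push_cast; ring]
    ring
  rw [h1, h2]
  have hp : 0 < Z ^ b := by positivity
  have ht : 0 < 1 + t ^ 2 := by positivity
  set P := Z ^ b
  set T := 1 + t ^ 2
  rw [← sub_nonneg]
  have : 1 / 2 * (P * T⁻¹ + T * w ^ 2 / P) - |w| = 1 / 2 * (T / P) * (P / T - |w|) ^ 2 := by
    rw [← sq_abs w]
    field_simp
    ring
  rw [this]
  positivity

lemma exists_absGaussInt_le (b : ℕ) : ∃ A : ℝ, 0 ≤ A ∧ ∀ (j : ℕ) (Z : ℝ), 1 ≤ Z →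
    (4 * j + 1 : ℝ) ≤ Z ^ 2 → absGaussInt (X ^ b * normHermiteC j) ≤ A * Z ^ (b + 2) := by
  obtain ⟨A₀, hA₀, h₀⟩ := exists_hermiteMoment_le b
  obtain ⟨A₁, hA₁, h₁⟩ := exists_hermiteMoment_le (b + 1)
  refine ⟨1 / 2 * (Real.pi + (A₀ + A₁)), by positivity, fun j Z hZ hj => ?_⟩
  have hZ0 : 0 < Z := zero_lt_one.trans_le hZ
  refine (absGaussInt_le j b hZ0).trans ?_
  have g₀ : hermiteMoment j b ≤ A₀ * Z ^ (2 * (b + 1)) := (h₀ j Z hZ hj).trans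
    (mul_le_mul_of_nonneg_left (pow_le_pow_right₀ hZ (by omega)) hA₀)
  have g₁ := h₁ j Z hZ hj
  have g : (hermiteMoment j b + hermiteMoment j (b + 1)) / Z ^ b ≤ (A₀ + A₁) * Z ^ (b + 2) := by
    rw [div_le_iff₀ (by positivity)]
    calc _ ≤ _ := add_le_add g₀ g₁
      _ = _ := by ring
  have g2 : Z ^ b * Real.pi ≤ Real.pi * Z ^ (b + 2) := by
    rw [mul_comm]
    exact mul_le_mul_of_nonneg_left (pow_le_pow_right₀ hZ (by omega)) Real.pi_pos.le
  calc _ ≤ 1 / 2 * (Real.pi * Z ^ (b + 2) + (A₀ + A₁) * Z ^ (b + 2)) := by gcongr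
    _ = _ := by ring

end

end HiddenDirection

namespace HiddenDirection

noncomputable section

open Finset Polynomial MeasureTheory Filter

/-! ### The witness as a Gaussian integral -/

/-- The polynomial `∏ j, (1 + i x_j X / √n)`. -/
def rotPoly {n : ℕ} (x : Cube n) : ℂ[X] :=
  ((genPoly x).map Complex.ofRealHom).comp (C (Complex.I / √n) * X)

/-- The normalized sum `S(x) / √n`. -/
def normSum {n : ℕ} (x : Cube n) : ℝ := coordSum x / √n

lemma rotPoly_eval {n : ℕ} (x : Cube n) (z : ℂ) :
    (rotPoly x).eval z = ∏ i, (1 + sgn (x i) * (Complex.I / √n * z)) := by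
  rw [rotPoly, eval_comp, genPoly, Polynomial.map_prod, eval_prod]
  simp

lemma rotPoly_eval_zero {n : ℕ} (x : Cube n) : (rotPoly x).eval 0 = 1 := by simp [rotPoly_eval]

lemma rotPoly_eq_sum {n : ℕ} (x : Cube n) :
    rotPoly x = ∑ d ∈ range (n + 1), C (esum d x * (Complex.I / √n) ^ d) * X ^ d := by
  ext d
  rw [rotPoly, comp_C_mul_X_coeff, coeff_map, coeff_genPoly, finsetSum_coeff]
  simp only [coeff_C_mul, coeff_X_pow, mul_ite, mul_one, mul_zero]
  rw [sum_ite_eq]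
  split_ifs with h
  · rfl
  · rw [mem_range] at h
    rw [esum, powersetCard_eq_empty.2 (by simp; omega)]
    simp

/-- The equation of the generating polynomial under the substitution `X ↦ iX/√n`. As `n → ∞` it
becomes that of `exp(ist + t²/2)`. -/
lemma derivative_rotPoly {n : ℕ} (hn : 0 < n) (x : Cube n) :
    (1 + C (1 / n : ℂ) * X ^ 2) * derivative (rotPoly x) =
      (C (Complex.I * normSum x) + X) * rotPoly x := by
  have h := congrArg (fun p : ℝ[X] => (p.map Complex.ofRealHom).comp (C (Complex.I / √n) * X))
    (one_sub_X_sq_mul_derivative_genPoly x)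
  simp only [Polynomial.map_mul, Polynomial.map_sub, Polynomial.map_one, Polynomial.map_pow, map_X,
    map_C, mul_comp, sub_comp, one_comp, pow_comp, X_comp, C_comp, Polynomial.map_natCast,
    natCast_comp] at h
  have hs : ((√n : ℝ) : ℂ) ≠ 0 := by
    rw [Complex.ofReal_ne_zero]; positivity
  have hs2 : ((√n : ℝ) : ℂ) ^ 2 = n := by
    rw [← Complex.ofReal_pow, Real.sq_sqrt (by positivity)]; simp
  have hn0 : (n : ℂ) ≠ 0 := by exact_mod_cast hn.ne'
  have hc1 : (Complex.I / √n) * (Complex.I / √n) = -(1 / n) := by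
    rw [← hs2, div_mul_div_comm, Complex.I_mul_I]; ring
  have hc2 : (n : ℂ) * ((Complex.I / √n) * (Complex.I / √n)) = -1 := by
    rw [hc1]; field_simp
  have hc3 : (Complex.I / √n) * coordSum x = Complex.I * normSum x := by
    rw [normSum]; push_cast; ring
  have e1 := congrArg (C : ℂ → ℂ[X]) hc1
  have e2 := congrArg (C : ℂ → ℂ[X]) hc2
  have e3 := congrArg (C : ℂ → ℂ[X]) hc3
  simp only [map_mul, map_neg, map_one, map_natCast] at e1 e2 e3
  rw [rotPoly, derivative_comp, derivative_C_mul_X, derivative_map]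
  set D := (Polynomial.map Complex.ofRealHom (derivative (genPoly x))).comp (C (Complex.I / √n) * X)
  set G := (Polynomial.map Complex.ofRealHom (genPoly x)).comp (C (Complex.I / √n) * X)
  set c : ℂ[X] := C (Complex.I / √n)
  have e4 : Complex.ofRealHom (coordSum x) = (coordSum x : ℂ) := rfl
  rw [e4] at h
  rw [map_mul, ← e3]
  linear_combination c * h + X ^ 2 * D * c * e1 + (-(X * G)) * e2

/-- Even powers of `t` in the expanded product pair to zero with `t` times an even Hermite
polynomial; the odd ones reproduce the coefficients of the witness with `j = k + 1`. -/
lemma gaussInt_mul_rotPoly {n h : ℕ} (hn : n = 2 * h + 1) (k : ℕ) (x : Cube n) :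
    gaussInt one_pos 0 (X * normHermiteC (k + 1) * rotPoly x) =
      2 * Complex.I * avgWitness k n x := by
  have hterm : ∀ d : ℕ, X * normHermiteC (k + 1) *
      (C (esum d x * (Complex.I / √n) ^ d) * X ^ d) =
        (esum d x * (Complex.I / √n) ^ d : ℂ) • (X ^ (d + 1) * normHermiteC (k + 1)) := by
    intro d
    rw [smul_eq_C_mul]
    ring
  rw [avgWitness_eq hn, rotPoly_eq_sum, mul_sum, map_sum,
    show n + 1 = 2 * (h + 1) by omega, sum_range_two_mul]
  push_cast
  rw [mul_sum]
  refine sum_congr rfl fun r _ => ?_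
  rw [hterm, hterm, map_smul, map_smul, gaussInt_X_pow_odd_mul_normHermiteC,
    show 2 * r + 1 + 1 = 2 * (r + 1) by ring, gaussInt_X_pow_even_mul_normHermiteC, witnessCoeff,
    show (((r + 1 : ℕ) : ℝ) + 1 / 2) = r + 3 / 2 by push_cast; ring]
  have hI : (Complex.I / √n) ^ (2 * r + 1) = (-1) ^ r * Complex.I / (√n : ℂ) ^ (2 * r + 1) := by
    rw [div_pow, pow_succ Complex.I, pow_mul, Complex.I_sq]
  rw [hI]
  push_cast
  simp only [smul_eq_mul]
  ring

/-- The squared modulus of each factor has the form `1 + y`, and `1 + y ≤ e^y`. -/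
lemma norm_rotPoly_eval_le {n : ℕ} (hn : 0 < n) (x : Cube n) (t σ : ℝ) :
    ‖(rotPoly x).eval (t + σ * Complex.I)‖ ≤ Real.exp (-σ * normSum x + (σ ^ 2 + t ^ 2) / 2) := by
  refine le_of_sq_le_sq ?_ (Real.exp_nonneg _)
  have hs : (√n : ℝ) ≠ 0 := by positivity
  have hs2 : (√n : ℝ) ^ 2 = n := Real.sq_sqrt (by positivity)
  have h : ∀ i, ‖1 + (sgn (x i) : ℂ) * (Complex.I / √n * (t + σ * Complex.I))‖ ^ 2 ≤
      Real.exp (-2 * σ * (sgn (x i) / √n) + (σ ^ 2 + t ^ 2) / n) := by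
    intro i
    have e : (1 + (sgn (x i) : ℂ) * (Complex.I / √n * (t + σ * Complex.I))) =
        ((1 - sgn (x i) * σ / √n : ℝ) : ℂ) + ((sgn (x i) * t / √n : ℝ) : ℂ) * Complex.I := by
      push_cast
      linear_combination (sgn (x i) * σ / √n : ℂ) * Complex.I_sq
    rw [e, Complex.sq_norm, Complex.normSq_add_mul_I]
    have h1 := Real.add_one_le_exp (-2 * σ * (sgn (x i) / √n) + (σ ^ 2 + t ^ 2) / n)
    refine le_trans (le_of_eq ?_) h1
    have h2 := sgn_mul_self (x i)
    rw [show (σ ^ 2 + t ^ 2) / (n : ℝ) = (σ ^ 2 + t ^ 2) / √n ^ 2 by rw [hs2]]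
    field_simp
    linear_combination (σ ^ 2 + t ^ 2) * h2
  rw [rotPoly_eval, norm_prod, ← prod_pow, ← Real.exp_nat_mul]
  refine (prod_le_prod (fun _ _ => sq_nonneg _) fun i _ => h i).trans_eq ?_
  rw [← Real.exp_sum, sum_add_distrib, ← mul_sum, ← sum_div, sum_const, card_univ,
    Fintype.card_fin, nsmul_eq_mul, normSum, coordSum]
  congr 1
  have : (n : ℝ) ≠ 0 := by positivity
  push_cast
  field_simp

end

end HiddenDirection

namespace HiddenDirection

noncomputable section

open Finset Polynomial MeasureTheory Filter

/-! ### Shifting the contour -/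

/-- The integration-by-parts rule determines all moments from the zeroth one. Applied to a
difference of two functionals it proves the contour shift purely algebraically. -/
lemma eq_zero_of_map_derivative (f : ℂ[X] →ₗ[ℂ] ℂ) (hf : ∀ p, f (derivative p) = f (2 * X * p))
    (h1 : f 1 = 0) (p : ℂ[X]) : f p = 0 := by
  have h2 : ∀ q : ℂ[X], f (2 * X * q) = 2 * f (X * q) := fun q => by
    rw [← smul_eq_mul (2 : ℂ), ← map_smul, smul_eq_C_mul, C_ofNat, mul_assoc]
  have hX : ∀ m : ℕ, f (X ^ m) = 0 := by
    intro m
    induction m using Nat.twoStepInduction with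
    | zero => simpa using h1
    | one =>
      have := hf 1
      rw [derivative_one, map_zero, h2, mul_one] at this
      simpa using this.symm
    | more m ih _ =>
      have := hf (X ^ (m + 1))
      rw [derivative_X_pow, ← smul_eq_C_mul, map_smul, Nat.add_sub_cancel, ih, smul_zero, h2,
        ← pow_succ'] at this
      simpa using this.symm
  induction p using Polynomial.induction_on' with
  | add p q hp hq => rw [map_add, hp, hq, add_zero]
  | monomial m a => rw [← C_mul_X_pow_eq_monomial, ← smul_eq_C_mul, map_smul, hX, smul_zero]

/-- The functional `p ↦ exp (σ²) ∫ p(t + iσ) exp (-t² - 2iσt) dt`. -/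
def shiftedGaussInt (σ : ℝ) : ℂ[X] →ₗ[ℂ] ℂ where
  toFun p := Complex.exp (σ ^ 2) *
    gaussInt one_pos (-2 * Complex.I * σ) (p.comp (X + C (Complex.I * σ)))
  map_add' p q := by rw [add_comp, map_add, mul_add]
  map_smul' a p := by
    rw [smul_comp, map_smul]
    simp only [smul_eq_mul, RingHom.id_apply]
    ring

lemma shiftedGaussInt_apply (σ : ℝ) (p : ℂ[X]) : shiftedGaussInt σ p = Complex.exp (σ ^ 2) *
    gaussInt one_pos (-2 * Complex.I * σ) (p.comp (X + C (Complex.I * σ))) := rfl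

lemma gaussInt_eq_shiftedGaussInt (σ : ℝ) (p : ℂ[X]) :
    gaussInt one_pos 0 p = shiftedGaussInt σ p := by
  rw [← sub_eq_zero]
  refine eq_zero_of_map_derivative (gaussInt one_pos 0 - shiftedGaussInt σ) (fun p => ?_) ?_ p
  · rw [LinearMap.sub_apply, LinearMap.sub_apply, gaussInt_derivative, shiftedGaussInt_apply,
      shiftedGaussInt_apply]
    have h := gaussInt_derivative one_pos (-2 * Complex.I * σ) (p.comp (X + C (Complex.I * σ)))
    rw [derivative_comp, derivative_add, derivative_X, derivative_C, add_zero, one_mul] at h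
    rw [h]
    congr 3
    · simp [C_ofNat]
    · simp only [mul_comp, X_comp, map_mul, map_neg, ofNat_comp]
      congr 1
      simp [C_ofNat]
      ring
  · rw [LinearMap.sub_apply, gaussInt_one_zero_one, shiftedGaussInt_apply, one_comp, gaussInt_apply]
    have h := integral_cexp_quadratic (b := -1) (by simp) (-2 * Complex.I * σ) 0
    have e : ∀ t : ℝ, (1 : ℂ[X]).eval (t : ℂ) *
        Complex.exp (-((1 : ℝ) : ℂ) * (t : ℂ) ^ 2 + -2 * Complex.I * σ * t) =
          Complex.exp (-1 * (t : ℂ) ^ 2 + -2 * Complex.I * σ * t + 0) := fun t => by simp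
    simp only [e]
    rw [h, neg_neg, div_one, mul_left_comm, ← Complex.exp_add]
    rw [show ((σ : ℂ) ^ 2 + (0 - (-2 * Complex.I * σ) ^ 2 / (4 * -1))) = 0 by
      linear_combination (σ : ℂ) ^ 2 * Complex.I_sq, Complex.exp_zero, mul_one, sub_eq_zero,
      Real.sqrt_eq_rpow, Complex.ofReal_cpow Real.pi_pos.le]
    simp

lemma norm_gaussInt_le_of_shift (σ : ℝ) (p : ℂ[X]) : ‖gaussInt one_pos 0 p‖ ≤
    ∫ t : ℝ, ‖p.eval (t + σ * Complex.I)‖ * Real.exp (σ ^ 2 - t ^ 2) := by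
  rw [gaussInt_eq_shiftedGaussInt σ, shiftedGaussInt_apply, gaussInt_apply, ← integral_const_mul]
  refine (norm_integral_le_integral_norm _).trans_eq ?_
  refine integral_congr_ae (Eventually.of_forall fun t => ?_)
  simp only [norm_mul, eval_comp, eval_add, eval_X, eval_C, Complex.norm_exp]
  rw [mul_left_comm, ← Real.exp_add, mul_comm Complex.I]
  congr 2
  simp [← Complex.ofReal_pow]
  ring

/-- From the three-term recurrence, with `√(2M)` chosen so that its square dominates every
coefficient `2(m+1)` that occurs. -/
lemma norm_eval_physHermite_le (M : ℕ) (z : ℂ) : ∀ m ≤ M,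
    ‖((physHermite m).map Complex.ofRealHom).eval z‖ ≤ (2 * ‖z‖ + √(2 * M)) ^ m := by
  intro m
  induction m using Nat.twoStepInduction with
  | zero => simp [physHermite]
  | one =>
    intro _
    simp [physHermite]
  | more m ih₀ ih₁ =>
    intro hm
    have g₀ := ih₀ (by omega)
    have g₁ := ih₁ (by omega)
    have e : ((physHermite (m + 2)).map Complex.ofRealHom).eval z =
        2 * z * ((physHermite (m + 1)).map Complex.ofRealHom).eval z -
          (2 * (m + 1) : ℝ) * ((physHermite m).map Complex.ofRealHom).eval z := by
      rw [physHermite_add_two]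
      simp
    set q := √(2 * M) with hq
    have hq0 : 0 ≤ q := Real.sqrt_nonneg _
    have hq2 : (2 * (m + 1) : ℝ) ≤ q ^ 2 := by
      rw [hq, Real.sq_sqrt (by positivity)]
      have : ((m + 2 : ℕ) : ℝ) ≤ M := by exact_mod_cast hm
      push_cast at this
      linarith
    rw [e]
    refine (norm_sub_le _ _).trans ?_
    rw [norm_mul, norm_mul, norm_mul, Complex.norm_real, Real.norm_eq_abs,
      abs_of_nonneg (by positivity), Complex.norm_ofNat]
    have hz := norm_nonneg z
    have hp : 0 ≤ (2 * ‖z‖ + q) ^ m := by positivity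
    calc _ ≤ 2 * ‖z‖ * (2 * ‖z‖ + q) ^ (m + 1) + q ^ 2 * (2 * ‖z‖ + q) ^ m := by gcongr
      _ ≤ (2 * ‖z‖ + q) ^ (m + 2) := by
        have : 0 ≤ 2 * ‖z‖ * q * (2 * ‖z‖ + q) ^ m := by positivity
        rw [pow_succ, pow_add]
        nlinarith

lemma norm_eval_normHermiteC_le (j : ℕ) (z : ℂ) :
    ‖(normHermiteC j).eval z‖ ≤ Real.exp (4 * j + ‖z‖ ^ 2 / 4) := by
  have h := norm_eval_physHermite_le (2 * j) z (2 * j) le_rfl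
  have hz := norm_nonneg z
  have hs : √(2 * ((2 * j : ℕ) : ℝ)) = 2 * √j := by
    rw [show (2 * ((2 * j : ℕ) : ℝ)) = 2 ^ 2 * j by push_cast; ring,
      Real.sqrt_mul (by positivity), Real.sqrt_sq (by norm_num)]
  have hj : √(j : ℝ) ^ 2 = j := Real.sq_sqrt (by positivity)
  rw [hs, ← mul_add, mul_pow, pow_mul, pow_mul, show (2 : ℝ) ^ 2 = 4 by norm_num] at h
  have h1 : ‖(normHermiteC j).eval z‖ ≤ ((‖z‖ + √j) ^ 2) ^ j / j.factorial := by
    rw [normHermiteC, normHermite, Polynomial.map_mul, map_C, eval_mul, eval_C, norm_mul]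
    have e : ‖Complex.ofRealHom (1 / (4 ^ j * j.factorial))‖ = 1 / (4 ^ j * j.factorial) := by
      simp
    rw [e, div_mul_eq_mul_div, one_mul, div_le_div_iff₀ (by positivity) (by positivity)]
    calc _ ≤ 4 ^ j * ((‖z‖ + √j) ^ 2) ^ j * j.factorial := by gcongr
      _ = _ := by ring
  have h2 : (‖z‖ + √j) ^ 2 ≤ 2 * ‖z‖ ^ 2 + 2 * j := by nlinarith [sq_nonneg (‖z‖ - √j)]
  have h3 := Real.pow_div_factorial_le_exp (((2 * ‖z‖ ^ 2 + 2 * j)) / 8) (by positivity) j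
  have h8 : (8 : ℝ) ≤ Real.exp 3 := by
    have := Real.exp_one_gt_d9
    rw [show (3 : ℝ) = ((3 : ℕ) : ℝ) * 1 by norm_num, Real.exp_nat_mul]
    nlinarith [pow_le_pow_left₀ (by norm_num) this.le 3]
  have h9 : (8 : ℝ) ^ j ≤ Real.exp (3 * j) := by
    rw [mul_comm, Real.exp_nat_mul]
    exact pow_le_pow_left₀ (by norm_num) h8 j
  calc _ ≤ _ := h1
    _ ≤ (2 * ‖z‖ ^ 2 + 2 * j) ^ j / j.factorial := by gcongr
    _ = 8 ^ j * (((2 * ‖z‖ ^ 2 + 2 * j) / 8) ^ j / j.factorial) := by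
      rw [div_pow]; field_simp
    _ ≤ Real.exp (3 * j) * Real.exp ((2 * ‖z‖ ^ 2 + 2 * j) / 8) := by gcongr
    _ ≤ _ := by
      rw [← Real.exp_add, Real.exp_le_exp]
      have : (0 : ℝ) ≤ j := by positivity
      linarith

/-- The witness is bounded at points whose normalized sum is large. -/
lemma exists_abs_avgWitness_le_of_large : ∃ K : ℝ, 0 ≤ K ∧ ∀ (n h k : ℕ), n = 2 * h + 1 →
    ∀ x : Cube n, 4 * √(4 * k + 5) ≤ |normSum x| → |avgWitness k n x| ≤ K := by
  have hi : Integrable fun t : ℝ => (|t| + 1) * Real.exp (-(1 / 4) * t ^ 2) := by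
    have h1 := (integrable_mul_exp_neg_mul_sq (b := 1 / 4) (by norm_num)).abs
    have h2 := integrable_exp_neg_mul_sq (b := 1 / 4) (by norm_num)
    refine (h1.add h2).congr (Eventually.of_forall fun t => ?_)
    simp only [Pi.add_apply, abs_mul, Real.abs_exp]
    ring
  refine ⟨∫ t : ℝ, (|t| + 1) * Real.exp (-(1 / 4) * t ^ 2),
    integral_nonneg fun t => by positivity, fun n h k hn x hx => ?_⟩
  set lam : ℝ := 4 * k + 5 with hlam
  have hlam0 : 0 < lam := by positivity
  have hsq : √lam ^ 2 = lam := Real.sq_sqrt hlam0.le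
  -- The shift has size `√λ` and the sign of the normalized sum. The other factors contribute in
  -- total less than `(1 + 1 + 1/4 + 1/2 + 1)λ = 3.75λ` to the exponent, which the gain `σ · s ≥ 4λ`
  -- beats; the coefficient of `t²` is `1/4 + 1/2 - 1 = -1/4`.
  obtain ⟨σ, hσ, hσs⟩ : ∃ σ : ℝ, σ ^ 2 = lam ∧ 4 * lam ≤ σ * normSum x := by
    rcases abs_cases (normSum x) with ⟨h1, _⟩ | ⟨h1, _⟩ <;> rw [h1] at hx
    · exact ⟨√lam, hsq, by nlinarith [Real.sqrt_nonneg lam]⟩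
    · exact ⟨-√lam, by rw [neg_sq, hsq], by nlinarith [Real.sqrt_nonneg lam]⟩
  have hI := gaussInt_mul_rotPoly hn k x
  have hb := norm_gaussInt_le_of_shift σ (X * normHermiteC (k + 1) * rotPoly x)
  rw [hI] at hb
  have e : ‖2 * Complex.I * (avgWitness k n x : ℂ)‖ = 2 * |avgWitness k n x| := by
    simp
  rw [e] at hb
  suffices hle : ∫ t : ℝ, ‖(X * normHermiteC (k + 1) * rotPoly x).eval (t + σ * Complex.I)‖ *
      Real.exp (σ ^ 2 - t ^ 2) ≤ ∫ t : ℝ, (|t| + 1) * Real.exp (-(1 / 4) * t ^ 2) by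
    have := abs_nonneg (avgWitness k n x)
    linarith
  refine integral_mono_of_nonneg (Eventually.of_forall fun t => by positivity) hi
    (Eventually.of_forall fun t => ?_)
  have hnz : ‖(t : ℂ) + σ * Complex.I‖ ^ 2 = t ^ 2 + lam := by
    rw [Complex.sq_norm, Complex.normSq_add_mul_I, hσ]
  have h1 : ‖(t : ℂ) + σ * Complex.I‖ ≤ |t| + lam := by
    refine (norm_add_le _ _).trans ?_
    simp only [norm_mul, Complex.norm_real, Complex.norm_I, Real.norm_eq_abs, mul_one]
    have h5 : |σ| ≤ lam := by
      refine le_of_sq_le_sq ?_ hlam0.le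
      rw [sq_abs, hσ]
      have : (0 : ℝ) ≤ k := by positivity
      nlinarith
    linarith
  have h2 := norm_eval_normHermiteC_le (k + 1) ((t : ℂ) + σ * Complex.I)
  have h3 := norm_rotPoly_eval_le (show 0 < n by omega) x t σ
  rw [hnz] at h2
  rw [hσ] at h3
  have hlam1 : 1 ≤ lam := by
    have : (0 : ℝ) ≤ k := by positivity
    linarith
  have h4 : |t| + lam ≤ (|t| + 1) * Real.exp lam := by
    have h6 := Real.add_one_le_exp lam
    nlinarith [abs_nonneg t]
  simp only [eval_mul, eval_X, norm_mul]
  calc _ ≤ (|t| + 1) * Real.exp lam * Real.exp (4 * ((k + 1 : ℕ) : ℝ) + (t ^ 2 + lam) / 4) *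
        Real.exp (-σ * normSum x + (lam + t ^ 2) / 2) * Real.exp (σ ^ 2 - t ^ 2) := by
        gcongr
        exact h1.trans h4
    _ ≤ _ := by
      rw [mul_assoc, mul_assoc, mul_assoc, ← Real.exp_add, ← Real.exp_add, ← Real.exp_add]
      refine mul_le_mul_of_nonneg_left (Real.exp_le_exp.2 ?_) (by positivity)
      rw [hσ]
      push_cast
      linarith

end

end HiddenDirection

namespace HiddenDirection

noncomputable section

open Finset Polynomial MeasureTheory Filter

/-! ### The expansion of the characteristic polynomial around the Gaussian -/

/-- The antiderivative of a polynomial vanishing at `0`. -/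
def polyInt (p : ℂ[X]) : ℂ[X] := p.sum fun i a => C (a / (i + 1)) * X ^ (i + 1)

lemma coeff_polyInt_zero (p : ℂ[X]) : (polyInt p).coeff 0 = 0 := by
  rw [polyInt, Polynomial.sum, finsetSum_coeff]
  refine sum_eq_zero fun i _ => ?_
  rw [coeff_C_mul, coeff_X_pow, if_neg (by omega), mul_zero]

lemma coeff_polyInt_succ (p : ℂ[X]) (i : ℕ) :
    (polyInt p).coeff (i + 1) = p.coeff i / (i + 1) := by
  rw [polyInt, Polynomial.sum, finsetSum_coeff]
  simp only [coeff_C_mul, coeff_X_pow, add_left_inj, mul_ite, mul_one, mul_zero]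
  rw [sum_ite_eq]
  split_ifs with h
  · rfl
  · rw [notMem_support_iff.1 h, zero_div]

lemma derivative_polyInt (p : ℂ[X]) : derivative (polyInt p) = p := by
  ext i
  rw [coeff_derivative, coeff_polyInt_succ, div_mul_cancel₀]
  exact_mod_cast Nat.succ_ne_zero i

lemma eval_zero_polyInt (p : ℂ[X]) : (polyInt p).eval 0 = 0 := by
  rw [← coeff_zero_eq_eval_zero, coeff_polyInt_zero]

/-- A polynomial of degree at most `D` whose coefficients `c_i` satisfy `‖c_i‖ Z^i ≤ M Z^D`. -/
def CoeffBound (Z : ℝ) (D : ℕ) (M : ℝ) (p : ℂ[X]) : Prop :=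
  p.natDegree ≤ D ∧ ∀ i, ‖p.coeff i‖ * Z ^ i ≤ M * Z ^ D

namespace CoeffBound

variable {Z M M' : ℝ} {D D' : ℕ} {p q : ℂ[X]}

lemma nonneg (hZ : 1 ≤ Z) (h : CoeffBound Z D M p) : 0 ≤ M := by
  have h1 := (mul_nonneg (norm_nonneg (p.coeff 0)) (by positivity)).trans (h.2 0)
  exact nonneg_of_mul_nonneg_left h1 (by positivity)

lemma one : CoeffBound Z 0 1 1 := by
  refine ⟨by simp, fun i => ?_⟩
  rcases i with _ | i <;> simp [coeff_one]

lemma mono (hZ : 1 ≤ Z) (hD : D ≤ D') (h : CoeffBound Z D M p) : CoeffBound Z D' M p :=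
  ⟨h.1.trans hD, fun i => (h.2 i).trans
    (mul_le_mul_of_nonneg_left (pow_le_pow_right₀ hZ hD) (h.nonneg hZ))⟩

lemma add (hZ : 1 ≤ Z) (hp : CoeffBound Z D M p) (hq : CoeffBound Z D M' q) :
    CoeffBound Z D (M + M') (p + q) := by
  refine ⟨(natDegree_add_le _ _).trans (max_le hp.1 hq.1), fun i => ?_⟩
  rw [coeff_add, add_mul]
  refine le_trans ?_ (add_le_add (hp.2 i) (hq.2 i))
  rw [← add_mul]
  exact mul_le_mul_of_nonneg_right (norm_add_le _ _) (by positivity)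

lemma neg (hp : CoeffBound Z D M p) : CoeffBound Z D M (-p) := by
  refine ⟨by rw [natDegree_neg]; exact hp.1, fun i => ?_⟩
  rw [coeff_neg, norm_neg]
  exact hp.2 i

lemma X_mul (hZ : 1 ≤ Z) (hp : CoeffBound Z D M p) : CoeffBound Z (D + 1) M (X * p) := by
  have hM := hp.nonneg hZ
  refine ⟨natDegree_mul_le.trans ?_, fun i => ?_⟩
  · have := natDegree_X_le (R := ℂ)
    have := hp.1
    omega
  · rcases i with _ | i
    · simp only [mul_coeff_zero, coeff_X_zero, zero_mul, norm_zero]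
      positivity
    · rw [coeff_X_mul, pow_succ, pow_succ, ← mul_assoc, ← mul_assoc]
      exact mul_le_mul_of_nonneg_right (hp.2 i) (by positivity)

lemma C_mul (hZ : 1 ≤ Z) {a : ℂ} (ha : ‖a‖ ≤ Z) (hp : CoeffBound Z D M p) :
    CoeffBound Z (D + 1) M (C a * p) := by
  refine ⟨(natDegree_C_mul_le _ _).trans (hp.1.trans (Nat.le_succ _)), fun i => ?_⟩
  rw [coeff_C_mul, norm_mul, mul_assoc, show M * Z ^ (D + 1) = Z * (M * Z ^ D) by ring]
  exact mul_le_mul ha (hp.2 i) (by positivity) (by positivity)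

lemma X_mul_derivative (hZ : 1 ≤ Z) (hp : CoeffBound Z D M p) :
    CoeffBound Z D (D * M) (X * derivative p) := by
  have hM := hp.nonneg hZ
  have hc : ∀ i, (X * derivative p).coeff i = i * p.coeff i := by
    intro i
    rcases i with _ | i
    · simp
    · rw [coeff_X_mul, coeff_derivative]
      push_cast
      ring
  refine ⟨natDegree_le_iff_coeff_eq_zero.2 fun i hi => ?_, fun i => ?_⟩
  · rw [hc, coeff_eq_zero_of_natDegree_lt (hp.1.trans_lt hi), mul_zero]
  · rw [hc]
    rcases le_or_gt i D with h | h
    · rw [norm_mul, Complex.norm_natCast, mul_assoc, mul_assoc]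
      exact mul_le_mul (by exact_mod_cast h) (hp.2 i) (by positivity) (by positivity)
    · rw [coeff_eq_zero_of_natDegree_lt (hp.1.trans_lt h), mul_zero, norm_zero, zero_mul]
      positivity

lemma polyInt (hZ : 1 ≤ Z) (hp : CoeffBound Z D M p) :
    CoeffBound Z (D + 1) M (polyInt p) := by
  have hM := hp.nonneg hZ
  refine ⟨natDegree_le_iff_coeff_eq_zero.2 fun i hi => ?_, fun i => ?_⟩
  · obtain ⟨i, rfl⟩ : ∃ l, i = l + 1 := ⟨i - 1, by omega⟩
    rw [coeff_polyInt_succ, coeff_eq_zero_of_natDegree_lt (hp.1.trans_lt (by omega)), zero_div]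
  · rcases i with _ | i
    · rw [coeff_polyInt_zero, norm_zero, zero_mul]
      positivity
    · rw [coeff_polyInt_succ, pow_succ, pow_succ, ← mul_assoc, ← mul_assoc]
      refine mul_le_mul_of_nonneg_right (le_trans ?_ (hp.2 i)) (by positivity)
      refine mul_le_mul_of_nonneg_right ?_ (by positivity)
      rw [norm_div]
      refine div_le_self (norm_nonneg _) ?_
      rw [← Nat.cast_succ, Complex.norm_natCast]
      exact_mod_cast Nat.succ_le_succ (Nat.zero_le i)

end CoeffBound

/-- The polynomial coefficients of the expansion of `P(t) exp (-at - t²/2)` in powers of `1/n`. -/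
def edgePoly (a : ℂ) : ℕ → ℂ[X]
  | 0 => 1
  | q + 1 => polyInt (-(X * (X * derivative (edgePoly a q))) +
      -(X * (X * (C a * edgePoly a q + X * edgePoly a q))))

lemma derivative_edgePoly_succ (a : ℂ) (q : ℕ) : derivative (edgePoly a (q + 1)) =
    -(X * (X * derivative (edgePoly a q))) +
      -(X * (X * (C a * edgePoly a q + X * edgePoly a q))) := by
  rw [edgePoly, derivative_polyInt]

/-- Each order multiplies by at most two factors `t`, one factor `a` or `t`, and one integration,
hence the growth `Z⁴` per order that is later compared with `n`. -/
lemma exists_coeffBound_edgePoly (q : ℕ) : ∃ M : ℝ, 0 ≤ M ∧ ∀ (Z : ℝ) (a : ℂ), 1 ≤ Z → ‖a‖ ≤ Z →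
    CoeffBound Z (4 * q) M (edgePoly a q) := by
  induction q with
  | zero => exact ⟨1, zero_le_one, fun Z a _ _ => CoeffBound.one⟩
  | succ q ih =>
    obtain ⟨M, hM, h⟩ := ih
    refine ⟨(4 * q : ℕ) * M + (M + M), by positivity, fun Z a hZ ha => ?_⟩
    have h0 := h Z a hZ ha
    refine CoeffBound.polyInt (D := 4 * q + 3) hZ (CoeffBound.add hZ ?_ ?_)
    · exact (((h0.X_mul_derivative hZ).X_mul hZ).mono hZ (by omega)).neg
    · exact (((CoeffBound.add hZ (h0.C_mul hZ ha) (h0.X_mul hZ)).X_mul hZ).X_mul hZ).neg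

/-- The partial sums of the expansion. -/
def edgeSum (a : ℂ) (e : ℝ) (Q : ℕ) : ℂ[X] := ∑ q ∈ range Q, C ((e : ℂ) ^ q) * edgePoly a q

/-- The edge polynomials solve the equation of `gaussRatio` order by order in `e = 1/n`, so
truncation leaves only the last order as a residual. -/
lemma edgeSum_ode (a : ℂ) (e : ℝ) (Q : ℕ) :
    (1 + C (e : ℂ) * X ^ 2) * derivative (edgeSum a e Q) +
      C (e : ℂ) * X ^ 2 * (C a + X) * edgeSum a e Q =
        -(C ((e : ℂ) ^ Q) * derivative (edgePoly a Q)) := by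
  induction Q with
  | zero => simp [edgeSum, edgePoly]
  | succ Q ih =>
    have e1 : edgeSum a e (Q + 1) = edgeSum a e Q + C ((e : ℂ) ^ Q) * edgePoly a Q := by
      rw [edgeSum, sum_range_succ]; rfl
    rw [e1, derivative_edgePoly_succ, derivative_add, derivative_C_mul,
      show C ((e : ℂ) ^ (Q + 1)) = C ((e : ℂ) ^ Q) * C (e : ℂ) by rw [pow_succ, C_mul]]
    linear_combination ih

lemma edgeSum_eval_zero (a : ℂ) (e : ℝ) {Q : ℕ} (hQ : 1 ≤ Q) : (edgeSum a e Q).eval 0 = 1 := by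
  obtain ⟨Q, rfl⟩ := Nat.exists_eq_add_of_le' hQ
  rw [edgeSum, sum_range_succ', eval_add, eval_finsetSum, sum_eq_zero]
  · simp [edgePoly]
  · intro q _
    rw [eval_mul, edgePoly, eval_zero_polyInt, mul_zero]

lemma norm_derivative_eval_le {p : ℂ[X]} {D : ℕ} (hD : p.natDegree ≤ D) {u : ℂ} {τ : ℝ}
    (hu : ‖u‖ ≤ τ) :
    ‖(derivative p).eval u‖ ≤ ∑ i ∈ range (D + 1), i * ‖p.coeff i‖ * τ ^ (i - 1) := by
  rw [derivative_eval, p.sum_over_range' (fun i => by simp) (D + 1) (by omega)]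
  refine (norm_sum_le _ _).trans (sum_le_sum fun i _ => ?_)
  rw [norm_mul, norm_mul, norm_pow, Complex.norm_natCast, mul_comm ‖p.coeff i‖]
  gcongr

lemma norm_rotPoly_eval_ofReal_sq {n : ℕ} (x : Cube n) (t : ℝ) :
    ‖(rotPoly x).eval (t : ℂ)‖ ^ 2 = (1 + t ^ 2 / n) ^ n := by
  rw [rotPoly_eval, norm_prod, ← prod_pow]
  have h : ∀ i, ‖1 + (sgn (x i) : ℂ) * (Complex.I / √n * t)‖ ^ 2 = 1 + t ^ 2 / n := by
    intro i
    have e : (1 + (sgn (x i) : ℂ) * (Complex.I / √n * t)) =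
        ((1 : ℝ) : ℂ) + ((sgn (x i) * t / √n : ℝ) : ℂ) * Complex.I := by
      push_cast
      ring
    rw [e, Complex.sq_norm, Complex.normSq_add_mul_I, div_pow, Real.sq_sqrt (by positivity), mul_pow,
      sq (sgn _), sgn_mul_self]
    ring
  simp [h]

/-- The ratio of the rotated polynomial and the Gaussian. -/
def gaussRatio {n : ℕ} (x : Cube n) (t : ℝ) : ℂ :=
  (rotPoly x).eval (t : ℂ) * Complex.exp (-(Complex.I * normSum x * t) - (t : ℂ) ^ 2 / 2)

lemma norm_gaussRatio_sq {n : ℕ} (hn : 0 < n) (x : Cube n) (t : ℝ) :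
    ‖gaussRatio x t‖ ^ 2 = ((1 + t ^ 2 / n) * Real.exp (-(t ^ 2 / n))) ^ n := by
  have hn0 : (n : ℝ) ≠ 0 := by positivity
  rw [gaussRatio, norm_mul, mul_pow, norm_rotPoly_eval_ofReal_sq, mul_pow, Complex.norm_exp,
    ← Real.exp_nat_mul, ← Real.exp_nat_mul]
  congr 2
  simp [← Complex.ofReal_pow]
  field_simp

lemma norm_gaussRatio_pos {n : ℕ} (hn : 0 < n) (x : Cube n) (t : ℝ) : 0 < ‖gaussRatio x t‖ := by
  have h : 0 < ‖gaussRatio x t‖ ^ 2 := by rw [norm_gaussRatio_sq hn]; positivity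
  refine norm_pos_iff.2 fun h0 => ?_
  simp [h0] at h

/-- The squared modulus is `((1+v)e^{-v})^n` with `v = t²/n`, and `(1+v)e^{-v}` decreases for `v ≥
0`. -/
lemma norm_gaussRatio_le {n : ℕ} (hn : 0 < n) (x : Cube n) {t u : ℝ} (h : |u| ≤ |t|) :
    ‖gaussRatio x t‖ ≤ ‖gaussRatio x u‖ := by
  refine le_of_sq_le_sq ?_ (norm_nonneg _)
  rw [norm_gaussRatio_sq hn, norm_gaussRatio_sq hn]
  refine pow_le_pow_left₀ (by positivity) ?_ n
  have h1 : u ^ 2 / n ≤ t ^ 2 / n := by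
    have : u ^ 2 ≤ t ^ 2 := sq_le_sq.2 h
    gcongr
  have h0 : 0 ≤ u ^ 2 / n := by positivity
  set v := t ^ 2 / n
  set w := u ^ 2 / n
  have h2 : 1 + v ≤ (1 + w) * Real.exp (v - w) := by
    have := Real.add_one_le_exp (v - w)
    nlinarith
  calc _ ≤ (1 + w) * Real.exp (v - w) * Real.exp (-v) := by gcongr
    _ = _ := by rw [mul_assoc, ← Real.exp_add]; ring_nf

lemma hasDerivAt_gaussRatio {n : ℕ} (hn : 0 < n) (x : Cube n) (t : ℝ) :
    HasDerivAt (gaussRatio x) (-((1 / n * (t : ℂ) ^ 2 * (Complex.I * normSum x + t)) /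
      (1 + 1 / n * (t : ℂ) ^ 2)) * gaussRatio x t) t := by
  have h1 : HasDerivAt (fun t : ℝ => (rotPoly x).eval (t : ℂ))
      ((derivative (rotPoly x)).eval (t : ℂ)) t := ((rotPoly x).hasDerivAt (t : ℂ)).comp_ofReal
  have h2 : HasDerivAt (fun z : ℂ => Complex.exp (-(Complex.I * normSum x * z) - z ^ 2 / 2))
      (Complex.exp (-(Complex.I * normSum x * t) - (t : ℂ) ^ 2 / 2) *
        (-(Complex.I * normSum x) - t)) (t : ℂ) := by
    have := (((hasDerivAt_id (t : ℂ)).const_mul (Complex.I * normSum x)).neg.sub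
      ((hasDerivAt_pow 2 (t : ℂ)).div_const 2)).cexp
    refine this.congr_deriv ?_
    simp
  refine (h1.mul h2.comp_ofReal).congr_deriv ?_
  have h3 := congrArg (fun p : ℂ[X] => p.eval (t : ℂ)) (derivative_rotPoly hn x)
  simp only [eval_mul, eval_add, eval_one, eval_C, eval_pow, eval_X] at h3
  have h4 : (1 : ℂ) + 1 / n * (t : ℂ) ^ 2 ≠ 0 := by
    have : (1 : ℂ) + 1 / n * (t : ℂ) ^ 2 = ((1 + 1 / n * t ^ 2 : ℝ) : ℂ) := by push_cast; rfl
    rw [this, Complex.ofReal_ne_zero]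
    positivity
  rw [eq_div_of_mul_eq h4 (mul_comm _ _ |>.trans h3), gaussRatio]
  set E : ℂ := 1 / n
  have hW : E * (t : ℂ) ^ 2 = (1 + E * (t : ℂ) ^ 2) - 1 := by ring
  set W := 1 + E * (t : ℂ) ^ 2
  rw [hW]
  field_simp
  ring

/-- Variation of constants: for the partial sum `T` and the ratio `R`, the derivative of `1 - T/R`
is the residual divided by `(1 + u²/n)R`, and `1 - T/R` vanishes at `0` since `Q ≥ 1`. -/
lemma norm_gaussRatio_sub_edgeSum_le {n : ℕ} (hn : 0 < n) (x : Cube n) {Q D : ℕ} (hQ : 1 ≤ Q)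
    (hD : (edgePoly (Complex.I * normSum x) Q).natDegree ≤ D) (t : ℝ) :
    ‖gaussRatio x t - (edgeSum (Complex.I * normSum x) (1 / n) Q).eval (t : ℂ)‖ ≤
      (1 / n) ^ Q * ∑ i ∈ range (D + 1),
        i * ‖(edgePoly (Complex.I * normSum x) Q).coeff i‖ * |t| ^ i := by
  set a := Complex.I * normSum x with ha
  set T := edgeSum a (1 / n) Q with hT
  set r := edgePoly a Q with hr
  set B := ∑ i ∈ range (D + 1), i * ‖r.coeff i‖ * |t| ^ (i - 1) with hB
  have hBt : B * |t| = ∑ i ∈ range (D + 1), i * ‖r.coeff i‖ * |t| ^ i := by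
    rw [hB, sum_mul]
    refine sum_congr rfl fun i _ => ?_
    rcases i with _ | i
    · simp
    · rw [Nat.add_sub_cancel, pow_succ]; ring
  have hB0 : 0 ≤ B := sum_nonneg fun i _ => by positivity
  have hR0 : ∀ u, gaussRatio x u ≠ 0 := fun u => norm_pos_iff.1 (norm_gaussRatio_pos hn x u)
  have hd : ∀ u : ℝ, HasDerivAt (fun u : ℝ => 1 - T.eval (u : ℂ) / gaussRatio x u)
      ((1 / n : ℂ) ^ Q * (derivative r).eval (u : ℂ) /
        ((1 + 1 / n * (u : ℂ) ^ 2) * gaussRatio x u)) u := by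
    intro u
    have h1 : HasDerivAt (fun u : ℝ => T.eval (u : ℂ)) ((derivative T).eval (u : ℂ)) u :=
      (T.hasDerivAt (u : ℂ)).comp_ofReal
    refine ((h1.div (hasDerivAt_gaussRatio hn x u) (hR0 u)).const_sub 1).congr_deriv ?_
    have h2 := congrArg (fun p : ℂ[X] => p.eval (u : ℂ)) (edgeSum_ode a (1 / n) Q)
    simp only [eval_mul, eval_add, eval_one, eval_C, eval_pow, eval_X, eval_neg] at h2
    push_cast at h2
    rw [← hT, ← hr] at h2
    have h4 : (1 : ℂ) + 1 / n * (u : ℂ) ^ 2 ≠ 0 := by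
      have : (1 : ℂ) + 1 / n * (u : ℂ) ^ 2 = ((1 + 1 / n * u ^ 2 : ℝ) : ℂ) := by push_cast; rfl
      rw [this, Complex.ofReal_ne_zero]
      positivity
    have hRu := hR0 u
    rw [← ha]
    set E : ℂ := 1 / n
    set W := 1 + E * (u : ℂ) ^ 2 with hW
    have h5 : E ^ Q * (derivative r).eval (u : ℂ) =
        -(W * (derivative T).eval (u : ℂ) + E * (u : ℂ) ^ 2 * (a + u) * T.eval (u : ℂ)) := by
      rw [h2, neg_neg]
    rw [h5]
    field_simp
    ring
  -- Between `0` and `t` the modulus of `R` is smallest at `t`, so the denominator introduced here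
  -- is cancelled exactly when multiplying back by `R(t)`.
  have hy := Convex.norm_image_sub_le_of_norm_hasDerivWithin_le
    (f := fun u : ℝ => 1 - T.eval (u : ℂ) / gaussRatio x u)
    (C := (1 / n) ^ Q * B / ‖gaussRatio x t‖)
    (s := Set.uIcc 0 t) (x := 0) (y := t) (fun u _ => (hd u).hasDerivWithinAt)
    (fun u hu => by
      have hut : |u| ≤ |t| := by
        have := Set.abs_sub_left_of_mem_uIcc hu
        simpa using this
      have h1 := norm_derivative_eval_le hD (u := (u : ℂ)) (τ := |t|)
        (by rw [Complex.norm_real]; exact hut)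
      have h2 := norm_gaussRatio_le hn x hut
      have h3 : (1 : ℝ) ≤ ‖(1 : ℂ) + 1 / n * (u : ℂ) ^ 2‖ := by
        have : (1 : ℂ) + 1 / n * (u : ℂ) ^ 2 = ((1 + 1 / n * u ^ 2 : ℝ) : ℂ) := by push_cast; rfl
        rw [this, Complex.norm_real, Real.norm_eq_abs, abs_of_nonneg (by positivity)]
        have : 0 ≤ 1 / (n : ℝ) * u ^ 2 := by positivity
        linarith
      rw [norm_div, norm_mul, norm_mul, norm_pow, norm_div, norm_one, Complex.norm_natCast]
      have hp := norm_gaussRatio_pos hn x t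
      refine div_le_div₀ (by positivity) (mul_le_mul_of_nonneg_left h1 (by positivity)) hp ?_
      nlinarith [norm_nonneg (gaussRatio x u)])
    (convex_uIcc 0 t) Set.left_mem_uIcc Set.right_mem_uIcc
  have h0 : gaussRatio x 0 = 1 := by simp [gaussRatio, rotPoly_eval_zero]
  have hT0 : T.eval 0 = 1 := edgeSum_eval_zero a _ hQ
  simp only [Complex.ofReal_zero, h0, hT0, div_one, sub_self, sub_zero, Real.norm_eq_abs] at hy
  have hp := norm_gaussRatio_pos hn x t
  have e : gaussRatio x t - T.eval (t : ℂ) =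
      gaussRatio x t * (1 - T.eval (t : ℂ) / gaussRatio x t) := by
    rw [mul_sub, mul_one, mul_div_cancel₀ _ (hR0 t)]
  rw [← hBt, e, norm_mul]
  calc _ ≤ ‖gaussRatio x t‖ * ((1 / n) ^ Q * B / ‖gaussRatio x t‖ * |t|) := by gcongr
    _ = _ := by field_simp

end

end HiddenDirection

namespace HiddenDirection

noncomputable section

open Finset Polynomial MeasureTheory Filter

/-! ### The supremum of the witness -/

lemma fourierGauss_eq_sum_hermiteFT (j : ℕ) (s : ℝ) {p : ℂ[X]} {D : ℕ} (hD : p.natDegree ≤ D) :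
    fourierGauss (X * normHermiteC j * p) s =
      ∑ i ∈ range (D + 1), p.coeff i * hermiteFT j (i + 1) s := by
  conv_lhs => rw [p.as_sum_range_C_mul_X_pow' (Nat.lt_succ_of_le hD)]
  rw [mul_sum, fourierGauss, map_sum]
  refine sum_congr rfl fun i _ => ?_
  rw [hermiteFT, ← fourierGauss_C_mul, fourierGauss]
  congr 1
  ring

lemma exists_norm_fourierGauss_le (D : ℕ) : ∃ A : ℝ, 0 ≤ A ∧ ∀ (j : ℕ) (s Z M : ℝ) (p : ℂ[X]),
    1 ≤ Z → (4 * j + 1 : ℝ) ≤ Z ^ 2 → |s| ≤ Z → CoeffBound Z D M p →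
      ‖fourierGauss (X * normHermiteC j * p) s‖ ≤ A * (M * Z ^ D) := by
  choose A hA h using exists_norm_hermiteFT_succ_le
  refine ⟨∑ i ∈ range (D + 1), A i, sum_nonneg fun i _ => hA i, fun j s Z M p hZ hj hs hp => ?_⟩
  rw [fourierGauss_eq_sum_hermiteFT j s hp.1, sum_mul]
  refine (norm_sum_le _ _).trans (sum_le_sum fun i _ => ?_)
  rw [norm_mul]
  calc _ ≤ ‖p.coeff i‖ * (A i * Z ^ i) :=
        mul_le_mul_of_nonneg_left (h i j s Z hZ hj hs) (norm_nonneg _)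
    _ = A i * (‖p.coeff i‖ * Z ^ i) := by ring
    _ ≤ _ := mul_le_mul_of_nonneg_left (hp.2 i) (hA i)

lemma exists_sum_absGaussInt_le (D : ℕ) : ∃ A : ℝ, 0 ≤ A ∧ ∀ (j : ℕ) (Z M : ℝ) (p : ℂ[X]),
    1 ≤ Z → (4 * j + 1 : ℝ) ≤ Z ^ 2 → CoeffBound Z D M p →
      ∑ i ∈ range (D + 1), i * ‖p.coeff i‖ * absGaussInt (X ^ (i + 1) * normHermiteC j) ≤
        A * (M * Z ^ (D + 3)) := by
  choose A hA h using exists_absGaussInt_le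
  refine ⟨∑ i ∈ range (D + 1), i * A (i + 1), sum_nonneg fun i _ =>
    mul_nonneg (by positivity) (hA _), fun j Z M p hZ hj hp => ?_⟩
  rw [sum_mul]
  refine sum_le_sum fun i _ => ?_
  calc _ ≤ i * ‖p.coeff i‖ * (A (i + 1) * Z ^ (i + 1 + 2)) :=
        mul_le_mul_of_nonneg_left (h (i + 1) j Z hZ hj) (by positivity)
    _ = i * A (i + 1) * (‖p.coeff i‖ * Z ^ i * Z ^ 3) := by ring
    _ ≤ i * A (i + 1) * (M * Z ^ D * Z ^ 3) := by
      have := hp.2 i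
      have := hA (i + 1)
      gcongr
    _ = _ := by ring

/-- Writing `P(t) exp(-t²) = R(t) exp(ist - t²/2)`, the pointwise error of the expansion is
integrated against a Hermite function. -/
lemma norm_gaussInt_sub_fourierGauss_le {n : ℕ} (hn : 0 < n) (x : Cube n) (j : ℕ) {Q D : ℕ}
    (hQ : 1 ≤ Q) (hD : (edgePoly (Complex.I * normSum x) Q).natDegree ≤ D) :
    ‖gaussInt one_pos 0 (X * normHermiteC j * rotPoly x) -
      fourierGauss (X * normHermiteC j * edgeSum (Complex.I * normSum x) (1 / n) Q) (normSum x)‖ ≤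
        (1 / n) ^ Q * ∑ i ∈ range (D + 1), i * ‖(edgePoly (Complex.I * normSum x) Q).coeff i‖ *
          absGaussInt (X ^ (i + 1) * normHermiteC j) := by
  set a := Complex.I * normSum x with ha
  set T := edgeSum a (1 / n) Q with hT
  set r := edgePoly a Q with hr
  rw [gaussInt_apply, fourierGauss, gaussInt_apply,
    ← integral_sub (integrable_eval_mul_cexp one_pos 0 _) (integrable_eval_mul_cexp one_half_pos _ _)]
  have hi : ∀ i ∈ range (D + 1), Integrable fun t : ℝ => i * ‖r.coeff i‖ *
      (‖(X ^ (i + 1) * normHermiteC j).eval (t : ℂ)‖ * Real.exp (-t ^ 2 / 2)) := fun i _ =>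
    (integrable_norm_eval_mul_exp _).const_mul _
  have hsum : (1 / (n : ℝ)) ^ Q * ∑ i ∈ range (D + 1), i * ‖r.coeff i‖ *
      absGaussInt (X ^ (i + 1) * normHermiteC j) =
        ∫ t : ℝ, (1 / (n : ℝ)) ^ Q * ∑ i ∈ range (D + 1), i * ‖r.coeff i‖ *
          (‖(X ^ (i + 1) * normHermiteC j).eval (t : ℂ)‖ * Real.exp (-t ^ 2 / 2)) := by
    rw [integral_const_mul, integral_finsetSum _ hi]
    simp only [integral_const_mul, absGaussInt]
  rw [hsum]
  refine norm_integral_le_of_norm_le ((integrable_finsetSum _ hi).const_mul _)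
    (Eventually.of_forall fun t => ?_)
  have e : (X * normHermiteC j * rotPoly x).eval (t : ℂ) *
      Complex.exp (-((1 : ℝ) : ℂ) * (t : ℂ) ^ 2 + 0 * t) -
        (X * normHermiteC j * T).eval (t : ℂ) *
          Complex.exp (-((1 / 2 : ℝ) : ℂ) * (t : ℂ) ^ 2 + Complex.I * normSum x * t) =
      (t * (normHermiteC j).eval (t : ℂ)) * (gaussRatio x t - T.eval (t : ℂ)) *
        Complex.exp (-((1 / 2 : ℝ) : ℂ) * (t : ℂ) ^ 2 + Complex.I * normSum x * t) := by
    have h1 : Complex.exp (-((1 : ℝ) : ℂ) * (t : ℂ) ^ 2 + 0 * t) =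
        Complex.exp (-(Complex.I * normSum x * t) - (t : ℂ) ^ 2 / 2) *
          Complex.exp (-((1 / 2 : ℝ) : ℂ) * (t : ℂ) ^ 2 + Complex.I * normSum x * t) := by
      rw [← Complex.exp_add]
      congr 1
      push_cast
      ring
    rw [h1, gaussRatio]
    simp only [eval_mul, eval_X]
    ring
  rw [e, norm_mul, norm_mul, norm_cexp_half]
  have hb := norm_gaussRatio_sub_edgeSum_le hn x hQ hD t
  rw [← ha, ← hT, ← hr] at hb
  calc _ ≤ ‖(t : ℂ) * (normHermiteC j).eval (t : ℂ)‖ * ((1 / n) ^ Q * ∑ i ∈ range (D + 1),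
        i * ‖r.coeff i‖ * |t| ^ i) * Real.exp (-t ^ 2 / 2) := by gcongr
    _ = _ := by
      rw [mul_left_comm, mul_assoc, mul_sum, sum_mul]
      congr 1
      refine sum_congr rfl fun i _ => ?_
      simp only [eval_mul, eval_pow, eval_X, norm_mul, norm_pow, Complex.norm_real,
        Real.norm_eq_abs]
      ring

/-- The witness is bounded at points whose normalized sum is at most `Z`, if `Z⁴ ≤ n`. -/
lemma exists_abs_avgWitness_le_of_small {Q : ℕ} (hQ : 1 ≤ Q) : ∃ K : ℝ, 0 ≤ K ∧
    ∀ (n h k : ℕ) (Z : ℝ), n = 2 * h + 1 → 1 ≤ Z → (4 * k + 5 : ℝ) ≤ Z ^ 2 → Z ^ 4 ≤ n →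
      ∀ x : Cube n, |normSum x| ≤ Z → |avgWitness k n x| ≤ K * (1 + (Z ^ 4 / n) ^ Q * Z ^ 3) := by
  choose M hM hedge using exists_coeffBound_edgePoly
  choose A hA hmain using fun q : ℕ => exists_norm_fourierGauss_le (4 * q)
  obtain ⟨B, hB, hrem⟩ := exists_sum_absGaussInt_le (4 * Q)
  have hK : 0 ≤ ∑ q ∈ range Q, A q * M q := sum_nonneg fun q _ => mul_nonneg (hA q) (hM q)
  refine ⟨∑ q ∈ range Q, A q * M q + B * M Q, add_nonneg hK (mul_nonneg hB (hM Q)),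
    fun n h k Z hn hZ hk hZn x hx => ?_⟩
  have hn0 : 0 < n := by omega
  have hn1 : (0 : ℝ) < n := by exact_mod_cast hn0
  have hZ0 : 0 < Z := zero_lt_one.trans_le hZ
  set a := Complex.I * normSum x with ha
  have haZ : ‖a‖ ≤ Z := by
    rw [ha, norm_mul, Complex.norm_I, one_mul, Complex.norm_real]; exact hx
  have hj : (4 * ((k + 1 : ℕ) : ℝ) + 1) ≤ Z ^ 2 := by push_cast; linarith
  have h1 := norm_gaussInt_sub_fourierGauss_le hn0 x (k + 1) hQ (hedge Q Z a hZ haZ).1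
  rw [gaussInt_mul_rotPoly hn, ← ha] at h1
  have h2 := hrem (k + 1) Z (M Q) _ hZ hj (hedge Q Z a hZ haZ)
  -- Order `q` contributes a constant times `(Z⁴/n)^q ≤ 1`, so the main terms stay bounded; the
  -- remainder carries the additional `Z³` from the cruder absolute integrals.
  have h3 : ‖fourierGauss (X * normHermiteC (k + 1) * edgeSum a (1 / n) Q) (normSum x)‖ ≤
      ∑ q ∈ range Q, A q * M q := by
    rw [edgeSum, mul_sum, fourierGauss, map_sum]
    refine (norm_sum_le _ _).trans (sum_le_sum fun q _ => ?_)
    have h4 := hmain q (k + 1) (normSum x) Z (M q) _ hZ hj hx (hedge q Z a hZ haZ)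
    rw [mul_left_comm, ← fourierGauss, fourierGauss_C_mul, norm_mul]
    have e : ‖((1 / n : ℝ) : ℂ) ^ q‖ = (1 / n : ℝ) ^ q := by
      rw [norm_pow, Complex.norm_real, Real.norm_eq_abs, abs_of_nonneg (by positivity)]
    rw [e]
    calc _ ≤ (1 / n : ℝ) ^ q * (A q * (M q * Z ^ (4 * q))) := by gcongr
      _ = A q * M q * (Z ^ 4 / n) ^ q := by
        rw [pow_mul, div_pow, div_pow, one_pow]; ring
      _ ≤ A q * M q * 1 := by
        refine mul_le_mul_of_nonneg_left (pow_le_one₀ (by positivity) ?_)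
          (mul_nonneg (hA q) (hM q))
        rw [div_le_one hn1]
        exact hZn
      _ = _ := mul_one _
  have h5 := norm_le_norm_add_norm_sub' (2 * Complex.I * (avgWitness k n x : ℂ))
    (fourierGauss (X * normHermiteC (k + 1) * edgeSum a (1 / n) Q) (normSum x))
  have e : ‖2 * Complex.I * (avgWitness k n x : ℂ)‖ = 2 * |avgWitness k n x| := by simp
  rw [e] at h5
  have h6 : (1 / (n : ℝ)) ^ Q * (B * (M Q * Z ^ (4 * Q + 3))) =
      B * M Q * ((Z ^ 4 / n) ^ Q * Z ^ 3) := by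
    rw [pow_add, pow_mul, div_pow, div_pow, one_pow]; ring
  have h7 := h1.trans ((mul_le_mul_of_nonneg_left h2 (by positivity)).trans_eq h6)
  have hBM := mul_nonneg hB (hM Q)
  have hE : 0 ≤ (Z ^ 4 / n) ^ Q * Z ^ 3 := by positivity
  have := mul_nonneg hK hE
  have := abs_nonneg (avgWitness k n x)
  nlinarith

end

end HiddenDirection

/-! ### Uniform bound on the maximum norm from the two regimes -/

namespace HiddenDirection

noncomputable section

open Finset Polynomial MeasureTheory Filter

lemma exists_iSup_abs_avgWitness_le {c₀ η : ℝ} (hc : 0 < c₀) (hη : 0 < η) :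
    ∃ n₀ : ℕ, 1 ≤ n₀ ∧ ∃ K : ℝ, 0 < K ∧ ∀ n h k m : ℕ, n = 2 * h + 1 → n₀ ≤ n → 1 ≤ k → k ≤ m →
      (m : ℝ) ≤ c₀ * (n : ℝ) ^ (1 / 2 - η) →
        k ≤ h ∧ 16 * k ^ 2 ≤ n ∧ ⨆ z : Cube n, |avgWitness k n z| ≤ K := by
  -- Enough orders that `n^{-2ηQ}` compensates a full factor `n`, which is what the `Z³` in the
  -- remainder requires.
  obtain ⟨Q, hQ⟩ := exists_nat_ge (1 / (2 * η))
  have hQη : 1 ≤ 2 * η * Q := by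
    rw [div_le_iff₀ (by positivity)] at hQ
    linarith
  have hQ1 : 1 ≤ Q := by
    by_contra hlt
    have : Q = 0 := by omega
    rw [this] at hQη
    norm_num at hQη
  obtain ⟨K₁, hK₁, hlarge⟩ := exists_abs_avgWitness_le_of_large
  obtain ⟨K₂, hK₂, hsmall⟩ := exists_abs_avgWitness_le_of_small hQ1
  set B : ℝ := (144 * c₀) ^ 2 with hB
  have hB0 : 0 < B := by positivity
  have hev : ∀ᶠ n : ℕ in atTop, B * (n : ℝ) ^ (-(2 * η)) ≤ 1 := by
    have h1 : Tendsto (fun n : ℕ => B * (n : ℝ) ^ (-(2 * η))) atTop (nhds (B * 0)) :=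
      ((tendsto_rpow_neg_atTop (by positivity)).comp tendsto_natCast_atTop_atTop).const_mul B
    rw [mul_zero] at h1
    exact (h1.eventually (gt_mem_nhds zero_lt_one)).mono fun n hn => hn.le
  obtain ⟨n₀, hn₀⟩ := eventually_atTop.1 hev
  refine ⟨max n₀ 1, le_max_right _ _, K₁ + K₂ * (1 + B ^ (Q + 1)) + 1, by positivity,
    fun n h k m hn hnn hk hkm hm => ?_⟩
  have hBn := hn₀ n ((le_max_left _ _).trans hnn)
  have hn1 : (1 : ℝ) ≤ n := by exact_mod_cast (le_max_right _ _).trans hnn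
  have hn0 : (0 : ℝ) < n := zero_lt_one.trans_le hn1
  have hk1 : (1 : ℝ) ≤ k := by exact_mod_cast hk
  have hkm' : (k : ℝ) ≤ m := by exact_mod_cast hkm
  -- The threshold of the large regime. For `k ≥ 1` one has `Z² = 16(4k+5) ≤ 144k`, the source of
  -- `144c₀` in `B`.
  set Z := 4 * √(4 * (k : ℝ) + 5) with hZ
  have hZ2 : Z ^ 2 = 16 * (4 * k + 5) := by
    rw [hZ, mul_pow, Real.sq_sqrt (by positivity)]; norm_num
  have hZ0 : 0 ≤ Z := by positivity
  have hZ1 : 1 ≤ Z := le_of_sq_le_sq (by rw [hZ2]; linarith) hZ0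
  have hZ4 : Z ^ 4 / n ≤ B * (n : ℝ) ^ (-(2 * η)) := by
    rw [div_le_iff₀ hn0]
    have h1 : Z ^ 2 ≤ 144 * (c₀ * (n : ℝ) ^ (1 / 2 - η)) := by rw [hZ2]; linarith
    calc Z ^ 4 = (Z ^ 2) ^ 2 := by ring
      _ ≤ (144 * (c₀ * (n : ℝ) ^ (1 / 2 - η))) ^ 2 := by gcongr
      _ = B * ((n : ℝ) ^ (1 / 2 - η)) ^ 2 := by rw [hB]; ring
      _ = B * ((n : ℝ) ^ (-(2 * η)) * n) := by
        rw [← Real.rpow_natCast, ← Real.rpow_mul hn0.le]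
        nth_rewrite 3 [← Real.rpow_one (n : ℝ)]
        rw [← Real.rpow_add hn0]
        congr 2
        push_cast
        ring
      _ = _ := by ring
  have hZn : Z ^ 4 ≤ n := by
    have := hZ4.trans hBn
    rwa [div_le_one hn0] at this
  have h16 : 16 * k ^ 2 ≤ n := by
    have h1 : Z ^ 4 = (16 * (4 * k + 5)) ^ 2 := by rw [← hZ2]; ring
    rw [h1] at hZn
    have : (16 * (k : ℝ) ^ 2) ≤ n := by nlinarith
    exact_mod_cast this
  have hkh : k ≤ h := by
    have : k ≤ k ^ 2 := Nat.le_self_pow two_ne_zero k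
    omega
  refine ⟨hkh, h16, ciSup_le fun x => ?_⟩
  rcases le_total Z |normSum x| with hx | hx
  · have := hlarge n h k hn x hx
    have : 0 ≤ K₂ * (1 + B ^ (Q + 1)) := by positivity
    linarith
  · have h1 := hsmall n h k Z hn hZ1 (by rw [hZ2]; linarith) hZn x hx
    have h2 : (Z ^ 4 / n) ^ Q * Z ^ 3 ≤ B ^ (Q + 1) := by
      have h3 : Z ^ 3 ≤ B * n := by
        calc Z ^ 3 ≤ Z ^ 4 := pow_le_pow_right₀ hZ1 (by norm_num)
          _ = Z ^ 4 / n * n := by field_simp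
          _ ≤ B * (n : ℝ) ^ (-(2 * η)) * n := by gcongr
          _ ≤ B * 1 * n := by
            have := Real.rpow_le_one_of_one_le_of_nonpos hn1 (show -(2 * η) ≤ 0 by linarith)
            gcongr
          _ = _ := by ring
      have h4 : ((n : ℝ) ^ (-(2 * η))) ^ Q * n ≤ 1 := by
        rw [← Real.rpow_natCast, ← Real.rpow_mul hn0.le]
        nth_rewrite 2 [← Real.rpow_one (n : ℝ)]
        rw [← Real.rpow_add hn0]
        exact Real.rpow_le_one_of_one_le_of_nonpos hn1 (by linarith)
      calc _ ≤ (B * (n : ℝ) ^ (-(2 * η))) ^ Q * (B * n) := by gcongr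
        _ = B ^ (Q + 1) * (((n : ℝ) ^ (-(2 * η))) ^ Q * n) := by ring
        _ ≤ B ^ (Q + 1) * 1 := by gcongr
        _ = _ := mul_one _
    have h5 : K₂ * (1 + (Z ^ 4 / n) ^ Q * Z ^ 3) ≤ K₂ * (1 + B ^ (Q + 1)) := by gcongr
    linarith

end

end HiddenDirection

theorem mainTheorem4 :
    -- the absolute constants
    ∃ A : ℝ, 0 < A ∧ ∃ C : ℕ → ℝ, (∀ p : ℕ, 1 ≤ p → 0 < C p ∧ C p ≤ A ^ p) ∧
    ∃ c : ℝ, 0 < c ∧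
    ∀ c₀ : ℝ, 0 < c₀ → ∀ η : ℝ, 0 < η → η < 1 / 2 →
    -- the constants that depend on `c₀` and `η` only
    ∃ n₀ : ℕ, 1 ≤ n₀ ∧ ∃ K : ℝ, 0 < K ∧
    ∀ ρ : ℝ, 0 < ρ → ρ < 1 →
    ∀ n : ℕ, Odd n → n₀ ≤ n →
    ∀ m : ℕ, 1 ≤ m → (m : ℝ) ≤ c₀ * (n : ℝ) ^ (1 / 2 - η) →
    ∀ k : ℕ, k = (m + 1) / 2 →
      -- the family is well defined: the witness can be normalized, and `D_0` and all `D_u` are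
      -- probability distributions
      ((∃ x : Cube n, avgWitness k n x ≠ 0) ∧ IsProbMass (refDist n) ∧
        ∀ u : Cube n, IsProbMass (plantedDist k n u)) ∧
      -- (i)
      (∀ u : Cube n,
        K * ρ ^ (2 * m + 1) / Real.sqrt m ≤
          expect (plantedDist k n u) (fun z => sgn z.2 * smoothedHalfspace ρ u z.1)) ∧
      -- (ii), where truncated subtraction gives the exponent `max {0, 2k + 1 - 2p}`
      (∀ δ : ℝ, 0 < δ → δ ≤ 1 → ∀ u v : Cube n, u ≠ v → |dot u v| ≤ δ * n →
        pairCorr (refDist n) (plantedDist k n u) (plantedDist k n v) ≤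
          δ ^ (2 * k + 1) +
            ∑ p ∈ Finset.Icc 1 (k + 1),
              C p * ((k : ℝ) ^ (2 * p) / (n : ℝ) ^ p) * δ ^ (2 * k + 1 - 2 * p)) ∧
      -- (iii)
      (∀ δ : ℝ, 0 < δ → δ < 1 →
        ∃ U : Finset (Cube n), ⌊Real.exp (c * δ ^ 2 * n)⌋₊ ≤ U.card ∧
          ∀ u ∈ U, ∀ v ∈ U, u ≠ v → |dot u v| ≤ δ * n) := by
  refine ⟨48 * 12000 ^ 2, by norm_num, fun p => (48 * 12000 ^ 2) ^ p,
    fun p _ => ⟨by positivity, le_rfl⟩, 1 / 4, by norm_num, fun c₀ hc₀ η hη _ => ?_⟩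
  obtain ⟨n₀, hn₀, K, hK, hsup⟩ := exists_iSup_abs_avgWitness_le hc₀ hη
  refine ⟨n₀, hn₀, 1 / 128 / K, by positivity, fun ρ hρ hρ1 n hodd hn m hm hmn k hk => ?_⟩
  obtain ⟨h, hnh⟩ := hodd
  have hk1 : 1 ≤ k := by omega
  have hkm : k ≤ m := by omega
  obtain ⟨hkh, h16, hle⟩ := hsup n h k m hnh hn hk1 hkm hmn
  refine ⟨⟨exists_avgWitness_ne_zero hnh hkh, isProbMass_refDist n, isProbMass_plantedDist k n⟩,
    fun u => ?_, fun δ hδ hδ1 u v _ huv => pairCorr_le hnh hk1 hkh hδ.le hδ1 huv,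
    fun δ hδ hδ1 => exists_nearly_orthogonal (by omega) hδ hδ1⟩
  -- The proved lower bound contains `1/N`; the uniform bound `N ≤ K` makes it a constant depending
  -- on `c₀` and `η` only.
  refine le_trans ?_ (le_expect_plantedDist hnh hk1 hkm (by omega) h16 hρ hρ1 u)
  have hpos := iSup_abs_avgWitness_pos hnh hkh
  gcongr
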